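/- **Conventions.** Let $k,l,m,n\ge 0$ be integers. A superspace is a topological space with a sheaf of $\mathbb Z_2$-graded real algebras; a morphism is a continuous map together with a pullback morphism of sheaves of $\mathbb Z_2$-graded algebras. A supermanifold (of some dimension $p|q$) is a Hausdorff, second countable superspace that is locally isomorphic to open parts of $\mathbb R^{p|q}=(\mathbb R^p, C^\infty\otimes\bigwedge\mathbb R^q)$. Write $M(T)=\mathrm{Hom}(T,M)$ and $\mathcal O(T)$ for the algebra of global sections on $T$. $GL(m|n)$ is the open part of the superdomain of even $m|n\times m|n$ supermatrices lying over $GL(\mathbb R^m)\times GL(\mathbb R^n)$; a $T$-point $P$ of it is described by the supermatrix over $\mathcal O(T)$ of the pullbacks of the coordinates, again denoted $P$. A $k|l$-index $I|R$ consists of a set $I$ of $k$ of the $m$ even column indices and a set $R$ of $l$ of the $n$ odd ones. For a $k|l\times m|n$ supermatrix $B$ let $M_{I|R}(B)$ be the square submatrix of the columns in $I\cup R$, and $D_{I|R}(B)$ the matrix of the other columns. Let $U_{I|R}=\mathbb R^{\alpha|\beta}$, $\alpha=k(m-k)+l(n-l)$, $\beta=l(m-k)+k(n-l)$, with its even (odd)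 coordinates placed in the even (odd) blocks of a $k|l\times m|n$ supermatrix $A_{I|R}$ outside the columns in $I\cup R$, those columns forming an identity matrix. For $X\in U_{I|R}(T)$ let $\tilde X$ be the supermatrix over $\mathcal O(T)$ obtained from $A_{I|R}$ by pulling back the coordinates along $X$. A $T$-point $Y$ of $U_{J|S}$ is said to have coordinates $C$ if $D_{J|S}(\tilde Y)=C$. Let $U_{I|R}\cap U_{J|S}$ be the open part of $U_{I|R}$ where $M_{J|S}(A_{I|R})$ is invertible. A transition map is a morphism $g_{J|S,I|R}\colon U_{I|R}\cap U_{J|S}\to U_{J|S}$ that pulls $D_{J|S}(A_{J|S})$ back to $D_{J|S}\big((M_{J|S}(A_{I|R}))^{-1}A_{I|R}\big)$, and $G=G_{k|l}(m|n)$ is the superspace obtained by gluing all $U_{I|R}$ along the transition maps. **Proposition.** There is exactly one family of transition maps $g_{J|S,I|R}$, and with $G=G_{k|l}(m|n)$ glued along it the following holds. 1. Let $T$ be a supermanifold and $P\in GL(m|n)(T)$. Let $U_{I|R}^{J|S}(T)$ be the set of all $X\in U_{I|R}(T)$ for which $M_{J|S}(\tilde XP)$ is invertible. Then the local maps $$\mathbf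 A_{I|R}^{J|S}\colon U_{I|R}^{J|S}(T)\to U_{J|S}(T),\qquad X\mapsto D_{J|S}\big((M_{J|S}(\tilde XP))^{-1}\tilde XP\big)$$ are well defined (there is exactly one $T$-point with these coordinates). For all $k|l$-indices $I|R$, $J|S$, $K|Q$, $H|L$ and every $T$-point $X$ of $U_{I|R}\cap U_{K|Q}$ with $X\in U_{I|R}^{J|S}(T)$ and $(g_{K|Q,I|R})_T(X)\in U_{K|Q}^{H|L}(T)$, the point $\mathbf A_{I|R}^{J|S}(X)$ lies in $(U_{J|S}\cap U_{H|L})(T)$ and $$(g_{H|L,J|S})_T\big(\mathbf A_{I|R}^{J|S}(X)\big)=\mathbf A_{K|Q}^{H|L}\big((g_{K|Q,I|R})_T(X)\big).$$ The refined pieces cover $G(T)$ locally on $T$: for every $x\in G(T)$ and every point $t$ of $T$ there are an open $V\ni t$ and indices $I|R$, $J|S$ such that $x|_V$ is the image in $G(V)$ of an element of $U_{I|R}^{J|S}(V)$ (formed with $P|_V$). 2. For every supermanifold $T$, taking the supermatrix is a bijection of $GL(m|n)(T)$ onto the invertible even $m|n\times m|n$ supermatrices over $\mathcal O(T)$. 3.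 There is exactly one family of maps $a_T\colon G(T)\times GL(m|n)(T)\to G(T)$, $T$ ranging over all supermanifolds, that is glued from the local maps: whenever $V\subset T$ is open and $x|_V$ is the image of $X\in U_{I|R}^{J|S}(V)$, then $a_T(x,P)|_V$ is the image of $\mathbf A_{I|R}^{J|S}(X)$, formed with $P|_V$. This family is natural in $T$, and every $a_T$ is a right action of the group $GL(m|n)(T)$, whose product is the product of supermatrices. If $N$ with projections $p,q$ is a product $G\times GL(m|n)$ in the category of supermanifolds, there is exactly one morphism $a\colon N\to G$ that induces it, that is, $a\circ h=a_T(p\circ h,q\circ h)$ for all supermanifolds $T$ and all $h\colon T\to N$. -/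

import Mathlib

open CategoryTheory TopologicalSpace
open scoped ContDiff

noncomputable section

namespace Super

/-! ### Superspaces: spaces with a sheaf of `ℤ/2`-graded real algebras -/

/-- A topological space with a sheaf `sec` of `ℤ/2`-graded associative unital real algebras
(the grading is given by the complementary subspaces `parity U 0` and `parity U 1`). -/
structure SuperSpace where
  carrier : Type
  [top : TopologicalSpace carrier]
  sec : Opens carrier → Type
  [ring : ∀ U, Ring (sec U)]
  [algebra : ∀ U, Algebra ℝ (sec U)]
  parity : ∀ U, ZMod 2 → Submodule ℝ (sec U)
  one_mem_parity : ∀ U, (1 : sec U) ∈ parity U 0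
  mul_mem_parity : ∀ U (i j : ZMod 2) (a b : sec U),
    a ∈ parity U i → b ∈ parity U j → a * b ∈ parity U (i + j)
  isCompl_parity : ∀ U, IsCompl (parity U 0) (parity U 1)
  res : ∀ {U V : Opens carrier}, U ≤ V → (sec V →ₐ[ℝ] sec U)
  res_parity : ∀ {U V : Opens carrier} (h : U ≤ V) (i : ZMod 2) (a : sec V),
    a ∈ parity V i → res h a ∈ parity U i
  res_self : ∀ (U : Opens carrier) (a : sec U), res (le_refl U) a = a
  res_res : ∀ {U V W : Opens carrier} (h : U ≤ V) (h' : V ≤ W) (a : sec W),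
    res h (res h' a) = res (h.trans h') a
  existsUnique_glue : ∀ {ι : Type} (W : Opens carrier) (U : ι → Opens carrier)
    (hle : ∀ i, U i ≤ W) (_ : W ≤ ⨆ i, U i) (s : ∀ i, sec (U i)),
    (∀ i j, res (inf_le_left : U i ⊓ U j ≤ U i) (s i) =
      res (inf_le_right : U i ⊓ U j ≤ U j) (s j)) →
    ∃! t : sec W, ∀ i, res (hle i) t = s i

attribute [instance] SuperSpace.top SuperSpace.ring SuperSpace.algebra

namespace SuperSpace

/-- The preimage of an open set under a continuous map. -/
def pre {X Y : Type} [TopologicalSpace X] [TopologicalSpace Y] (f : X → Y) (hf : Continuous f)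
    (U : Opens Y) : Opens X :=
  ⟨f ⁻¹' U, U.isOpen.preimage hf⟩

/-- A morphism of superspaces: a continuous map with a pullback morphism of sheaves of
`ℤ/2`-graded algebras. -/
structure Hom (M N : SuperSpace) where
  base : M.carrier → N.carrier
  continuous_base : Continuous base
  app : ∀ U : Opens N.carrier, N.sec U →ₐ[ℝ] M.sec (pre base continuous_base U)
  app_parity : ∀ (U : Opens N.carrier) (i : ZMod 2) (a : N.sec U),
    a ∈ N.parity U i → app U a ∈ M.parity _ i
  app_res : ∀ {U V : Opens N.carrier} (h : U ≤ V) (a : N.sec V),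
    app U (N.res h a) = M.res (fun _ hx => h hx) (app V a)

instance : Category SuperSpace where
  Hom := Hom
  id M :=
    { base := id
      continuous_base := continuous_id
      app := fun U => AlgHom.id ℝ (M.sec U)
      app_parity := fun _ _ _ h => h
      app_res := fun _ _ => rfl }
  comp {M N K} f g :=
    { base := g.base ∘ f.base
      continuous_base := g.continuous_base.comp f.continuous_base
      app := fun U => (f.app (pre g.base g.continuous_base U)).comp (g.app U)
      app_parity := fun U i a h => f.app_parity _ i _ (g.app_parity U i a h)
      app_res := fun {U V} h a =>
        (congrArg (f.app (pre g.base g.continuous_base U)) (g.app_res h a)).trans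
          (f.app_res (fun _ hx => h hx) (g.app V a)) }

/-- The pullback of a global section. -/
def pull {M N : SuperSpace} (f : M ⟶ N) (s : N.sec ⊤) : M.sec ⊤ :=
  M.res (U := ⊤) (V := pre f.base f.continuous_base ⊤) (fun _ _ => trivial) (f.app ⊤ s)

/-- The image in `M` of an open subset of the open subset `D` of `M`. -/
def img {X : Type} [TopologicalSpace X] (D : Opens X) (W : Opens D) : Opens X :=
  ⟨Subtype.val '' (W : Set D), D.isOpen.isOpenMap_subtype_val _ W.isOpen⟩

lemma img_mono {X : Type} [TopologicalSpace X] (D : Opens X) {W W' : Opens D} (h : W ≤ W') :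
    img D W ≤ img D W' :=
  Set.image_mono h

lemma eq_of_cover (M : SuperSpace) {ι : Type} {W : Opens M.carrier} {U : ι → Opens M.carrier}
    (hle : ∀ i, U i ≤ W) (hcov : W ≤ ⨆ i, U i) {a b : M.sec W}
    (h : ∀ i, M.res (hle i) a = M.res (hle i) b) : a = b := by
  obtain ⟨t, -, ht⟩ := M.existsUnique_glue W U hle hcov (fun i => M.res (hle i) a)
    (fun i j => by rw [M.res_res, M.res_res])
  rw [ht a (fun _ => rfl), ht b (fun i => (h i).symm)]

lemma eq_of_add_eq (M : SuperSpace) {W : Opens M.carrier} {a a' b b' : M.sec W}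
    (ha : a ∈ M.parity W 0) (ha' : a' ∈ M.parity W 0) (hb : b ∈ M.parity W 1)
    (hb' : b' ∈ M.parity W 1) (h : a + b = a' + b') : a = a' ∧ b = b' := by
  have hs : a - a' = b' - b := by
    rw [sub_eq_sub_iff_add_eq_add, add_comm b']
    exact h
  have z := Submodule.disjoint_def.1 (M.isCompl_parity W).disjoint _
    (Submodule.sub_mem _ ha ha') (hs ▸ Submodule.sub_mem _ hb' hb)
  exact ⟨sub_eq_zero.1 z, (sub_eq_zero.1 (hs ▸ z)).symm⟩

/-- The open sub-superspace on an open subset `D`. -/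
def restrict (M : SuperSpace) (D : Opens M.carrier) : SuperSpace where
  carrier := D
  sec W := M.sec (img D W)
  parity W := M.parity (img D W)
  one_mem_parity _ := M.one_mem_parity _
  mul_mem_parity _ := M.mul_mem_parity _
  isCompl_parity _ := M.isCompl_parity _
  res h := M.res (img_mono D h)
  res_parity _ := M.res_parity _
  res_self _ := M.res_self _
  res_res _ _ := M.res_res _ _
  existsUnique_glue W U hle hcov s hs := by
    refine M.existsUnique_glue (img D W) (fun i => img D (U i)) (fun i => img_mono D (hle i)) ?_ s ?_
    · rintro _ ⟨x, hx, rfl⟩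
      obtain ⟨i, hi⟩ := Opens.mem_iSup.1 (hcov hx)
      exact Opens.mem_iSup.2 ⟨i, x, hi, rfl⟩
    · intro i j
      have key : img D (U i) ⊓ img D (U j) ≤ img D (U i ⊓ U j) := by
        rintro _ ⟨⟨x, hx, rfl⟩, ⟨y, hy, hxy⟩⟩
        have : y = x := Subtype.ext hxy
        subst this
        exact ⟨y, ⟨hx, hy⟩, rfl⟩
      have h := congrArg (M.res key) (hs i j)
      rw [M.res_res, M.res_res] at h
      exact h

/-- The inclusion of an open sub-superspace. -/
def incl (M : SuperSpace) (D : Opens M.carrier) : M.restrict D ⟶ M where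
  base := Subtype.val
  continuous_base := continuous_subtype_val
  app _ := M.res (by rintro _ ⟨x, hx, rfl⟩; exact hx)
  app_parity _ _ _ h := M.res_parity _ _ _ h
  app_res h a := by
    change M.res _ (M.res _ a) = M.res _ (M.res _ a)
    rw [M.res_res, M.res_res]

end SuperSpace

open SuperSpace

/-! ### Superdomains and supermanifolds -/

/-- The exterior algebra on (anticommuting) generators indexed by `O`. -/
abbrev Ext (O : Type) : Type := ExteriorAlgebra ℝ (O → ℝ)

/-- The even (`i = 0`) and odd (`i = 1`) part of the exterior algebra. -/
abbrev extParity (O : Type) (i : ZMod 2) : Submodule ℝ (Ext O) :=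
  CliffordAlgebra.evenOdd (0 : QuadraticForm ℝ (O → ℝ)) i

/-- The extension by zero of a real function on an open set. -/
def extendZero {X : Type} [TopologicalSpace X] (U : Opens X) (f : U → ℝ) : X → ℝ :=
  Function.extend Subtype.val f 0

lemma extendZero_apply {X : Type} [TopologicalSpace X] {U : Opens X} (f : U → ℝ) (x : U) :
    extendZero U f x.1 = f x :=
  Subtype.val_injective.extend_apply _ _ _

/-- A real function on an open subset of `ℝ^E` is smooth. -/
def SmoothReal {E : Type} [Fintype E] (U : Opens (E → ℝ)) (f : U → ℝ) : Prop :=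
  ∀ x : U, ContDiffAt ℝ ∞ (extendZero U f) x.1

/-- A function with values in the finite-dimensional space `⋀ℝ^O` is smooth, that is, all its
components are smooth. These functions are the elements of `C^∞(U) ⊗ ⋀ℝ^O`. -/
def SmoothExt {E O : Type} [Fintype E] (U : Opens (E → ℝ)) (f : U → Ext O) : Prop :=
  ∀ l : Ext O →ₗ[ℝ] ℝ, SmoothReal U (fun x => l (f x))

section smooth

variable {E O : Type} [Fintype E] {U : Opens (E → ℝ)}

lemma SmoothReal.of_local {f : U → ℝ}
    (h : ∀ x : U, ∃ g : (E → ℝ) → ℝ, ContDiffAt ℝ ∞ g x.1 ∧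
      ∃ W : Opens (E → ℝ), x.1 ∈ W ∧ ∀ y : U, y.1 ∈ W → f y = g y.1) : SmoothReal U f := by
  intro x
  obtain ⟨g, hg, W, hxW, hW⟩ := h x
  refine hg.congr_of_eventuallyEq ?_
  filter_upwards [U.isOpen.mem_nhds x.2, W.isOpen.mem_nhds hxW] with y hy hyW
  rw [← hW ⟨y, hy⟩ hyW, ← extendZero_apply f ⟨y, hy⟩]

lemma SmoothReal.of_contDiff {g : (E → ℝ) → ℝ} (hg : ContDiff ℝ ∞ g) :
    SmoothReal U (fun x => g x.1) :=
  SmoothReal.of_local fun _ => ⟨g, hg.contDiffAt, ⊤, trivial, fun _ _ => rfl⟩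

lemma SmoothReal.add {f g : U → ℝ} (hf : SmoothReal U f) (hg : SmoothReal U g) :
    SmoothReal U (fun x => f x + g x) :=
  SmoothReal.of_local fun x => ⟨_, (hf x).add (hg x), ⊤, trivial, fun y _ => by
    simp only [extendZero_apply]⟩

lemma SmoothReal.mul {f g : U → ℝ} (hf : SmoothReal U f) (hg : SmoothReal U g) :
    SmoothReal U (fun x => f x * g x) :=
  SmoothReal.of_local fun x => ⟨_, (hf x).mul (hg x), ⊤, trivial, fun y _ => by
    simp only [extendZero_apply]⟩

lemma SmoothReal.sum {κ : Type} (s : Finset κ) {f : κ → U → ℝ} (h : ∀ i, SmoothReal U (f i)) :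
    SmoothReal U (fun x => ∑ i ∈ s, f i x) :=
  SmoothReal.of_local fun x => ⟨_, ContDiffAt.sum (s := s) (fun i _ => h i x), ⊤, trivial,
    fun y _ => by simp only [extendZero_apply]⟩

lemma SmoothReal.res {V : Opens (E → ℝ)} (h : V ≤ U) {f : U → ℝ} (hf : SmoothReal U f) :
    SmoothReal V (fun x => f ⟨x.1, h x.2⟩) :=
  SmoothReal.of_local fun x => ⟨_, hf ⟨x.1, h x.2⟩, ⊤, trivial, fun y _ => by
    rw [← extendZero_apply f ⟨y.1, h y.2⟩]⟩

lemma exists_finite_basis (O : Type) [Fintype O] :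
    ∃ (κ : Type) (_ : Fintype κ), Nonempty (Module.Basis κ ℝ (Ext O)) := by
  let b : Module.Basis (Fin (Fintype.card O)) ℝ (O → ℝ) :=
    (Pi.basisFun ℝ O).reindex (Fintype.equivFin O)
  exact ⟨_, inferInstance, ⟨b.ExteriorAlgebra⟩⟩

lemma SmoothExt.const (c : Ext O) : SmoothExt U (fun _ => c) := fun l =>
  SmoothReal.of_contDiff (g := fun _ => l c) contDiff_const

lemma SmoothExt.add {f g : U → Ext O} (hf : SmoothExt U f) (hg : SmoothExt U g) :
    SmoothExt U (fun x => f x + g x) := fun l => by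
  simpa only [map_add] using (hf l).add (hg l)

lemma SmoothExt.linear (φ : Ext O →ₗ[ℝ] Ext O) {f : U → Ext O} (hf : SmoothExt U f) :
    SmoothExt U (fun x => φ (f x)) := fun l => hf (l ∘ₗ φ)

lemma SmoothExt.mul [Fintype O] {f g : U → Ext O} (hf : SmoothExt U f) (hg : SmoothExt U g) :
    SmoothExt U (fun x => f x * g x) := fun l => by
  obtain ⟨κ, _, ⟨b⟩⟩ := exists_finite_basis O
  have h : ∀ x, l (f x * g x) =
      ∑ i, ∑ j, (b.coord i (f x) * b.coord j (g x)) * l (b i * b j) := by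
    intro x
    conv_lhs => rw [← b.sum_repr (f x), ← b.sum_repr (g x)]
    simp only [Finset.sum_mul, Finset.mul_sum, map_sum, smul_mul_smul_comm, map_smul, smul_eq_mul,
      Module.Basis.coord_apply]
    rw [Finset.sum_comm]
  simp only [h]
  exact SmoothReal.sum _ fun i => SmoothReal.sum _ fun j =>
    ((hf (b.coord i)).mul (hg (b.coord j))).mul
      (SmoothReal.of_contDiff (g := fun _ => l (b i * b j)) contDiff_const)

end smooth

/-- The algebra `C^∞(U) ⊗ ⋀ℝ^O` for an open subset `U` of `ℝ^E`. -/
def superFunctions (E O : Type) [Fintype E] [Fintype O] (U : Opens (E → ℝ)) :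
    Subalgebra ℝ (U → Ext O) where
  carrier := {f | SmoothExt U f}
  mul_mem' hf hg := SmoothExt.mul hf hg
  add_mem' hf hg := SmoothExt.add hf hg
  algebraMap_mem' r := SmoothExt.const (algebraMap ℝ (Ext O) r)

/-- The superdomain `ℝ^{E|O}`, with even coordinates indexed by `E` and odd coordinates indexed
by `O`: the space `ℝ^E` with the sheaf `C^∞ ⊗ ⋀ℝ^O`. -/
def superdomain (E O : Type) [Fintype E] [Fintype O] : SuperSpace where
  carrier := E → ℝ
  sec U := superFunctions E O U
  parity U i :=
    { carrier := {f | ∀ x, f.1 x ∈ extParity O i}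
      add_mem' := fun hf hg x => (extParity O i).add_mem (hf x) (hg x)
      zero_mem' := fun _ => (extParity O i).zero_mem
      smul_mem' := fun c _ hf x => (extParity O i).smul_mem c (hf x) }
  one_mem_parity U x := SetLike.GradedOne.one_mem (A := extParity O)
  mul_mem_parity U i j a b ha hb x := SetLike.GradedMul.mul_mem (A := extParity O) (ha x) (hb x)
  isCompl_parity U := by
    have hc := CliffordAlgebra.evenOdd_isCompl (Q := (0 : QuadraticForm ℝ (O → ℝ)))
    constructor
    · rw [Submodule.disjoint_def]
      intro f h0 h1
      apply Subtype.ext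
      funext x
      exact Submodule.disjoint_def.1 hc.disjoint _ (h0 x) (h1 x)
    · rw [codisjoint_iff, Submodule.eq_top_iff']
      intro f
      let φ := (extParity O 0).projection (extParity O 1) hc
      let ψ := (extParity O 1).projection (extParity O 0) hc.symm
      refine Submodule.mem_sup.2 ⟨⟨fun x => φ (f.1 x), SmoothExt.linear φ f.2⟩,
        fun x => Submodule.projection_apply_mem hc _,
        ⟨fun x => ψ (f.1 x), SmoothExt.linear ψ f.2⟩,
        fun x => Submodule.projection_apply_mem hc.symm _, ?_⟩
      apply Subtype.ext
      funext x
      exact Submodule.projection_add_projection_eq_self hc (f.1 x)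
  res {U V} h :=
    { toFun := fun f => ⟨fun x => f.1 ⟨x.1, h x.2⟩, fun l => (f.2 l).res h⟩
      map_one' := rfl
      map_mul' := fun _ _ => rfl
      map_zero' := rfl
      map_add' := fun _ _ => rfl
      commutes' := fun _ => rfl }
  res_parity _ _ _ ha x := ha _
  res_self _ _ := rfl
  res_res _ _ _ := rfl
  existsUnique_glue {ι} W U hle hcov s hs := by
    have hx : ∀ x : W, ∃ i, x.1 ∈ U i := fun x => Opens.mem_iSup.1 (hcov x.2)
    choose c hc using hx
    have agree : ∀ (x : W) (i : ι) (hi : x.1 ∈ U i),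
        (s (c x)).1 ⟨x.1, hc x⟩ = (s i).1 ⟨x.1, hi⟩ := fun x i hi =>
      congrFun (congrArg Subtype.val (hs (c x) i)) ⟨x.1, hc x, hi⟩
    refine ⟨⟨fun x => (s (c x)).1 ⟨x.1, hc x⟩, fun l => ?_⟩, fun i => ?_, fun t ht => ?_⟩
    · refine SmoothReal.of_local fun x => ⟨_, (s (c x)).2 l ⟨x.1, hc x⟩, U (c x), hc x,
        fun y hy => ?_⟩
      have hl := congrArg l (agree y (c x) hy)
      refine hl.trans ?_
      exact (extendZero_apply (fun z => l ((s (c x)).1 z)) ⟨y.1, hy⟩).symm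
    · apply Subtype.ext
      funext x
      exact agree ⟨x.1, hle i x.2⟩ i x.2
    · apply Subtype.ext
      funext x
      exact congrFun (congrArg Subtype.val (ht (c x))) ⟨x.1, hc x⟩

/-- The even coordinate functions of a superdomain. -/
def evenCoord {E O : Type} [Fintype E] [Fintype O] (e : E) : (superdomain E O).sec ⊤ :=
  ⟨fun x => algebraMap ℝ (Ext O) (x.1 e), fun l => by
    have h : ∀ x : (⊤ : Opens (E → ℝ)), l (algebraMap ℝ (Ext O) (x.1 e)) = x.1 e * l 1 := by
      intro x
      rw [Algebra.algebraMap_eq_smul_one, map_smul, smul_eq_mul]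
    have h' : SmoothReal (⊤ : Opens (E → ℝ)) (fun x => x.1 e * l 1) :=
      SmoothReal.of_contDiff (g := fun x => x e * l 1)
        ((contDiff_apply ℝ ℝ e).mul contDiff_const)
    rwa [← funext h] at h'⟩

/-- The odd coordinate functions of a superdomain: the generators of the exterior algebra. -/
def oddCoord {E O : Type} [Fintype E] [Fintype O] [DecidableEq O] (o : O) :
    (superdomain E O).sec ⊤ :=
  ⟨fun _ => ExteriorAlgebra.ι ℝ (Pi.single o 1), SmoothExt.const _⟩

/-- `M` is a supermanifold of dimension `p|q`: it is Hausdorff, second countable and locally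
isomorphic to open parts of `ℝ^{p|q}`. -/
def IsSupermanifold (p q : ℕ) (M : SuperSpace) : Prop :=
  T2Space M.carrier ∧ SecondCountableTopology M.carrier ∧
    ∀ x : M.carrier, ∃ (V : Opens M.carrier) (D : Opens (Fin p → ℝ)), x ∈ V ∧
      Nonempty (M.restrict V ≅ (superdomain (Fin p) (Fin q)).restrict D)

/-- Supermanifolds; a morphism of supermanifolds is a morphism of the superspaces. -/
structure Supermanifold where
  space : SuperSpace
  evenDim : ℕ
  oddDim : ℕ
  isSupermanifold : IsSupermanifold evenDim oddDim space

/-! ### Gluing superspaces -/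

section glue

variable {ι : Type} (U : ι → SuperSpace) (V : ∀ i _ : ι, Opens (U i).carrier)
  (g : ∀ i j, (U i).restrict (V i j) ⟶ U j)

/-- The point `a` of `U i` is identified with its image in `U j` whenever it lies in `V i j`. -/
def glueRel (a b : Σ i, (U i).carrier) : Prop :=
  ∃ h : a.2 ∈ V a.1 b.1, (g a.1 b.1).base ⟨a.2, h⟩ = b.2

/-- The glued topological space, with the quotient topology. -/
def GlueSpace : Type := Quot (glueRel U V g)

instance : TopologicalSpace (GlueSpace U V g) :=
  inferInstanceAs (TopologicalSpace (Quot (glueRel U V g)))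

/-- The map of a piece to the glued space. -/
def glueMk (i : ι) (x : (U i).carrier) : GlueSpace U V g := Quot.mk _ ⟨i, x⟩

lemma continuous_glueMk (i : ι) : Continuous (glueMk U V g i) :=
  continuous_quot_mk.comp continuous_sigmaMk

/-- The open part of `U i` that lies over the open part `W` of the glued space. -/
def gluePre (W : Opens (GlueSpace U V g)) (i : ι) : Opens (U i).carrier :=
  pre (glueMk U V g i) (continuous_glueMk U V g i) W

lemma glue_le (W : Opens (GlueSpace U V g)) (i j : ι) :
    img (V i j) (pre (g i j).base (g i j).continuous_base (gluePre U V g W j)) ≤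
      gluePre U V g W i := by
  rintro _ ⟨x, hx, rfl⟩
  have h : glueMk U V g i x.1 = glueMk U V g j ((g i j).base x) := Quot.sound ⟨x.2, rfl⟩
  change glueMk U V g i x.1 ∈ W
  rw [h]
  exact hx

/-- The sections of the glued sheaf over `W`: families of sections of the pieces that correspond
to each other under pullback along the gluing morphisms. -/
def glueSec (W : Opens (GlueSpace U V g)) :
    Subalgebra ℝ (∀ i, (U i).sec (gluePre U V g W i)) where
  carrier := {f | ∀ i j, (U i).res (glue_le U V g W i j) (f i) = (g i j).app _ (f j)}
  mul_mem' ha hb i j := by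
    simp only [Pi.mul_apply, map_mul]
    exact congrArg₂ (· * ·) (ha i j) (hb i j)
  add_mem' ha hb i j := by
    simp only [Pi.add_apply, map_add]
    exact congrArg₂ (· + ·) (ha i j) (hb i j)
  algebraMap_mem' r i j := by
    simp only [Pi.algebraMap_apply, AlgHom.commutes]
    rfl

/-- The superspace glued from the superspaces `U i` by identifying the open part `V i j` of `U i`
with an open part of `U j` along `g i j`. -/
def glue : SuperSpace where
  carrier := GlueSpace U V g
  sec W := glueSec U V g W
  parity W p :=
    { carrier := {f | ∀ i, f.1 i ∈ (U i).parity _ p}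
      add_mem' := fun ha hb i => ((U i).parity _ p).add_mem (ha i) (hb i)
      zero_mem' := fun i => ((U i).parity _ p).zero_mem
      smul_mem' := fun c _ ha i => ((U i).parity _ p).smul_mem c (ha i) }
  one_mem_parity W i := (U i).one_mem_parity _
  mul_mem_parity W p q a b ha hb i := (U i).mul_mem_parity _ p q _ _ (ha i) (hb i)
  isCompl_parity W := by
    constructor
    · rw [Submodule.disjoint_def]
      intro f h0 h1
      apply Subtype.ext
      funext i
      exact Submodule.disjoint_def.1 ((U i).isCompl_parity _).disjoint _ (h0 i) (h1 i)
    · rw [codisjoint_iff, Submodule.eq_top_iff']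
      intro f
      have hd : ∀ i, ∃ a b, a ∈ (U i).parity (gluePre U V g W i) 0 ∧
          b ∈ (U i).parity (gluePre U V g W i) 1 ∧ a + b = f.1 i := fun i => by
        have h := Submodule.mem_sup.1 (((U i).isCompl_parity (gluePre U V g W i)).codisjoint.eq_top ▸
          (Submodule.mem_top : f.1 i ∈ ⊤))
        obtain ⟨a, ha, b, hb, hab⟩ := h
        exact ⟨a, b, ha, hb, hab⟩
      choose a b ha hb hab using hd
      have both : ∀ i j,
          (U i).res (glue_le U V g W i j) (a i) = (g i j).app _ (a j) ∧
          (U i).res (glue_le U V g W i j) (b i) = (g i j).app _ (b j) := fun i j =>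
        (U i).eq_of_add_eq ((U i).res_parity (glue_le U V g W i j) 0 _ (ha i))
          ((g i j).app_parity _ 0 _ (ha j)) ((U i).res_parity (glue_le U V g W i j) 1 _ (hb i))
          ((g i j).app_parity _ 1 _ (hb j)) (by
            have hf := f.2 i j
            rw [← hab i, ← hab j, map_add, map_add] at hf
            exact hf)
      exact Submodule.mem_sup.2 ⟨⟨a, fun i j => (both i j).1⟩, ha, ⟨b, fun i j => (both i j).2⟩, hb,
        Subtype.ext (funext hab)⟩
  res {W W'} h :=
    { toFun := fun f => ⟨fun i => (U i).res (fun _ hx => h hx) (f.1 i), fun i j => by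
        have hle : pre (g i j).base (g i j).continuous_base (gluePre U V g W j) ≤
          pre (g i j).base (g i j).continuous_base (gluePre U V g W' j) := fun _ hx => h hx
        have hf := congrArg ((U i).res (img_mono (V i j) hle)) (f.2 i j)
        have h1 := (U i).res_res (img_mono (V i j) hle) (glue_le U V g W' i j) (f.1 i)
        have h2 := (U i).res_res (glue_le U V g W i j) (fun _ hx => h hx) (f.1 i)
        have h3 := (g i j).app_res (U := gluePre U V g W j) (V := gluePre U V g W' j)
          (fun _ hx => h hx) (f.1 j)
        exact h2.trans (h1.symm.trans (hf.trans h3.symm))⟩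
      map_one' := Subtype.ext (funext fun i => map_one _)
      map_mul' := fun _ _ => Subtype.ext (funext fun i => map_mul _ _ _)
      map_zero' := Subtype.ext (funext fun i => map_zero _)
      map_add' := fun _ _ => Subtype.ext (funext fun i => map_add _ _ _)
      commutes' := fun r => Subtype.ext (funext fun i => AlgHom.commutes _ r) }
  res_parity h p a ha i := (U i).res_parity _ p _ (ha i)
  res_self W a := Subtype.ext (funext fun i => (U i).res_self _ _)
  res_res h h' a := Subtype.ext (funext fun i => (U i).res_res _ _ _)
  existsUnique_glue {κ} W A hle hcov s hs := by
    have hcov' : ∀ i, gluePre U V g W i ≤ ⨆ k, gluePre U V g (A k) i := fun i x hx => by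
      obtain ⟨k, hk⟩ := Opens.mem_iSup.1 (hcov (show glueMk U V g i x ∈ W from hx))
      exact Opens.mem_iSup.2 ⟨k, hk⟩
    have hle' : ∀ i k, gluePre U V g (A k) i ≤ gluePre U V g W i := fun i k _ hx => hle k hx
    have ex : ∀ i, ∃! t : (U i).sec (gluePre U V g W i),
        ∀ k, (U i).res (hle' i k) t = (s k).1 i := fun i =>
      (U i).existsUnique_glue _ (fun k => gluePre U V g (A k) i) (hle' i) (hcov' i)
        (fun k => (s k).1 i) (fun k k' => congrFun (congrArg Subtype.val (hs k k')) i)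
    choose t ht hu using ex
    refine ⟨⟨t, fun i j => ?_⟩, fun k => Subtype.ext (funext fun i => ht i k),
      fun t' ht' => Subtype.ext (funext fun i =>
        hu i _ fun k => congrFun (congrArg Subtype.val (ht' k)) i)⟩
    have hsub : ∀ k, pre (g i j).base (g i j).continuous_base (gluePre U V g (A k) j) ≤
        pre (g i j).base (g i j).continuous_base (gluePre U V g W j) := fun k _ hx => hle k hx
    refine (U i).eq_of_cover (ι := κ)
      (U := fun k => img (V i j) (pre (g i j).base (g i j).continuous_base (gluePre U V g (A k) j)))
      (fun k => img_mono (V i j) (hsub k)) ?_ fun k => ?_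
    · rintro _ ⟨x, hx, rfl⟩
      obtain ⟨k, hk⟩ := Opens.mem_iSup.1 (hcov' j hx)
      exact Opens.mem_iSup.2 ⟨k, x, hk, rfl⟩
    · have h1 := (s k).2 i j
      rw [← ht i k, ← ht j k, (U i).res_res] at h1
      have h2 := (g i j).app_res (hle' j k) (t j)
      have h3 := (U i).res_res (img_mono (V i j) (hsub k)) (glue_le U V g W i j) (t i)
      exact h3.trans (h1.trans h2)

/-- The morphism of a piece to the glued superspace. -/
def glueIncl (i : ι) : U i ⟶ glue U V g where
  base := glueMk U V g i
  continuous_base := continuous_glueMk U V g i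
  app _ :=
    { toFun := fun f => f.1 i
      map_one' := rfl
      map_mul' := fun _ _ => rfl
      map_zero' := rfl
      map_add' := fun _ _ => rfl
      commutes' := fun _ => rfl }
  app_parity _ _ _ h := h i
  app_res _ _ := rfl

end glue

/-! ### Supermatrices -/

/-- Row and column indices of supermatrices: `a` even ones followed by `b` odd ones. -/
abbrev SIx (a b : ℕ) : Type := Fin a ⊕ Fin b

/-- Entries in the even blocks of a supermatrix are those whose row and column index have the same
parity. -/
abbrev SameParity {a b c d : ℕ} (r : SIx a b) (s : SIx c d) : Prop := r.isLeft = s.isLeft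

/-- A supermatrix is even if the entries of its even blocks are even and the entries of its odd
blocks are odd. -/
def IsEvenMatrix {a b c d : ℕ} (T : SuperSpace) (B : Matrix (SIx a b) (SIx c d) (T.sec ⊤)) : Prop :=
  ∀ r s, B r s ∈ T.parity ⊤ (if SameParity r s then 0 else 1)

/-- A `k|l`-index for `m|n`: a set of `k` even and a set of `l` odd column indices, each given by
its increasing enumeration. -/
structure KLIndex (k l m n : ℕ) where
  even : Fin k ↪o Fin m
  odd : Fin l ↪o Fin n

namespace KLIndex

variable {k l m n : ℕ} (J : KLIndex k l m n)

/-- The columns that belong to the index, in order. -/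
def col : SIx k l → SIx m n := Sum.map J.even J.odd

/-- A column that belongs to the index. -/
abbrev Mem (c : SIx m n) : Prop := ∃ r, J.col r = c

/-- The square submatrix `M_J B` of the columns of `B` that belong to `J`. -/
def minor {R : Type} (B : Matrix (SIx k l) (SIx m n) R) : Matrix (SIx k l) (SIx k l) R :=
  B.submatrix id J.col

/-- The matrix `D_J B` that remains after omitting `M_J B`. -/
def rest {R : Type} (B : Matrix (SIx k l) (SIx m n) R) :
    Matrix (SIx k l) {c : SIx m n // ¬ J.Mem c} R :=
  B.submatrix id Subtype.val

/-- The free positions in the even blocks of the supermatrix that labels the chart of `J`. -/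
abbrev EvenPos : Type :=
  {p : SIx k l × SIx m n // ¬ J.Mem p.2 ∧ SameParity p.1 p.2}

/-- The free positions in the odd blocks of the supermatrix that labels the chart of `J`. -/
abbrev OddPos : Type :=
  {p : SIx k l × SIx m n // ¬ J.Mem p.2 ∧ ¬ SameParity p.1 p.2}

/-- The superdomain `U_J = ℝ^{α|β}` with `α = k(m-k)+l(n-l)` and `β = l(m-k)+k(n-l)`, its
coordinates being indexed by the free positions of the supermatrix that labels it. -/
def chart : SuperSpace := superdomain J.EvenPos J.OddPos

/-- The supermatrix `X̃_J` of a `T`-point `X` of `U_J`: the columns that belong to `J` form an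
identity supermatrix, the other entries are the pullbacks of the coordinates of `U_J`.
For the identity of `U_J` this is the supermatrix `A_J` that labels the chart. -/
def tilde {T : SuperSpace} (X : T ⟶ J.chart) : Matrix (SIx k l) (SIx m n) (T.sec ⊤) := fun r c =>
  if hc : J.Mem c then (if J.col r = c then 1 else 0)
  else if hp : SameParity r c then
    pull X (evenCoord (E := J.EvenPos) (O := J.OddPos) ⟨(r, c), hc, hp⟩)
  else pull X (oddCoord (E := J.EvenPos) (O := J.OddPos) ⟨(r, c), hc, hp⟩)

/-- The real matrix of a point of `|U_J|`: the reduction of the supermatrix `A_J`. -/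
def body (x : J.EvenPos → ℝ) : Matrix (SIx k l) (SIx m n) ℝ := fun r c =>
  if hc : J.Mem c then (if J.col r = c then 1 else 0)
  else if hp : SameParity r c then x ⟨(r, c), hc, hp⟩ else 0

lemma continuous_body : Continuous J.body := by
  refine continuous_matrix fun r c => ?_
  unfold body
  split_ifs
  · exact continuous_const
  · exact continuous_const
  · exact continuous_apply _
  · exact continuous_const

/-- `Y` is the `T`-point of `U_J` with the coordinates `D_J((M_J B)⁻¹ B)`, where `M_J B` is
invertible. -/
def IsPoint {T : SuperSpace} (Y : T ⟶ J.chart) (B : Matrix (SIx k l) (SIx m n) (T.sec ⊤)) : Prop :=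
  IsUnit (J.minor B) ∧ J.rest (J.tilde Y) = J.rest (Ring.inverse (J.minor B) * B)

end KLIndex

/-! ### The supergrassmannian -/

section grassmannian

variable {k l m n : ℕ}

/-- The open set `|U_I| ∩ |U_J|`, as an open part of `|U_I|`: the set of all points at which
`M_J A_I` is invertible. -/
def overlap (I J : KLIndex k l m n) : Opens I.chart.carrier where
  carrier := {x | IsUnit (J.minor (I.body x))}
  is_open' := by
    have h : {x : I.EvenPos → ℝ | IsUnit (J.minor (I.body x))} =
        (fun x => (J.minor (I.body x)).det) ⁻¹' {0}ᶜ := by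
      ext x
      simp [Matrix.isUnit_iff_isUnit_det]
    change IsOpen {x : I.EvenPos → ℝ | IsUnit (J.minor (I.body x))}
    rw [h]
    exact isOpen_compl_singleton.preimage
      (Continuous.matrix_det (I.continuous_body.matrix_submatrix _ _))

/-- The superdomain `U_I ∩ U_J`, as an open part of `U_I`. -/
abbrev overlapSpace (I J : KLIndex k l m n) : SuperSpace := I.chart.restrict (overlap I J)

/-- The defining equation `D_J A_J = D_J((M_J A_I)⁻¹ A_I)` of the transition map from `U_I` to
`U_J`: its left side is pulled back along `g`, its right side is restricted to `U_I ∩ U_J`. -/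
def IsTransition (I J : KLIndex k l m n) (g : overlapSpace I J ⟶ J.chart) : Prop :=
  J.IsPoint g (I.tilde (I.chart.incl (overlap I J)))

end grassmannian

/-- The families of transition maps between the charts of `G_{k|l}(m|n)`. -/
def Transitions (k l m n : ℕ) : Type :=
  {g : ∀ I J : KLIndex k l m n, overlapSpace I J ⟶ J.chart // ∀ I J, IsTransition I J (g I J)}

section action

variable {k l m n : ℕ}

/-- The supergrassmannian `G_{k|l}(m|n)`: the charts `U_I` glued along the transition maps. -/
def supergrassmannian (g : Transitions k l m n) : SuperSpace :=
  glue KLIndex.chart overlap g.1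

/-- The embedding of the chart `U_I` in the supergrassmannian. -/
def chartIncl (g : Transitions k l m n) (I : KLIndex k l m n) : I.chart ⟶ supergrassmannian g :=
  glueIncl KLIndex.chart overlap g.1 I

/-! ### The general linear supergroup -/

/-- The positions in the even blocks of an `m|n × m|n` supermatrix. -/
abbrev GLEvenPos (m n : ℕ) : Type := {p : SIx m n × SIx m n // SameParity p.1 p.2}

/-- The positions in the odd blocks of an `m|n × m|n` supermatrix. -/
abbrev GLOddPos (m n : ℕ) : Type := {p : SIx m n × SIx m n // ¬ SameParity p.1 p.2}

/-- The real matrix of a point of `End(ℝ^m) × End(ℝ^n)`. -/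
def glBody (x : GLEvenPos m n → ℝ) : Matrix (SIx m n) (SIx m n) ℝ := fun r c =>
  if h : SameParity r c then x ⟨(r, c), h⟩ else 0

lemma continuous_glBody : Continuous (glBody (m := m) (n := n)) := by
  refine continuous_matrix fun r c => ?_
  unfold glBody
  split_ifs
  · exact continuous_apply _
  · exact continuous_const

/-- The open subset `GL(ℝ^m) × GL(ℝ^n)` of `End(ℝ^m) × End(ℝ^n)`. -/
def glOpens (m n : ℕ) : Opens (superdomain (GLEvenPos m n) (GLOddPos m n)).carrier where
  carrier := {x | IsUnit (glBody x)}
  is_open' := by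
    have h : {x : GLEvenPos m n → ℝ | IsUnit (glBody x)} = (fun x => (glBody x).det) ⁻¹' {0}ᶜ := by
      ext x
      simp [Matrix.isUnit_iff_isUnit_det]
    change IsOpen {x : GLEvenPos m n → ℝ | IsUnit (glBody x)}
    rw [h]
    exact isOpen_compl_singleton.preimage (Continuous.matrix_det continuous_glBody)

/-- The supermanifold `GL(m|n)`: the open part of the superdomain of all even `m|n × m|n`
supermatrices over `GL(ℝ^m) × GL(ℝ^n)`. -/
def superGL (m n : ℕ) : SuperSpace :=
  (superdomain (GLEvenPos m n) (GLOddPos m n)).restrict (glOpens m n)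

/-- The supermatrix of a `T`-point of `GL(m|n)`: the entries are the pullbacks of the
coordinates. -/
def glMatrix {T : SuperSpace} (P : T ⟶ superGL m n) : Matrix (SIx m n) (SIx m n) (T.sec ⊤) := fun r c =>
  let P' : T ⟶ superdomain (GLEvenPos m n) (GLOddPos m n) :=
    P ≫ (superdomain (GLEvenPos m n) (GLOddPos m n)).incl (glOpens m n)
  if h : SameParity r c then pull P' (evenCoord ⟨(r, c), h⟩) else pull P' (oddCoord ⟨(r, c), h⟩)

/-! ### The local maps and the action -/

/-- The piece `U_I^J(T)` of the refined cover, for a fixed `P` in `GL(m|n)(T)`: the `T`-points `X`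
of `U_I` for which `M_J(X̃P)` is invertible. -/
def refinedCover {T : SuperSpace} (P : T ⟶ superGL m n) (I J : KLIndex k l m n) : Set (T ⟶ I.chart) :=
  {X | IsUnit (J.minor (I.tilde X * glMatrix P))}

/-- `Y` is the value at `X` of the local map `U_I^J(T) → U_J(T)`,
`X ↦ D_J((M_J(X̃P))⁻¹ X̃P)`. -/
def IsLocalValue {T : SuperSpace} (P : T ⟶ superGL m n) (I J : KLIndex k l m n) (X : T ⟶ I.chart)
    (Y : T ⟶ J.chart) : Prop :=
  J.IsPoint Y (I.tilde X * glMatrix P)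

/-- Families of maps `a_T : G(T) × GL(T) → G(T)`, where `T` ranges over all supermanifolds. -/
abbrev PointMaps (g : Transitions k l m n) : Type 1 :=
  ∀ T : Supermanifold, (T.space ⟶ supergrassmannian g) → (T.space ⟶ superGL m n) →
    (T.space ⟶ supergrassmannian g)

/-- The maps `a_T` are glued from the local maps: wherever, on an open part `V` of `T`, a `T`-point
`x` of `G` lies in `U_I^J`, the point `a_T(x, P)` is on `V` the value of the local map. -/
def IsGluedFromLocal (g : Transitions k l m n) (a : PointMaps g) : Prop :=
  ∀ (T : Supermanifold) (x : T.space ⟶ supergrassmannian g) (P : T.space ⟶ superGL m n)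
    (V : Opens T.space.carrier) (I J : KLIndex k l m n)
    (X : T.space.restrict V ⟶ I.chart) (Y : T.space.restrict V ⟶ J.chart),
    X ≫ chartIncl g I = T.space.incl V ≫ x →
    IsLocalValue (T.space.incl V ≫ P) I J X Y →
    T.space.incl V ≫ a T x P = Y ≫ chartIncl g J

/-- The maps `a_T` are natural in `T`. -/
def IsNatural (g : Transitions k l m n) (a : PointMaps g) : Prop :=
  ∀ (S T : Supermanifold) (φ : S.space ⟶ T.space) (x : T.space ⟶ supergrassmannian g)
    (P : T.space ⟶ superGL m n), a S (φ ≫ x) (φ ≫ P) = φ ≫ a T x P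

/-- The maps `a_T` are right actions of the groups `GL(m|n)(T)`, whose product is the product of
supermatrices. -/
def IsRightAction (g : Transitions k l m n) (a : PointMaps g) : Prop :=
  ∀ (T : Supermanifold) (x : T.space ⟶ supergrassmannian g),
    (∀ P Q R : T.space ⟶ superGL m n, glMatrix R = glMatrix P * glMatrix Q →
      a T (a T x P) Q = a T x R) ∧
    (∀ E : T.space ⟶ superGL m n, glMatrix E = 1 → a T x E = x)

/-- `N` with the projections `p` and `q` is a product of `M` and `K` in the category of
supermanifolds. -/
def IsProduct (N : Supermanifold) {M K : SuperSpace} (p : N.space ⟶ M) (q : N.space ⟶ K) : Prop :=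
  ∀ (T : Supermanifold) (x : T.space ⟶ M) (y : T.space ⟶ K),
    ∃! h : T.space ⟶ N.space, h ≫ p = x ∧ h ≫ q = y

end action

end Super

end

open Super

/-! A `T`-point of the chart `U_J` is an even supermatrix whose `J`-columns form the identity.
`J.IsPoint Y B` says that `B = u * J.tilde Y` for an invertible `u` (`isPoint_iff`), so `Y` is the
normal form of `B` under left multiplication by invertible matrices. The transition maps compute the
normal form of `X̃`, the local maps that of `X̃P`. Since left multiplication commutes with right
multiplication by `P`, the cocycle condition, the compatibility of the local maps with the
transition maps and the law `(xP)Q = x(PQ)` all reduce to short computations with units.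

To work with points, one needs that a morphism from `T` to `ℝ^{E|O}` is the same as a choice of even
and odd global sections. Uniqueness (`algHom_eq_of_coords`): every character of the sections near a
point is evaluation, so the base map is determined by the pullback. By Hadamard's lemma, two
pullbacks that agree on the coordinates differ on a smooth function by an element of every power of
the ideal generated by the odd generators, and a high power vanishes. Existence
(`exists_hom_superdomain`): substitute by the finite Taylor expansion `f(b + n) = (exp(∑ nₑ∂ₑ)
f)(b)` with `n` nilpotent; it is multiplicative, being the exponential of a nilpotent derivation.
Both facts carry over to spaces that are locally retracts of superdomains (`LocSuper`), a class that
contains supermanifolds, charts and their open parts.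

Invertibility of a square matrix of sections is decided by its real reductions
(`LocSuper.isUnit_iff`), because a matrix with zero reduction is nilpotent. Hence the overlaps,
defined by real matrices, have the right `T`-points, and the points of `GL(m|n)` are the invertible
even supermatrices.

The cocycle condition, stated for points (`IsGluing`), implies that the pieces are open in the glued
space (`isOpenImm_glueIncl`) and that points of two pieces become equal there exactly when they are
linked (`linked_iff`). A point of `G` therefore lifts locally to a chart. The real block diagonal
matrix of `X̃P` has full row rank, so some `J`-minor is invertible near the given point
(`exists_mem_refinedCover`). The local values agree in `G` and glue to the action; naturality and
the action laws follow by uniqueness, and the morphism on a product is obtained by evaluating at its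
projections. -/

noncomputable section

namespace Super

open SuperSpace

/-! ### Pullback of sections and local equality of morphisms -/

namespace SuperSpace

variable {M N K T : SuperSpace}

lemma le_pre_top {X Y : Type} [TopologicalSpace X] [TopologicalSpace Y] {f : X → Y}
    {hf : Continuous f} (A : Opens X) : A ≤ pre f hf ⊤ := fun _ _ => trivial

lemma pre_mono {X Y : Type} [TopologicalSpace X] [TopologicalSpace Y] {f : X → Y}
    {hf : Continuous f} {U V : Opens Y} (h : U ≤ V) : pre f hf U ≤ pre f hf V :=
  fun _ hx => h hx

lemma le_pre_comp {f : M ⟶ N} {g : N ⟶ K} {A : Opens M.carrier} {B : Opens N.carrier}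
    {U : Opens K.carrier} (hA : A ≤ pre f.base f.continuous_base B)
    (hB : B ≤ pre g.base g.continuous_base U) :
    A ≤ pre (f ≫ g).base (f ≫ g).continuous_base U := fun _ hx => hB (hA hx)

lemma le_pre_of_comp {f : M ⟶ N} {g : N ⟶ K} {A : Opens M.carrier} {U : Opens K.carrier}
    (h : A ≤ pre (f ≫ g).base (f ≫ g).continuous_base U) :
    A ≤ pre f.base f.continuous_base (pre g.base g.continuous_base U) := h

/-- The pullback of a section over `U` to an open set `A` that maps to `U`. -/
def pullOn (f : M ⟶ N) {U : Opens N.carrier} {A : Opens M.carrier}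
    (h : A ≤ pre f.base f.continuous_base U) : N.sec U →ₐ[ℝ] M.sec A :=
  (M.res h).comp (f.app U)

lemma pullOn_apply (f : M ⟶ N) {U : Opens N.carrier} {A : Opens M.carrier}
    (h : A ≤ pre f.base f.continuous_base U) (a : N.sec U) :
    pullOn f h a = M.res h (f.app U a) := rfl

lemma app_eq_pullOn (f : M ⟶ N) (U : Opens N.carrier) (a : N.sec U) :
    f.app U a = pullOn f le_rfl a := (M.res_self _ _).symm

lemma res_pullOn (f : M ⟶ N) {U : Opens N.carrier} {A B : Opens M.carrier}
    (h : A ≤ pre f.base f.continuous_base U) (h' : B ≤ A) (a : N.sec U) :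
    M.res h' (pullOn f h a) = pullOn f (h'.trans h) a := M.res_res _ _ _

lemma pullOn_res (f : M ⟶ N) {U V : Opens N.carrier} {A : Opens M.carrier}
    (h : A ≤ pre f.base f.continuous_base U) (h' : U ≤ V) (a : N.sec V)
    (h'' : A ≤ pre f.base f.continuous_base V := h.trans (pre_mono h')) :
    pullOn f h (N.res h' a) = pullOn f h'' a :=
  (congrArg (M.res h) (f.app_res h' a)).trans (M.res_res _ _ _)

lemma pullOn_comp (f : M ⟶ N) (g : N ⟶ K) {U : Opens K.carrier} {B : Opens N.carrier}
    {A : Opens M.carrier} (hA : A ≤ pre f.base f.continuous_base B)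
    (hB : B ≤ pre g.base g.continuous_base U) (a : K.sec U)
    (h : A ≤ pre (f ≫ g).base (f ≫ g).continuous_base U := le_pre_comp hA hB) :
    pullOn (f ≫ g) h a = pullOn f hA (pullOn g hB a) :=
  (pullOn_res f hA hB _ h).symm

lemma pullOn_congr {f g : M ⟶ N} (e : f = g) {U : Opens N.carrier} {A : Opens M.carrier}
    (h : A ≤ pre f.base f.continuous_base U) (h' : A ≤ pre g.base g.continuous_base U)
    (a : N.sec U) : pullOn f h a = pullOn g h' a := by
  subst e; rfl

lemma pullOn_parity (f : M ⟶ N) {U : Opens N.carrier} {A : Opens M.carrier}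
    (h : A ≤ pre f.base f.continuous_base U) (i : ZMod 2) (a : N.sec U) (ha : a ∈ N.parity U i) :
    pullOn f h a ∈ M.parity A i :=
  M.res_parity _ _ _ (f.app_parity _ _ _ ha)

lemma pullOn_id {U A : Opens M.carrier} (h : A ≤ pre (𝟙 M : M ⟶ M).base (𝟙 M : M ⟶ M).continuous_base U)
    (a : M.sec U) : pullOn (𝟙 M) h a = M.res h a := rfl

/-- The sections `f.app U a` and `g.app U a` live over different preimages, so they cannot be
compared directly. Restricting both to a common open set `A` avoids a transport along the equality
of the base maps. -/
lemma hom_ext {f g : M ⟶ N} (hb : ∀ x, f.base x = g.base x)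
    (h : ∀ (U : Opens N.carrier) (a : N.sec U) (A : Opens M.carrier)
      (hf : A ≤ pre f.base f.continuous_base U) (hg : A ≤ pre g.base g.continuous_base U),
      pullOn f hf a = pullOn g hg a) : f = g := by
  obtain ⟨fb, fc, fa, fp, fr⟩ := f
  obtain ⟨gb, gc, ga, gp, gr⟩ := g
  have : fb = gb := funext hb
  subst this
  have : fa = ga := by
    funext U
    ext a
    have := h U a _ le_rfl le_rfl
    rw [pullOn_apply, pullOn_apply, M.res_self, M.res_self] at this
    exact this
  subst this
  rfl

lemma pullOn_incl (D : Opens M.carrier) {U : Opens M.carrier} {A : Opens (M.restrict D).carrier}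
    (h : A ≤ pre (M.incl D).base (M.incl D).continuous_base U) (a : M.sec U) :
    pullOn (M.incl D) h a = M.res (show img D A ≤ U by rintro _ ⟨x, hx, rfl⟩; exact h hx) a :=
  M.res_res _ _ _

lemma eq_of_locally_eq {W : Opens M.carrier} {a b : M.sec W}
    (h : ∀ x ∈ W, ∃ V : Opens M.carrier, ∃ hV : V ≤ W, x ∈ V ∧ M.res hV a = M.res hV b) : a = b := by
  choose V hV hx he using h
  exact M.eq_of_cover (ι := W) (U := fun x => V x.1 x.2) (fun x => hV _ _)
    (fun x hxW => Opens.mem_iSup.2 ⟨⟨x, hxW⟩, hx _ _⟩) (fun x => he _ _)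

lemma hom_ext_local {f g : M ⟶ N}
    (h : ∀ x, ∃ V : Opens M.carrier, x ∈ V ∧ M.incl V ≫ f = M.incl V ≫ g) : f = g := by
  refine hom_ext (fun x => ?_) fun U a A hf hg => ?_
  · obtain ⟨V, hx, e⟩ := h x
    exact congrArg (fun k : M.restrict V ⟶ N => k.base ⟨x, hx⟩) e
  · refine eq_of_locally_eq fun x hxA => ?_
    obtain ⟨V, hx, e⟩ := h x
    refine ⟨A ⊓ V, inf_le_left, ⟨hxA, hx⟩, ?_⟩
    let A' : Opens (M.restrict V).carrier := pre (M.incl V).base (M.incl V).continuous_base A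
    have hfA : A' ≤ pre (M.incl V ≫ f).base (M.incl V ≫ f).continuous_base U := fun y hy => hf hy
    have hgA : A' ≤ pre (M.incl V ≫ g).base (M.incl V ≫ g).continuous_base U := fun y hy => hg hy
    have key := pullOn_congr e hfA hgA a
    rw [pullOn_comp _ _ (B := A) le_rfl hf, pullOn_comp _ _ (B := A) le_rfl hg, pullOn_incl,
      pullOn_incl] at key
    have hle : A ⊓ V ≤ img V A' := fun y hy => ⟨⟨y, hy.2⟩, hy.1, rfl⟩
    have := congrArg (M.res hle) key
    rw [M.res_res, M.res_res] at this
    exact this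

/-! #### Open immersions -/

/-- An open immersion: an isomorphism onto an open part of the target. -/
structure IsOpenImm (f : M ⟶ N) : Prop where
  emb : Topology.IsOpenEmbedding f.base
  bij : ∀ (A : Opens M.carrier) (U : Opens N.carrier) (h : A ≤ pre f.base f.continuous_base U),
    (U : Set N.carrier) ⊆ f.base '' A → Function.Bijective (pullOn f h)

/-- Split `a` into its even and odd parts. The image of the part of the wrong parity is both even
and odd, hence zero, and injectivity kills that part. -/
lemma mem_parity_of_injective {W : Opens M.carrier} {U : Opens N.carrier}
    (φ : M.sec W →ₐ[ℝ] N.sec U) (hφ : ∀ i a, a ∈ M.parity W i → φ a ∈ N.parity U i)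
    (hinj : Function.Injective φ) (i : ZMod 2) (a : M.sec W) (ha : φ a ∈ N.parity U i) :
    a ∈ M.parity W i := by
  obtain ⟨b, hb, c, hc, rfl⟩ := Submodule.mem_sup.1
    ((M.isCompl_parity W).codisjoint.eq_top ▸ (Submodule.mem_top : a ∈ ⊤))
  have hi : i = 0 ∨ i = 1 := by clear ha; revert i; decide
  rw [map_add] at ha
  rcases hi with rfl | rfl
  · have : φ c = 0 := Submodule.disjoint_def.1 (N.isCompl_parity U).disjoint _
      (by simpa using Submodule.sub_mem _ ha (hφ 0 b hb)) (hφ 1 c hc)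
    rw [hinj (this.trans (map_zero φ).symm), add_zero]
    exact hb
  · have : φ b = 0 := Submodule.disjoint_def.1 (N.isCompl_parity U).disjoint _
      (hφ 0 b hb) (by simpa using Submodule.sub_mem _ ha (hφ 1 c hc))
    rw [hinj (this.trans (map_zero φ).symm), zero_add]
    exact hc

namespace IsOpenImm

variable {f : M ⟶ N} (hf : IsOpenImm f)
include hf

/-- The image of an open set under an open immersion. -/
def image (A : Opens M.carrier) : Opens N.carrier := ⟨f.base '' A, hf.emb.isOpenMap _ A.isOpen⟩

lemma le_pre_image (A : Opens M.carrier) :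
    A ≤ pre f.base f.continuous_base (hf.image A) := fun x hx => ⟨x, hx, rfl⟩

/-- Sections of the source of an open immersion are sections over the image. -/
def secEquiv (A : Opens M.carrier) : N.sec (hf.image A) ≃ₐ[ℝ] M.sec A :=
  AlgEquiv.ofBijective (pullOn f (hf.le_pre_image A)) (hf.bij A _ _ (fun _ h => h))

lemma pullOn_secEquiv_symm (A : Opens M.carrier) (a : M.sec A) :
    pullOn f (hf.le_pre_image A) ((hf.secEquiv A).symm a) = a :=
  (hf.secEquiv A).apply_symm_apply a

lemma secEquiv_symm_parity (A : Opens M.carrier) (i : ZMod 2) (a : M.sec A)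
    (ha : a ∈ M.parity A i) : (hf.secEquiv A).symm a ∈ N.parity _ i := by
  refine mem_parity_of_injective (pullOn f (hf.le_pre_image A)) (pullOn_parity f _)
    (hf.bij A _ _ (fun _ h => h)).1 i _ ?_
  rw [pullOn_secEquiv_symm]
  exact ha

lemma image_mono {A B : Opens M.carrier} (h : A ≤ B) : hf.image A ≤ hf.image B :=
  Set.image_mono h

lemma secEquiv_symm_res {A B : Opens M.carrier} (h : A ≤ B) (a : M.sec B) :
    (hf.secEquiv A).symm (M.res h a) = N.res (hf.image_mono h) ((hf.secEquiv B).symm a) := by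
  apply (hf.bij A _ (hf.le_pre_image A) (fun _ h => h)).1
  rw [pullOn_secEquiv_symm, pullOn_res, ← res_pullOn f (hf.le_pre_image B) h, pullOn_secEquiv_symm]

lemma exists_base (h : T ⟶ N) (hr : ∀ t, h.base t ∈ Set.range f.base) :
    ∃ b : T.carrier → M.carrier, Continuous b ∧ ∀ t, f.base (b t) = h.base t := by
  choose b hb using hr
  refine ⟨b, hf.emb.isInducing.continuous_iff.2 ?_, hb⟩
  rw [show f.base ∘ b = h.base from funext hb]
  exact h.continuous_base

/-- The factorization of a morphism with image in the image of an open immersion. -/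
theorem exists_lift (h : T ⟶ N) (hr : ∀ t, h.base t ∈ Set.range f.base) :
    ∃ k : T ⟶ M, k ≫ f = h := by
  obtain ⟨b, hbc, hb⟩ := hf.exists_base h hr
  have hpre : ∀ A : Opens M.carrier,
      pre b hbc A ≤ pre h.base h.continuous_base (hf.image A) := fun A t ht =>
    ⟨b t, ht, hb t⟩
  -- A section over `A` is moved to the image of `A` in `N` and pulled back from there along `h`.
  let k : T ⟶ M := Hom.mk b hbc
    (fun A => (pullOn h (hpre A)).comp (hf.secEquiv A).symm.toAlgHom)
    (fun A i a ha => pullOn_parity h _ _ _ (hf.secEquiv_symm_parity A i a ha))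
    (fun {A B} hAB a => by
      change pullOn h (hpre A) ((hf.secEquiv A).symm (M.res hAB a)) =
        T.res _ (pullOn h (hpre B) ((hf.secEquiv B).symm a))
      rw [hf.secEquiv_symm_res]
      exact (pullOn_res _ _ _ _).trans (res_pullOn _ _ _ _).symm)
  have hk : ∀ (A : Opens M.carrier) (B : Opens T.carrier)
      (hB : B ≤ pre k.base k.continuous_base A) (a : M.sec A),
      pullOn k hB a = pullOn h (hB.trans (hpre A)) ((hf.secEquiv A).symm a) := fun A B hB a =>
    res_pullOn h (hpre A) hB _
  refine ⟨k, hom_ext hb fun U a A hA hA' => ?_⟩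
  refine (pullOn_comp k f (le_pre_of_comp hA) le_rfl a hA).trans ((hk _ _ _ _).trans ?_)
  have : (hf.secEquiv _).symm (pullOn f le_rfl a) =
      N.res (show hf.image (pre f.base f.continuous_base U) ≤ U by rintro _ ⟨x, hx, rfl⟩; exact hx) a := by
    apply (hf.secEquiv _).injective
    rw [AlgEquiv.apply_symm_apply]
    exact (pullOn_res f _ _ _).symm
  rw [this]
  exact pullOn_res _ _ _ _

/-- Every section of `M` is the pullback of a section of `N` over the image, so the composites with
`f` determine the action on sections. -/
theorem cancel {k k' : T ⟶ M} (e : k ≫ f = k' ≫ f) : k = k' := by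
  have hb : ∀ t, k.base t = k'.base t := fun t =>
    hf.emb.injective (congrArg (fun q : T ⟶ N => q.base t) e)
  refine hom_ext hb fun U a A hA hA' => ?_
  rw [← hf.pullOn_secEquiv_symm U a,
    ← pullOn_comp k f _ _ _ (le_pre_comp hA (hf.le_pre_image U)),
    ← pullOn_comp k' f _ _ _ (le_pre_comp hA' (hf.le_pre_image U))]
  exact pullOn_congr e _ _ _

end IsOpenImm

lemma isOpenImm_incl (D : Opens M.carrier) : IsOpenImm (M.incl D) where
  emb := D.isOpen.isOpenEmbedding_subtypeVal
  bij A U h hU := by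
    have e : U = img D A := le_antisymm (fun x hx => hU hx)
      (by rintro _ ⟨x, hx, rfl⟩; exact h hx)
    subst e
    have : (pullOn (M.incl D) h : _ → _) = id := by
      funext a
      rw [pullOn_incl]
      exact M.res_self _ _
    rw [this]
    exact Function.bijective_id

lemma exists_lift_incl (D : Opens M.carrier) (h : T ⟶ M) (hr : ∀ t, h.base t ∈ D) :
    ∃ k : T ⟶ M.restrict D, k ≫ M.incl D = h :=
  (isOpenImm_incl D).exists_lift h fun t => ⟨⟨_, hr t⟩, rfl⟩

lemma incl_cancel {D : Opens M.carrier} {k k' : T ⟶ M.restrict D}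
    (e : k ≫ M.incl D = k' ≫ M.incl D) : k = k' :=
  (isOpenImm_incl D).cancel e

/-- A lift of a morphism through an open part. -/
def liftIncl (D : Opens M.carrier) (h : T ⟶ M) (hr : ∀ t, h.base t ∈ D) : T ⟶ M.restrict D :=
  (exists_lift_incl D h hr).choose

@[simp]
lemma liftIncl_comp (D : Opens M.carrier) (h : T ⟶ M) (hr : ∀ t, h.base t ∈ D) :
    liftIncl D h hr ≫ M.incl D = h :=
  (exists_lift_incl D h hr).choose_spec

/-- The inclusion of an open part in a larger one. -/
def inclLE {V W : Opens M.carrier} (h : V ≤ W) : M.restrict V ⟶ M.restrict W :=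
  liftIncl W (M.incl V) fun t => h t.2

@[simp]
lemma inclLE_comp {V W : Opens M.carrier} (h : V ≤ W) : inclLE h ≫ M.incl W = M.incl V :=
  liftIncl_comp _ _ _

@[simp]
lemma inclLE_comp_assoc {V W : Opens M.carrier} (h : V ≤ W) (f : M ⟶ N) :
    inclLE h ≫ M.incl W ≫ f = M.incl V ≫ f := by
  rw [← Category.assoc, inclLE_comp]

lemma inclLE_base {V W : Opens M.carrier} (h : V ≤ W) (x : V) :
    (inclLE h : M.restrict V ⟶ _).base x = ⟨x.1, h x.2⟩ :=
  Subtype.ext (congrArg (fun q : M.restrict V ⟶ M => q.base x) (inclLE_comp h))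

/-- `inclLE` is chosen as a lift, so its effect on sections does not hold by definition. It is
computed by comparison with the inclusion in `M`. -/
lemma pullOn_inclLE {V W : Opens M.carrier} (h : V ≤ W) {B : Opens (M.restrict W).carrier}
    {A : Opens (M.restrict V).carrier}
    (hB : A ≤ pre (inclLE h).base (inclLE h).continuous_base B) (s : (M.restrict W).sec B)
    (hle : img V A ≤ img W B) : pullOn (inclLE h) hB s = M.res hle s := by
  have hW : B ≤ pre (M.incl W).base (M.incl W).continuous_base (img W B) := fun x hx => ⟨x, hx, rfl⟩
  have hV : A ≤ pre (M.incl V).base (M.incl V).continuous_base (img W B) :=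
    fun x hx => hle ⟨x, hx, rfl⟩
  have h2 : pullOn (M.incl W) hW s = s := (pullOn_incl W hW s).trans (M.res_self _ _)
  exact (congrArg (pullOn (inclLE h) hB) h2.symm).trans
    ((pullOn_comp _ _ hB hW s (le_pre_comp hB hW)).symm.trans
      ((pullOn_congr (inclLE_comp h) _ hV _).trans (pullOn_incl _ _ _)))

/-- Morphisms on the parts of an open cover that agree on the overlaps can be glued. -/
theorem exists_glueHom {ι : Type} (V : ι → Opens M.carrier) (hV : ∀ x, ∃ i, x ∈ V i)
    (f : ∀ i, M.restrict (V i) ⟶ N)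
    (hf : ∀ i j, inclLE (inf_le_left : V i ⊓ V j ≤ V i) ≫ f i = inclLE inf_le_right ≫ f j) :
    ∃ F : M ⟶ N, ∀ i, M.incl (V i) ≫ F = f i := by
  have agree : ∀ i j x (hi : x ∈ V i) (hj : x ∈ V j), (f i).base ⟨x, hi⟩ = (f j).base ⟨x, hj⟩ := by
    intro i j x hi hj
    have := congrArg (fun q : M.restrict (V i ⊓ V j) ⟶ N => q.base ⟨x, hi, hj⟩) (hf i j)
    change (f i).base ((inclLE _).base _) = (f j).base ((inclLE _).base _) at this
    rwa [inclLE_base, inclLE_base] at this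
  choose c hc using hV
  let b : M.carrier → N.carrier := fun x => (f (c x)).base ⟨x, hc x⟩
  have hb : ∀ i x (hi : x ∈ V i), b x = (f i).base ⟨x, hi⟩ := fun i x hi => agree _ _ _ _ _
  have hbc : Continuous b := by
    rw [continuous_iff_continuousAt]
    intro x
    have h1 : ContinuousOn b (V (c x)) := by
      rw [continuousOn_iff_continuous_domRestrict]
      have : (V (c x) : Set M.carrier).domRestrict b = (f (c x)).base := by
        funext y
        exact hb _ _ _
      rw [this]
      exact (f (c x)).continuous_base
    exact h1.continuousAt ((V (c x)).isOpen.mem_nhds (hc x))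
  -- The part of `V i` that lies over `U`. These parts cover the preimage of `U`, and the pullback
  -- of a section over `U` is glued from its pullbacks along the `f i`.
  let W : ι → Opens N.carrier → Opens M.carrier := fun i U =>
    img (V i) (pre (f i).base (f i).continuous_base U)
  have hW : ∀ i U, W i U ≤ pre b hbc U := by
    rintro i U _ ⟨x, hx, rfl⟩
    change b x.1 ∈ U
    rw [hb i x.1 x.2]
    exact hx
  have hcov : ∀ U, pre b hbc U ≤ ⨆ i, W i U := fun U x hx =>
    Opens.mem_iSup.2 ⟨c x, ⟨x, hc x⟩, hx, rfl⟩
  have ex : ∀ (U : Opens N.carrier) (a : N.sec U), ∃! s : M.sec (pre b hbc U),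
      ∀ i, M.res (hW i U) s = (f i).app U a := by
    intro U a
    refine M.existsUnique_glue _ (fun i => W i U) (fun i => hW i U) (hcov U)
      (fun i => (f i).app U a) fun i j => ?_
    let A : Opens (M.restrict (V i ⊓ V j)).carrier :=
      pre (inclLE inf_le_left ≫ f i).base (inclLE inf_le_left ≫ f i).continuous_base U
    have hA : A ≤ pre (inclLE inf_le_right ≫ f j).base
        (inclLE inf_le_right ≫ f j).continuous_base U := by
      rw [← hf i j]
    have key := pullOn_congr (hf i j) (A := A) le_rfl hA a
    replace key := (pullOn_comp _ (f i) (le_pre_of_comp le_rfl) le_rfl a _).symm.trans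
      (key.trans (pullOn_comp _ (f j) (le_pre_of_comp hA) le_rfl a _))
    rw [← app_eq_pullOn, ← app_eq_pullOn] at key
    have hle : ∀ k (hk : V i ⊓ V j ≤ V k),
        A ≤ pre (inclLE hk).base (inclLE hk).continuous_base
          (pre (f k).base (f k).continuous_base U) →
        img (V i ⊓ V j) A ≤ W k U := by
      rintro k hk h _ ⟨x, hx, rfl⟩
      have hx' : (f k).base ((inclLE hk).base x) ∈ U := h hx
      rw [inclLE_base] at hx'
      exact ⟨_, hx', rfl⟩
    replace key := (pullOn_inclLE inf_le_left _ _ (hle i inf_le_left le_rfl)).symm.trans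
      (key.trans (pullOn_inclLE inf_le_right _ _ (hle j inf_le_right hA)))
    have hsub : W i U ⊓ W j U ≤ img (V i ⊓ V j) A := by
      rintro _ ⟨⟨x, hx, rfl⟩, ⟨y, hy, hxy⟩⟩
      refine ⟨⟨x.1, x.2, by rw [← hxy]; exact y.2⟩, ?_, rfl⟩
      change (f i).base ((inclLE _).base _) ∈ U
      rw [inclLE_base]
      exact hx
    exact (M.res_res _ _ _).symm.trans ((congrArg (M.res hsub) key).trans (M.res_res _ _ _))
  choose s hs hu using ex
  -- The glued section is homogeneous because its component of the wrong parity restricts to zero on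
  -- each member of the cover.
  have hpar : ∀ (U : Opens N.carrier) (p : ZMod 2) (a : N.sec U), a ∈ N.parity U p →
      s U a ∈ M.parity (pre b hbc U) p := by
    intro U p a ha
    obtain ⟨a0, h0, a1, h1, h01⟩ := Submodule.mem_sup.1
      ((M.isCompl_parity (pre b hbc U)).codisjoint.eq_top ▸ (Submodule.mem_top : s U a ∈ ⊤))
    have hi : p = 0 ∨ p = 1 := by clear ha; revert p; decide
    have hsum : ∀ i, M.res (hW i U) a0 + M.res (hW i U) a1 = (f i).app U a := fun i => by
      rw [← map_add, h01]; exact hs U a i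
    rcases hi with rfl | rfl
    · have : a1 = 0 := by
        refine M.eq_of_cover (fun i => hW i U) (hcov U) fun i => ?_
        exact (M.eq_of_add_eq (M.res_parity _ _ _ h0) ((f i).app_parity U 0 a ha)
          (M.res_parity _ _ _ h1) (Submodule.zero_mem _)
          ((hsum i).trans (add_zero _).symm)).2.trans (map_zero _).symm
      rw [← h01, this, add_zero]; exact h0
    · have : a0 = 0 := by
        refine M.eq_of_cover (fun i => hW i U) (hcov U) fun i => ?_
        exact (M.eq_of_add_eq (M.res_parity _ _ _ h0) (Submodule.zero_mem _)
          (M.res_parity _ _ _ h1) ((f i).app_parity U 1 a ha)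
          ((hsum i).trans (zero_add _).symm)).1.trans (map_zero _).symm
      rw [← h01, this, zero_add]; exact h1
  -- The algebra laws and the compatibility with restriction follow from the uniqueness of the glued
  -- sections.
  let F : M ⟶ N := Hom.mk b hbc
    (fun U =>
      { toFun := s U
        map_one' := (hu U 1 1 fun i => by rw [map_one, map_one]; rfl).symm
        map_mul' := fun x y => (hu U _ _ fun i => by
          rw [map_mul, map_mul, hs, hs]; rfl).symm
        map_zero' := (hu U 0 0 fun i => by rw [map_zero, map_zero]; rfl).symm
        map_add' := fun x y => (hu U _ _ fun i => by
          rw [map_add, map_add, hs, hs]; rfl).symm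
        commutes' := fun r => (hu U _ _ fun i => by
          rw [AlgHom.commutes, AlgHom.commutes]; rfl).symm })
    hpar
    (fun {U U'} h a => by
      refine ((hu U (N.res h a) _ fun i => ?_)).symm
      refine (M.res_res _ _ _).trans (Eq.trans ?_ ((f i).app_res h a).symm)
      rw [← hs U' a i]
      exact (M.res_res _ _ _).symm)
  refine ⟨F, fun i => hom_ext (fun x => hb i x.1 x.2) fun U a A hA hA' => ?_⟩
  refine (pullOn_comp (M.incl (V i)) F (le_pre_of_comp hA) le_rfl a hA).trans ?_
  rw [← app_eq_pullOn, pullOn_incl, pullOn_apply (f i), ← hs U a i]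
  exact (M.res_res _ _ _).symm

end SuperSpace

/-! ### The exterior algebra -/

section ext

variable {O : Type}

/-- The augmentation of the exterior algebra, which forgets the odd generators. -/
def aug (O : Type) : Ext O →ₐ[ℝ] ℝ := ExteriorAlgebra.algebraMapInv

lemma aug_ι (v : O → ℝ) : aug O (ExteriorAlgebra.ι ℝ v) = 0 := by
  simp [aug, ExteriorAlgebra.algebraMapInv]

/-- The right ideal generated by the products of `j` generators. -/
def extFilt (O : Type) (j : ℕ) : Submodule ℝ (Ext O) :=
  LinearMap.range (ExteriorAlgebra.ι ℝ (M := O → ℝ)) ^ j * ⊤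

lemma mem_extFilt_zero (x : Ext O) : x ∈ extFilt O 0 := by
  rw [extFilt, pow_zero, one_mul]
  trivial

lemma mul_mem_extFilt (j : ℕ) {x : Ext O} (hx : x ∈ extFilt O j) (y : Ext O) :
    x * y ∈ extFilt O j := by
  have : x * y ∈ extFilt O j * ⊤ := Submodule.mul_mem_mul hx trivial
  have e : (⊤ : Submodule ℝ (Ext O)) * ⊤ ≤ ⊤ := le_top
  rw [extFilt, mul_assoc] at this
  exact mul_le_mul' le_rfl e this

/-- With `ε` the augmentation, `ab - ε(ab) = (a - ε(a))b + ε(a)(b - ε(b))`. As `extFilt O 1` is a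
right ideal, the claim passes from the generators to products. -/
lemma sub_aug_mem (x : Ext O) : x - algebraMap ℝ _ (aug O x) ∈ extFilt O 1 := by
  induction x using ExteriorAlgebra.induction with
  | algebraMap r => simp
  | ι v =>
    rw [aug_ι, map_zero, sub_zero]
    have : ExteriorAlgebra.ι ℝ v * 1 ∈ extFilt O 1 := by
      rw [extFilt, pow_one]
      exact Submodule.mul_mem_mul ⟨v, rfl⟩ trivial
    rwa [mul_one] at this
  | mul a b ha hb =>
    have : a * b - algebraMap ℝ _ (aug O (a * b)) = (a - algebraMap ℝ _ (aug O a)) * b +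
        aug O a • (b - algebraMap ℝ _ (aug O b)) := by
      rw [map_mul, map_mul, Algebra.smul_def]
      noncomm_ring
    rw [this]
    exact Submodule.add_mem _ (mul_mem_extFilt 1 ha b) (Submodule.smul_mem _ _ hb)
  | add a b ha hb =>
    have : a + b - algebraMap ℝ _ (aug O (a + b)) = (a - algebraMap ℝ _ (aug O a)) +
        (b - algebraMap ℝ _ (aug O b)) := by
      rw [map_add, map_add]
      abel
    rw [this]
    exact Submodule.add_mem _ ha hb

lemma mem_extFilt_one {x : Ext O} (hx : aug O x = 0) : x ∈ extFilt O 1 := by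
  simpa [hx] using sub_aug_mem x

/-- A product `t * ι v` has augmentation zero, so by `mem_extFilt_one` it lies in the right ideal of
the generators. Repeating this moves `⊤` past all `j` generators, so `extFilt O j` is a two-sided
ideal. -/
lemma top_mul_extFilt (j : ℕ) : ⊤ * extFilt O j ≤ extFilt O j := by
  induction j with
  | zero => exact fun x _ => mem_extFilt_zero x
  | succ j ih =>
    have h1 : ⊤ * LinearMap.range (ExteriorAlgebra.ι ℝ (M := O → ℝ)) ≤
        LinearMap.range (ExteriorAlgebra.ι ℝ (M := O → ℝ)) * ⊤ := by
      rw [Submodule.mul_le]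
      rintro t - _ ⟨v, rfl⟩
      have := mem_extFilt_one (O := O) (x := t * ExteriorAlgebra.ι ℝ v)
        (by rw [map_mul, aug_ι, mul_zero])
      rwa [extFilt, pow_one] at this
    calc ⊤ * extFilt O (j + 1)
        = (⊤ * LinearMap.range (ExteriorAlgebra.ι ℝ (M := O → ℝ))) * extFilt O j := by
          rw [extFilt, extFilt, pow_succ', mul_assoc, mul_assoc]
      _ ≤ (LinearMap.range (ExteriorAlgebra.ι ℝ (M := O → ℝ)) * ⊤) * extFilt O j :=
          mul_le_mul' h1 le_rfl
      _ ≤ LinearMap.range (ExteriorAlgebra.ι ℝ (M := O → ℝ)) * extFilt O j := by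
          rw [mul_assoc]
          exact mul_le_mul' le_rfl ih
      _ = extFilt O (j + 1) := by rw [extFilt, extFilt, pow_succ', mul_assoc]

/-- A factor with zero reduction raises the filtration by one. With `extFilt_eq_bot`, this is the
source of the nilpotency of matrices and derivations and of the uniqueness of morphisms. -/
lemma mul_mem_extFilt_succ {a z : Ext O} (j : ℕ) (ha : aug O a = 0) (hz : z ∈ extFilt O j) :
    a * z ∈ extFilt O (j + 1) := by
  have h : a * z ∈ extFilt O 1 * extFilt O j := Submodule.mul_mem_mul (mem_extFilt_one ha) hz
  have e : extFilt O 1 * extFilt O j ≤ extFilt O (j + 1) := by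
    calc extFilt O 1 * extFilt O j
        = LinearMap.range (ExteriorAlgebra.ι ℝ (M := O → ℝ)) * (⊤ * extFilt O j) := by
          rw [extFilt, pow_one, mul_assoc]
      _ ≤ LinearMap.range (ExteriorAlgebra.ι ℝ (M := O → ℝ)) * extFilt O j :=
          mul_le_mul' le_rfl (top_mul_extFilt j)
      _ = extFilt O (j + 1) := by rw [extFilt, extFilt, pow_succ', mul_assoc]
  exact e h

/-- The exterior power of degree one more than the number of generators has dimension a vanishing
binomial coefficient. -/
lemma extFilt_eq_bot [Fintype O] : extFilt O (Fintype.card O + 1) = ⊥ := by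
  have : LinearMap.range (ExteriorAlgebra.ι ℝ (M := O → ℝ)) ^ (Fintype.card O + 1) = ⊥ := by
    have h : Module.finrank ℝ (⋀[ℝ]^(Fintype.card O + 1) (O → ℝ)) = 0 := by
      rw [exteriorPower.finrank_eq, Module.finrank_fintype_fun_eq_card]
      exact Nat.choose_eq_zero_of_lt (Nat.lt_succ_self _)
    have : Module.Finite ℝ (Ext O) := by
      obtain ⟨κ, _, ⟨b⟩⟩ := exists_finite_basis O
      exact Module.Finite.of_basis b
    exact Submodule.finrank_eq_zero.1 h
  rw [extFilt, this, Submodule.bot_mul]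

/-- The involution is `-1` on generators, so it records the sign produced by moving `ι v` past `x`.
-/
lemma ι_mul (v : O → ℝ) (x : Ext O) :
    ExteriorAlgebra.ι ℝ v * x = CliffordAlgebra.involute x * ExteriorAlgebra.ι ℝ v := by
  induction x using ExteriorAlgebra.induction with
  | algebraMap r => rw [AlgHom.commutes, Algebra.commutes]
  | ι w =>
    have h : CliffordAlgebra.involute (ExteriorAlgebra.ι ℝ w) = -ExteriorAlgebra.ι ℝ w :=
      CliffordAlgebra.involute_ι _
    rw [h, neg_mul]
    exact eq_neg_of_add_eq_zero_left (ExteriorAlgebra.ι_add_mul_swap v w)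
  | mul a b ha hb => rw [map_mul, ← mul_assoc, ha, mul_assoc, hb, mul_assoc]
  | add a b ha hb => rw [map_add, mul_add, add_mul, ha, hb]

lemma even_comm {x : Ext O} (hx : x ∈ extParity O 0) (y : Ext O) : x * y = y * x := by
  induction y using ExteriorAlgebra.induction with
  | algebraMap r => rw [Algebra.commutes]
  | ι w => rw [ι_mul, CliffordAlgebra.involute_eq_of_mem_even hx]
  | mul a b ha hb => rw [← mul_assoc, ha, mul_assoc, hb, mul_assoc]
  | add a b ha hb => rw [mul_add, add_mul, ha, hb]

lemma odd_mul {y : Ext O} (hy : y ∈ extParity O 1) (x : Ext O) :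
    y * x = CliffordAlgebra.involute x * y := by
  induction x using ExteriorAlgebra.induction with
  | algebraMap r => rw [AlgHom.commutes, Algebra.commutes]
  | ι w =>
    have h : CliffordAlgebra.involute (ExteriorAlgebra.ι ℝ w) = -ExteriorAlgebra.ι ℝ w :=
      CliffordAlgebra.involute_ι _
    have h2 := ι_mul w y
    rw [CliffordAlgebra.involute_eq_of_mem_odd hy] at h2
    rw [h, neg_mul, h2, neg_mul, neg_neg]
  | mul a b ha hb => rw [map_mul, ← mul_assoc, ha, mul_assoc, hb, mul_assoc]
  | add a b ha hb => rw [map_add, mul_add, add_mul, ha, hb]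

/-- Oddness gives `y * y = -(y * y)`, and `2` is invertible in `ℝ`. -/
lemma odd_sq {y : Ext O} (hy : y ∈ extParity O 1) : y * y = 0 := by
  have h := odd_mul hy y
  rw [CliffordAlgebra.involute_eq_of_mem_odd hy, neg_mul] at h
  have h2 : (2 : ℝ) • (y * y) = 0 := by
    rw [two_smul]
    exact eq_neg_iff_add_eq_zero.1 h
  exact (smul_eq_zero.1 h2).resolve_left two_ne_zero

end ext

/-! ### Units in rings of superfunctions -/

section units

variable {E O : Type} [Fintype E] [Fintype O] {U : Opens (E → ℝ)}

lemma SmoothReal.continuous {f : U → ℝ} (hf : SmoothReal U f) : Continuous f := by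
  rw [continuous_iff_continuousAt]
  intro x
  have h : f = extendZero U f ∘ Subtype.val := by
    funext y
    exact (extendZero_apply f y).symm
  rw [h]
  exact ContinuousAt.comp (hf x).continuousAt continuous_subtype_val.continuousAt

lemma SmoothReal.inv {f : U → ℝ} (hf : SmoothReal U f) (h0 : ∀ x, f x ≠ 0) :
    SmoothReal U (fun x => (f x)⁻¹) :=
  SmoothReal.of_local fun x => ⟨_, (hf x).inv (by rw [extendZero_apply]; exact h0 x), ⊤, trivial,
    fun y _ => by rw [Pi.inv_apply, extendZero_apply]⟩

/-- The algebra of smooth real functions on an open subset of `ℝ^E`. -/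
def realFunctions (E : Type) [Fintype E] (U : Opens (E → ℝ)) : Subalgebra ℝ (U → ℝ) where
  carrier := {f | SmoothReal U f}
  mul_mem' hf hg := SmoothReal.mul hf hg
  add_mem' hf hg := SmoothReal.add hf hg
  algebraMap_mem' r := SmoothReal.of_contDiff (g := fun _ => r) contDiff_const

lemma isUnit_realFunctions (f : realFunctions E U) (h : ∀ x, f.1 x ≠ 0) : IsUnit f :=
  IsUnit.of_mul_eq_one (⟨_, SmoothReal.inv f.2 h⟩ : realFunctions E U)
    (Subtype.ext (funext fun x => mul_inv_cancel₀ (h x)))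

/-- The value of a superfunction at a point, an element of the exterior algebra. -/
def evalAt (x : U) : superFunctions E O U →ₐ[ℝ] Ext O :=
  (Pi.evalAlgHom ℝ (fun _ : U => Ext O) x).comp (superFunctions E O U).val

lemma evalAt_apply (x : U) (f : superFunctions E O U) : evalAt x f = f.1 x := rfl

/-- The reduction of a superfunction to a real function. -/
def reduction (E O : Type) [Fintype E] [Fintype O] (U : Opens (E → ℝ)) :
    superFunctions E O U →ₐ[ℝ] realFunctions E U where
  toFun f := ⟨fun x => aug O (f.1 x), f.2 (aug O).toLinearMap⟩
  map_one' := Subtype.ext (funext fun _ => map_one _)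
  map_zero' := Subtype.ext (funext fun _ => map_zero _)
  map_mul' _ _ := Subtype.ext (funext fun _ => map_mul _ _ _)
  map_add' _ _ := Subtype.ext (funext fun _ => map_add _ _ _)
  commutes' _ := Subtype.ext (funext fun _ => AlgHom.commutes _ _)

/-- Real functions as superfunctions. -/
def ofReal (E O : Type) [Fintype E] [Fintype O] (U : Opens (E → ℝ)) :
    realFunctions E U →ₐ[ℝ] superFunctions E O U where
  toFun f := ⟨fun x => algebraMap ℝ (Ext O) (f.1 x), fun l => by
    have h : (fun x => l (algebraMap ℝ (Ext O) (f.1 x))) = fun x => f.1 x * l 1 := by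
      funext x
      rw [Algebra.algebraMap_eq_smul_one, map_smul, smul_eq_mul]
    rw [h]
    exact SmoothReal.mul f.2 (SmoothReal.of_contDiff (g := fun _ => l 1) contDiff_const)⟩
  map_one' := Subtype.ext (funext fun _ => map_one _)
  map_zero' := Subtype.ext (funext fun _ => map_zero _)
  map_mul' _ _ := Subtype.ext (funext fun _ => map_mul _ _ _)
  map_add' _ _ := Subtype.ext (funext fun _ => map_add _ _ _)
  commutes' _ := rfl

lemma reduction_ofReal (f : realFunctions E U) : reduction E O U (ofReal E O U f) = f :=
  Subtype.ext (funext fun _ => AlgHom.commutes _ _)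

lemma reduction_apply (f : superFunctions E O U) (x : U) :
    (reduction E O U f).1 x = aug O (evalAt x f) := rfl

variable {ν : Type} [Fintype ν] [DecidableEq ν]

/-- The entries of the `j`-th power lie in the `j`-th step of the filtration, which ends at zero. -/
lemma isNilpotent_matrix (N : Matrix ν ν (superFunctions E O U))
    (hN : ∀ i j, reduction E O U (N i j) = 0) : IsNilpotent N := by
  refine ⟨Fintype.card O + 1, ?_⟩
  have key : ∀ (j : ℕ) (r s : ν) (x : U), evalAt x ((N ^ j) r s) ∈ extFilt O j := by
    intro j
    induction j with
    | zero => exact fun r s x => mem_extFilt_zero _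
    | succ j ih =>
      intro r s x
      rw [pow_succ', Matrix.mul_apply, map_sum]
      refine Submodule.sum_mem _ fun c _ => ?_
      rw [map_mul]
      refine mul_mem_extFilt_succ j ?_ (ih c s x)
      rw [← reduction_apply, hN]
      rfl
  ext1 r s
  refine Subtype.ext (funext fun x => ?_)
  have := key (Fintype.card O + 1) r s x
  rw [extFilt_eq_bot] at this
  exact (Submodule.mem_bot ℝ).1 this

/-- Superfunctions do not commute, so the determinant is used only after reduction. The invertible
reduced matrix is lifted to a unit `u`; then `B = u(1 + N)`, where `N = u⁻¹(B - u)` reduces to zero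
and is nilpotent. -/
theorem isUnit_matrix (B : Matrix ν ν (superFunctions E O U))
    (h : ∀ x : U, IsUnit (B.map fun f => aug O (evalAt x f))) : IsUnit B := by
  let ρ := (reduction E O U).mapMatrix (m := ν)
  let σ := (ofReal E O U).mapMatrix (m := ν)
  have hρσ : ∀ C, ρ (σ C) = C := fun C => by
    ext1 r s
    exact reduction_ofReal _
  have h0 : IsUnit (ρ B) := by
    rw [Matrix.isUnit_iff_isUnit_det]
    refine isUnit_realFunctions _ fun x => ?_
    let e : realFunctions E U →ₐ[ℝ] ℝ := (Pi.evalAlgHom ℝ (fun _ : U => ℝ) x).comp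
      (realFunctions E U).val
    have h1 := (Matrix.isUnit_iff_isUnit_det _).1 (h x)
    have h2 : e (ρ B).det = (B.map fun f => aug O (evalAt x f)).det := by
      rw [AlgHom.map_det]
      rfl
    change e (ρ B).det ≠ 0
    rw [h2]
    exact h1.ne_zero
  obtain ⟨u, hu⟩ := h0.map σ
  have hN : IsNilpotent (((u⁻¹ : (Matrix ν ν (superFunctions E O U))ˣ) :
      Matrix ν ν (superFunctions E O U)) * (B - u)) := by
    refine isNilpotent_matrix _ fun i j => ?_
    have : ρ (((u⁻¹ : (Matrix ν ν (superFunctions E O U))ˣ) :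
      Matrix ν ν (superFunctions E O U)) * (B - u)) = 0 := by
      rw [map_mul, map_sub, hu, hρσ, sub_self, mul_zero]
    exact congrFun (congrFun this i) j
  have e : B = u * (1 + ((u⁻¹ : (Matrix ν ν (superFunctions E O U))ˣ) :
      Matrix ν ν (superFunctions E O U)) * (B - u)) := by
    rw [mul_add, mul_one, ← mul_assoc, Units.mul_inv, one_mul]
    abel
  rw [e]
  exact u.isUnit.mul hN.isUnit_one_add

end units

/-! ### Hadamard's lemma -/

section hadamard

open MeasureTheory intervalIntegral Set

/-- Differentiation under the integral sign gains one order at a time. The target `G` is quantified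
inside the induction because the derivative takes values in `V →L[ℝ] G`. -/
lemma contDiff_integral_nat {V : Type} [NormedAddCommGroup V] [NormedSpace ℝ V] [ProperSpace V]
    (n : ℕ) : ∀ {G : Type} [NormedAddCommGroup G] [NormedSpace ℝ G] [CompleteSpace G]
    {F : V → ℝ → G}, ContDiff ℝ ∞ (Function.uncurry F) →
      ContDiff ℝ n (fun v => ∫ s in (0 : ℝ)..1, F v s) := by
  induction n with
  | zero =>
    intro G _ _ _ F hF
    exact contDiff_zero.2
      (continuous_parametric_intervalIntegral_of_continuous' hF.continuous 0 1)
  | succ n ih =>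
    intro G _ _ _ F hF
    let F' : V → ℝ → V →L[ℝ] G := fun v s =>
      (fderiv ℝ (Function.uncurry F) (v, s)).comp (ContinuousLinearMap.inl ℝ V ℝ)
    have hF' : ContDiff ℝ ∞ (Function.uncurry F') :=
      (hF.fderiv_right (m := ∞) (by simp)).clm_comp contDiff_const
    have hd : ∀ v s, HasFDerivAt (fun v => F v s) (F' v s) v := fun v s =>
      HasFDerivAt.comp (f := fun w => (w, s)) v
        ((hF.differentiable (by simp)) (v, s)).hasFDerivAt (hasFDerivAt_prodMk_left v s)
    have hint : ∀ v, HasFDerivAt (fun v => ∫ s in (0 : ℝ)..1, F v s)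
        (∫ s in (0 : ℝ)..1, F' v s) v := by
      intro v
      -- Compactness of a closed ball times `[0, 1]` supplies the constant that dominates the
      -- derivative.
      have hK : IsCompact (Metric.closedBall v 1 ×ˢ Icc (0 : ℝ) 1) :=
        (isCompact_closedBall v 1).prod isCompact_Icc
      obtain ⟨C, hC⟩ := hK.exists_bound_of_continuousOn
        (f := Function.uncurry F') hF'.continuous.continuousOn
      refine hasFDerivAt_integral_of_dominated_of_fderiv_le (bound := fun _ => C)
        (Metric.closedBall_mem_nhds v one_pos) ?_ ?_ ?_ ?_ ?_ ?_
      · exact Filter.Eventually.of_forall fun w =>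
          (hF.continuous.comp (Continuous.prodMk_right w)).aestronglyMeasurable
      · exact (hF.continuous.comp (Continuous.prodMk_right v)).intervalIntegrable _ _
      · exact (hF'.continuous.comp (Continuous.prodMk_right v)).aestronglyMeasurable
      · refine Filter.Eventually.of_forall fun s hs w hw => hC (w, s) ⟨hw, ?_⟩
        rw [uIoc_of_le zero_le_one] at hs
        exact ⟨hs.1.le, hs.2⟩
      · exact intervalIntegrable_const
      · exact Filter.Eventually.of_forall fun s _ w _ => hd w s
    have hfd : fderiv ℝ (fun v => ∫ s in (0 : ℝ)..1, F v s) =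
        fun v => ∫ s in (0 : ℝ)..1, F' v s := funext fun v => (hint v).fderiv
    push_cast
    refine contDiff_succ_iff_fderiv.2 ⟨fun v => (hint v).differentiableAt, by simp, ?_⟩
    rw [hfd]
    exact ih hF'

lemma contDiff_integral {V G : Type} [NormedAddCommGroup V] [NormedSpace ℝ V] [ProperSpace V]
    [NormedAddCommGroup G] [NormedSpace ℝ G] [CompleteSpace G] {F : V → ℝ → G}
    (hF : ContDiff ℝ ∞ (Function.uncurry F)) :
    ContDiff ℝ ∞ (fun v => ∫ s in (0 : ℝ)..1, F v s) :=
  contDiff_infty.2 fun n => contDiff_integral_nat n hF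

variable {E : Type} [Fintype E]

/-- Integrate the derivative of `h` along the segment from `y` to `t`. The coefficients are the
integrals of `∂ₑh(y + s(t - y))` over `s` in `[0, 1]`. -/
lemma exists_hadamard {h : (E → ℝ) → ℝ} (hh : ContDiff ℝ ∞ h) (y : E → ℝ) :
    ∃ g : E → (E → ℝ) → ℝ, (∀ e, ContDiff ℝ ∞ (g e)) ∧
      ∀ t, h t = h y + ∑ e, (t e - y e) * g e t := by
  classical
  let γ : (E → ℝ) × ℝ → (E → ℝ) := fun p => y + p.2 • (p.1 - y)
  have hγ : ContDiff ℝ ∞ γ :=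
    contDiff_const.add (contDiff_snd.smul (contDiff_fst.sub contDiff_const))
  have hfd : ContDiff ℝ ∞ (fderiv ℝ h) := hh.fderiv_right (by simp)
  have hF : ∀ e, ContDiff ℝ ∞ (fun p : (E → ℝ) × ℝ => fderiv ℝ h (γ p) (Pi.single e 1)) :=
    fun e => (hfd.comp hγ).clm_apply contDiff_const
  refine ⟨fun e t => ∫ s in (0 : ℝ)..1, fderiv ℝ h (γ (t, s)) (Pi.single e 1),
    fun e => contDiff_integral (hF e), fun t => ?_⟩
  have hd : ∀ s : ℝ, HasDerivAt (fun s : ℝ => h (γ (t, s))) (fderiv ℝ h (γ (t, s)) (t - y)) s := by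
    intro s
    have h1 : HasDerivAt (fun s : ℝ => γ (t, s)) (t - y) s := by
      have := ((hasDerivAt_id s).smul_const (t - y)).const_add y
      rwa [one_smul] at this
    exact ((hh.differentiable (by simp)) _).hasFDerivAt.comp_hasDerivAt s h1
  have hsum : ∀ s : ℝ, fderiv ℝ h (γ (t, s)) (t - y) =
      ∑ e, (t e - y e) * fderiv ℝ h (γ (t, s)) (Pi.single e 1) := by
    intro s
    conv_lhs => rw [← Finset.univ_sum_single (t - y)]
    rw [map_sum]
    refine Finset.sum_congr rfl fun e _ => ?_
    rw [show Pi.single e ((t - y) e) = (t e - y e) • (Pi.single e 1 : E → ℝ) by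
        rw [← Pi.single_smul]; simp, map_smul, smul_eq_mul]
  have hcont : ∀ e, Continuous fun s : ℝ => fderiv ℝ h (γ (t, s)) (Pi.single e 1) := fun e =>
    (hF e).continuous.comp (Continuous.prodMk_right t)
  have hI := integral_eq_sub_of_hasDerivAt (a := 0) (b := 1) (fun s _ => hd s) (by
    refine Continuous.intervalIntegrable ?_ _ _
    simp only [hsum]
    exact continuous_finsetSum _ fun e _ => continuous_const.mul (hcont e))
  simp only [hsum] at hI
  rw [integral_finsetSum (f := fun e s => (t e - y e) * fderiv ℝ h (γ (t, s)) (Pi.single e 1))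
    fun e _ => (continuous_const.mul (hcont e)).intervalIntegrable _ _] at hI
  simp only [intervalIntegral.integral_const_mul] at hI
  rw [hI]
  simp [γ]

/-- The segment from `y` need not stay in `U`, so the previous lemma is used only near `y`, for a
cut-off of `f`. Away from `y` the coefficients `(tₑ - yₑ)(f t - f y)/|t - y|²` serve; a bump
function interpolates. -/
lemma SmoothReal.exists_hadamard {U : Opens (E → ℝ)} {f : U → ℝ} (hf : SmoothReal U f) (y : U) :
    ∃ g : E → U → ℝ, (∀ e, SmoothReal U (g e)) ∧
      ∀ t : U, f t = f y + ∑ e, (t.1 e - y.1 e) * g e t := by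
  obtain ⟨r, hr, hball⟩ := Metric.isOpen_iff.1 U.isOpen y.1 y.2
  -- `χ₁` is supported inside `U` and equals `1` on the ball of radius `r / 3`, which is the support
  -- of `χ`. So wherever `χ` is nonzero, the cut-off function `χ₁ f` agrees with `f`.
  let χ₁ : ContDiffBump y.1 := ⟨r / 3, r / 2, by positivity, by linarith⟩
  let χ : ContDiffBump y.1 := ⟨r / 6, r / 3, by positivity, by linarith⟩
  have hsmooth : ContDiff ℝ ∞ (fun t => χ₁ t * extendZero U f t) := by
    rw [contDiff_iff_contDiffAt]
    intro t
    by_cases ht : t ∈ U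
    · exact χ₁.contDiff.contDiffAt.mul (hf ⟨t, ht⟩)
    · have hts : t ∉ tsupport χ₁ := by
        rw [χ₁.tsupport_eq]
        intro h
        exact ht (hball (Metric.closedBall_subset_ball (by change r / 2 < r; linarith) h))
      refine (contDiffAt_const (c := (0 : ℝ))).congr_of_eventuallyEq ?_
      filter_upwards [notMem_tsupport_iff_eventuallyEq.1 hts] with s hs
      rw [hs, Pi.zero_apply, zero_mul]
  obtain ⟨g, hg, hgt⟩ := Super.exists_hadamard hsmooth y.1
  let q : (E → ℝ) → ℝ := fun t => ∑ e, (t e - y.1 e) * (t e - y.1 e)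
  have hq0 : ∀ t, t ≠ y.1 → q t ≠ 0 := by
    intro t ht h0
    apply ht
    funext e
    have := (Finset.sum_eq_zero_iff_of_nonneg fun e _ => mul_self_nonneg (t e - y.1 e)).1 h0 e
      (Finset.mem_univ e)
    exact sub_eq_zero.1 (mul_self_eq_zero.1 this)
  have hcoord : ∀ e, ContDiff ℝ ∞ (fun t : E → ℝ => t e - y.1 e) := fun e =>
    (contDiff_apply ℝ ℝ e).sub contDiff_const
  have hq : ContDiff ℝ ∞ q := ContDiff.sum fun e _ => (hcoord e).mul (hcoord e)
  -- The quotient is singular only at `y`, and its factor `1 - χ` vanishes on the ball of radius `r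
  -- / 6`.
  let G : E → (E → ℝ) → ℝ := fun e t =>
    χ t * g e t + (1 - χ t) * ((t e - y.1 e) * (extendZero U f t - f y) / q t)
  refine ⟨fun e t => G e t.1, fun e => SmoothReal.of_local fun t => ?_, fun t => ?_⟩
  · by_cases ht : t = y
    · refine ⟨g e, (hg e).contDiffAt, ⟨Metric.ball y.1 (r / 6), Metric.isOpen_ball⟩,
        by rw [ht]; exact Metric.mem_ball_self (by positivity), fun s hs => ?_⟩
      have : χ s.1 = 1 := χ.one_of_mem_closedBall (Metric.ball_subset_closedBall hs)
      simp only [G, this]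
      ring
    · have hty : t.1 ≠ y.1 := fun h => ht (Subtype.ext h)
      refine ⟨G e, ?_, ⊤, trivial, fun _ _ => rfl⟩
      exact (χ.contDiff.contDiffAt.mul (hg e).contDiffAt).add
        ((contDiffAt_const.sub χ.contDiff.contDiffAt).mul
          (((hcoord e).contDiffAt.mul ((hf t).sub contDiffAt_const)).div hq.contDiffAt
            (hq0 _ hty)))
  · have h1 : χ t.1 * (∑ e, (t.1 e - y.1 e) * g e t.1) = χ t.1 * (f t - f y) := by
      by_cases hts : t.1 ∈ Metric.ball y.1 (r / 3)
      · have e1 : χ₁ t.1 = 1 := χ₁.one_of_mem_closedBall (Metric.ball_subset_closedBall hts)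
        have e2 : χ₁ y.1 = 1 := χ₁.one_of_mem_closedBall
          (Metric.mem_closedBall_self (by change 0 ≤ r / 3; positivity))
        have := hgt t.1
        rw [e1, e2, extendZero_apply, extendZero_apply] at this
        rw [show f t - f y = ∑ e, (t.1 e - y.1 e) * g e t.1 by linarith]
      · have : χ t.1 = 0 := by
          rw [← Function.notMem_support, χ.support_eq]
          exact hts
        rw [this, zero_mul, zero_mul]
    have h2 : ∑ e, (t.1 e - y.1 e) * ((1 - χ t.1) *
        ((t.1 e - y.1 e) * (extendZero U f t.1 - f y) / q t.1)) = (1 - χ t.1) * (f t - f y) := by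
      rw [extendZero_apply]
      by_cases ht : t = y
      · subst ht; simp
      · have hq' := hq0 _ fun h => ht (Subtype.ext h)
        calc _ = ∑ e, ((t.1 e - y.1 e) * (t.1 e - y.1 e)) *
              ((1 - χ t.1) * (f t - f y) / q t.1) := by
              refine Finset.sum_congr rfl fun e _ => ?_
              field_simp
          _ = q t.1 * ((1 - χ t.1) * (f t - f y) / q t.1) := by rw [← Finset.sum_mul]
          _ = _ := by field_simp
    have h3 : ∑ e, (t.1 e - y.1 e) * G e t.1 =
        χ t.1 * (∑ e, (t.1 e - y.1 e) * g e t.1) + ∑ e, (t.1 e - y.1 e) * ((1 - χ t.1) *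
          ((t.1 e - y.1 e) * (extendZero U f t.1 - f y) / q t.1)) := by
      rw [Finset.mul_sum, ← Finset.sum_add_distrib]
      refine Finset.sum_congr rfl fun e _ => ?_
      simp only [G]
      ring
    rw [h3, h1, h2]
    ring

end hadamard

/-! ### Characters and the uniqueness of morphisms to superdomains -/

section characters

/-- A compatible family of real characters of the sections near a point. -/
def IsCharacter (T : SuperSpace) (t : T.carrier)
    (γ : ∀ W : Opens T.carrier, t ∈ W → (T.sec W →ₐ[ℝ] ℝ)) : Prop :=
  ∀ (V W : Opens T.carrier) (h : V ≤ W) (ht : t ∈ V) (a : T.sec W),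
    γ V ht (T.res h a) = γ W (h ht) a

variable {E O : Type} [Fintype E] [Fintype O]

/-- The value of a section of a superdomain at a point. -/
def valueAt {U : Opens (superdomain E O).carrier} (x : (superdomain E O).carrier) (hx : x ∈ U) :
    (superdomain E O).sec U →ₐ[ℝ] Ext O :=
  (evalAt ⟨x, hx⟩ : superFunctions E O U →ₐ[ℝ] Ext O)

/-- The character of a superdomain at a point. -/
def bodyAt {U : Opens (superdomain E O).carrier} (x : (superdomain E O).carrier) (hx : x ∈ U) :
    (superdomain E O).sec U →ₐ[ℝ] ℝ :=
  (aug O).comp (valueAt x hx)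

lemma isUnit_section {U : Opens (E → ℝ)} (a : superFunctions E O U)
    (h : ∀ x : U, aug O (evalAt x a) ≠ 0) : IsUnit a := by
  have h1 : IsUnit (Matrix.of fun _ _ : Unit => a) := isUnit_matrix _ fun x => by
    rw [Matrix.isUnit_iff_isUnit_det, Matrix.det_unique]
    exact (h x).isUnit
  obtain ⟨u, hu⟩ := h1
  refine isUnit_iff_exists.2 ⟨(u⁻¹).1 () (), ?_, ?_⟩
  · have := congrFun (congrFun u.mul_inv ()) ()
    rw [hu, Matrix.mul_apply, Fintype.sum_unique] at this
    exact this
  · have := congrFun (congrFun u.inv_mul ()) ()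
    rw [hu, Matrix.mul_apply, Fintype.sum_unique] at this
    exact this

lemma continuous_body_section {U : Opens (E → ℝ)} (a : superFunctions E O U) :
    Continuous fun x : U => aug O (evalAt x a) :=
  SmoothReal.continuous (a.2 (aug O).toLinearMap)

/-- If `γ a` differed from the value of `a` at `x`, then `a - γ a` would have nonzero reduction near
`x` and be invertible there. But `γ` maps it to zero. -/
lemma IsCharacter.eq_bodyAt {x : (superdomain E O).carrier}
    {γ : ∀ W : Opens (superdomain E O).carrier, x ∈ W → ((superdomain E O).sec W →ₐ[ℝ] ℝ)}
    (hγ : IsCharacter (superdomain E O) x γ) {W : Opens (superdomain E O).carrier} (hx : x ∈ W)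
    (a : (superdomain E O).sec W) : γ W hx a = bodyAt x hx a := by
  by_contra hne
  let c : ℝ := γ W hx a
  let b : (superdomain E O).sec W := a - algebraMap ℝ _ c
  have hb0 : γ W hx b = 0 := by
    refine (map_sub (γ W hx) a (algebraMap ℝ _ c)).trans ?_
    rw [AlgHom.commutes]
    exact sub_self _
  have hbx : bodyAt x hx b ≠ 0 := by
    rw [map_sub, AlgHom.commutes]
    exact sub_ne_zero.2 fun h => hne h.symm
  let V : Opens (superdomain E O).carrier := img W
    ⟨{y | bodyAt y.1 y.2 b ≠ 0}, isOpen_ne_fun (continuous_body_section (U := W) b)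
      continuous_const⟩
  have hV : V ≤ W := by rintro _ ⟨y, -, rfl⟩; exact y.2
  have hu : IsUnit ((superdomain E O).res hV b) := isUnit_section (U := V) _ (by
    rintro ⟨_, y, hy, rfl⟩
    exact hy)
  have hxV : x ∈ V := ⟨⟨x, hx⟩, hbx, rfl⟩
  have := hu.map (γ V hxV)
  rw [hγ V W hV hxV, hb0] at this
  exact not_isUnit_zero this

lemma IsCharacter.comp {M N : SuperSpace} (f : M ⟶ N) {m : M.carrier}
    {γ : ∀ W : Opens M.carrier, m ∈ W → (M.sec W →ₐ[ℝ] ℝ)} (hγ : IsCharacter M m γ) :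
    IsCharacter N (f.base m) fun W hW =>
      (γ (pre f.base f.continuous_base W) hW).comp (f.app W) := by
  intro V W h ht a
  have h1 := hγ (pre f.base f.continuous_base V) (pre f.base f.continuous_base W) (pre_mono h) ht
    (f.app W a)
  exact (congrArg (γ (pre f.base f.continuous_base V) ht) (f.app_res h a)).trans h1

/-- The composite of `γ` with the pullback is a character at `f.base m`, hence evaluation there. So
the base map of `f` is already determined by the pullback of sections. -/
lemma IsCharacter.bodyAt_base {M : SuperSpace} (f : M ⟶ superdomain E O) {m : M.carrier}
    {γ : ∀ W : Opens M.carrier, m ∈ W → (M.sec W →ₐ[ℝ] ℝ)} (hγ : IsCharacter M m γ)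
    {W : Opens (superdomain E O).carrier} {A : Opens M.carrier} (hA : m ∈ A)
    (hW : A ≤ pre f.base f.continuous_base W) (a : (superdomain E O).sec W) :
    γ A hA (pullOn f hW a) = bodyAt (f.base m) (hW hA) a := by
  exact (hγ _ _ hW hA _).trans ((hγ.comp f).eq_bodyAt (hW hA) a)

lemma IsCharacter.base_apply {M : SuperSpace} (f : M ⟶ superdomain E O) {m : M.carrier}
    {γ : ∀ W : Opens M.carrier, m ∈ W → (M.sec W →ₐ[ℝ] ℝ)} (hγ : IsCharacter M m γ) (e : E) :
    γ ⊤ trivial (pull f (evenCoord e)) = f.base m e := by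
  exact (hγ.bodyAt_base f (A := ⊤) trivial (le_pre_top _) _).trans (AlgHom.commutes (aug O) _)

lemma IsCharacter.odd_eq_zero {M : SuperSpace} {m : M.carrier}
    {γ : ∀ W : Opens M.carrier, m ∈ W → (M.sec W →ₐ[ℝ] ℝ)} (W : Opens M.carrier) (hm : m ∈ W)
    {a : M.sec W} (h : a * a = 0) : γ W hm a = 0 := by
  have : γ W hm (a * a) = 0 := by rw [h, map_zero]
  rw [map_mul] at this
  exact mul_self_eq_zero.1 this

lemma bodyAt_isCharacter (D : Opens (superdomain E O).carrier) (d : D) :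
    IsCharacter ((superdomain E O).restrict D) d
      fun W hW => bodyAt (U := img D W) d.1 ⟨d, hW, rfl⟩ := fun _ _ _ _ _ => rfl

end characters

/-! ### Morphisms to superdomains are determined by the coordinates -/

section uniqueness

variable {E O O' : Type} [Fintype E] [Fintype O] [Fintype O'] {B : Opens (E → ℝ)}

/-- The constant superfunctions. -/
def constSection (E O : Type) [Fintype E] [Fintype O] (B : Opens (E → ℝ)) :
    Ext O →ₐ[ℝ] superFunctions E O B where
  toFun c := ⟨fun _ => c, SmoothExt.const c⟩
  map_one' := rfl
  map_mul' _ _ := rfl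
  map_zero' := rfl
  map_add' _ _ := rfl
  commutes' _ := rfl

/-- The restricted even coordinates. -/
def evenOn (O : Type) [Fintype O] (B : Opens (E → ℝ)) (e : E) : superFunctions E O B :=
  (superdomain E O).res (le_top : B ≤ ⊤) (evenCoord e)

/-- The restricted odd coordinates. -/
def oddOn (E : Type) [Fintype E] [DecidableEq O] (B : Opens (E → ℝ)) (o : O) :
    superFunctions E O B :=
  (superdomain E O).res (le_top : B ≤ ⊤) (oddCoord o)

lemma exists_sum_ofReal_mul_const (O : Type) [Fintype O] :
    ∃ (κ : Type) (_ : Fintype κ) (b : κ → Ext O) (c : κ → Ext O →ₗ[ℝ] ℝ),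
      ∀ {E : Type} [Fintype E] {B : Opens (E → ℝ)} (f : superFunctions E O B),
        f = ∑ i, ofReal E O B ⟨fun x => c i (f.1 x), f.2 (c i)⟩ * constSection E O B (b i) := by
  obtain ⟨κ, hκ, ⟨b⟩⟩ := exists_finite_basis O
  refine ⟨κ, hκ, b, b.coord, fun {E} _ {B} f => Subtype.ext (funext fun x => ?_)⟩
  change evalAt x f = evalAt x _
  rw [map_sum]
  conv_lhs => rw [← b.sum_repr (evalAt x f)]
  refine Finset.sum_congr rfl fun i _ => ?_
  rw [map_mul, Algebra.smul_def]
  rfl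

/-- By Hadamard's lemma at `y`, a real function is a constant plus a sum of terms `(xₑ - yₑ)gₑ`.
Both morphisms agree on `xₑ - yₑ` and give it zero reduction, so their difference on the function
lies one filtration step deeper than their differences on the `gₑ`. By induction it lies in every
step, hence is zero. On constants the universal property of the exterior algebra applies. -/
theorem algHom_eq_of_coords [DecidableEq O] (y : B) (α α' : superFunctions E O B →ₐ[ℝ] Ext O')
    (hα : ∀ f, aug O' (α f) = aug O (evalAt y f))
    (he : ∀ e, α (evenOn O B e) = α' (evenOn O B e))
    (ho : ∀ o, α (oddOn E B o) = α' (oddOn E B o)) : α = α' := by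
  have hreal : ∀ (j : ℕ) (h : realFunctions E B),
      α (ofReal E O B h) - α' (ofReal E O B h) ∈ extFilt O' j := by
    intro j
    induction j with
    | zero => exact fun _ => mem_extFilt_zero _
    | succ j ih =>
      intro h
      obtain ⟨g, hg, hgt⟩ := SmoothReal.exists_hadamard h.2 y
      have key : ofReal E O B h = algebraMap ℝ _ (h.1 y) +
          ∑ e, (evenOn O B e - algebraMap ℝ _ (y.1 e)) * ofReal E O B ⟨g e, hg e⟩ := by
        refine Subtype.ext (funext fun x => ?_)
        have e1 : evalAt x (ofReal E O B h) = algebraMap ℝ (Ext O) (h.1 x) := rfl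
        refine e1.trans (Eq.trans ?_ (evalAt_apply x _))
        rw [map_add, map_sum, hgt x, map_add, map_sum, AlgHom.commutes]
        congr 1
        refine Finset.sum_congr rfl fun e _ => ?_
        rw [map_mul, map_mul, map_sub, map_sub, AlgHom.commutes]
        rfl
      rw [key, map_add, map_add, map_sum, map_sum, AlgHom.commutes, AlgHom.commutes,
        add_sub_add_left_eq_sub, ← Finset.sum_sub_distrib]
      refine Submodule.sum_mem _ fun e _ => ?_
      rw [map_mul, map_mul, map_sub, map_sub, ← he, AlgHom.commutes, AlgHom.commutes, ← mul_sub]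
      refine mul_mem_extFilt_succ j ?_ (ih _)
      rw [map_sub, hα, AlgHom.commutes]
      exact sub_eq_zero.2 (AlgHom.commutes _ _)
  have hconst : α.comp (constSection E O B) = α'.comp (constSection E O B) := by
    apply ExteriorAlgebra.hom_ext
    refine LinearMap.pi_ext' fun o => LinearMap.ext_ring ?_
    exact ho o
  obtain ⟨κ, _, b, c, hbc⟩ := exists_sum_ofReal_mul_const O
  ext f
  rw [hbc f, map_sum, map_sum]
  refine Finset.sum_congr rfl fun i _ => ?_
  rw [map_mul, map_mul]
  have h1 := hreal (Fintype.card O' + 1) ⟨fun x => c i (f.1 x), f.2 (c i)⟩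
  rw [extFilt_eq_bot, Submodule.mem_bot, sub_eq_zero] at h1
  rw [h1]
  exact congrArg _ (DFunLike.congr_fun hconst (b i))

variable {E' : Type} [Fintype E']

/-- The base maps agree because characters read them off from the even coordinates. Pullback
followed by evaluation at a point is then handled by `algHom_eq_of_coords`. -/
theorem hom_superdomain_ext [DecidableEq O] {D : Opens (superdomain E' O').carrier}
    {f g : (superdomain E' O').restrict D ⟶ superdomain E O}
    (he : ∀ e, pull f (evenCoord e) = pull g (evenCoord e))
    (ho : ∀ o, pull f (oddCoord o) = pull g (oddCoord o)) : f = g := by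
  have hb : ∀ d, f.base d = g.base d := fun d => funext fun e => by
    exact ((bodyAt_isCharacter D d).base_apply f e).symm.trans
      ((congrArg _ (he e)).trans ((bodyAt_isCharacter D d).base_apply g e))
  refine hom_ext hb fun U a A hA hA' => Subtype.ext (funext ?_)
  rintro ⟨_, d, hd, rfl⟩
  have hdU : f.base d ∈ U := hA hd
  let ev : ((superdomain E' O').restrict D).sec A →ₐ[ℝ] Ext O' :=
    (evalAt ⟨d.1, d, hd, rfl⟩ : superFunctions E' O' (img D A) →ₐ[ℝ] Ext O')
  have hcoord : ∀ c : (superdomain E O).sec ⊤, pull f c = pull g c →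
      ev (pullOn f hA ((superdomain E O).res le_top c)) =
        ev (pullOn g hA' ((superdomain E O).res le_top c)) := by
    intro c hc
    rw [pullOn_res f hA le_top c (le_pre_top _), pullOn_res g hA' le_top c (le_pre_top _)]
    have := congrArg (fun z => ev (((superdomain E' O').restrict D).res (le_top : A ≤ ⊤) z)) hc
    exact this
  have := algHom_eq_of_coords (O := O) (B := U) ⟨f.base d, hdU⟩ (ev.comp (pullOn f hA))
    (ev.comp (pullOn g hA')) (fun a => (bodyAt_isCharacter D d).bodyAt_base f hd hA a)
    (fun e => hcoord _ (he e)) (fun o => hcoord _ (ho o))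
  exact DFunLike.congr_fun this a

end uniqueness

/-! ### Partial derivatives of superfunctions -/

section partials

variable {E O : Type} [Fintype E] [Fintype O] {U : Opens (E → ℝ)}

lemma extendZero_of_notMem {X : Type} [TopologicalSpace X] {U : Opens X} (f : U → ℝ) {x : X}
    (hx : x ∉ U) : extendZero U f x = 0 :=
  Function.extend_apply' _ _ _ (by rintro ⟨y, rfl⟩; exact hx y.2)

lemma extendZero_add {X : Type} [TopologicalSpace X] {U : Opens X} (f g : U → ℝ) :
    extendZero U (fun x => f x + g x) = fun x => extendZero U f x + extendZero U g x := by
  funext x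
  by_cases hx : x ∈ U
  · rw [extendZero_apply _ ⟨x, hx⟩, extendZero_apply _ ⟨x, hx⟩, extendZero_apply _ ⟨x, hx⟩]
  · simp [extendZero_of_notMem _ hx]

lemma extendZero_mul {X : Type} [TopologicalSpace X] {U : Opens X} (f g : U → ℝ) :
    extendZero U (fun x => f x * g x) = fun x => extendZero U f x * extendZero U g x := by
  funext x
  by_cases hx : x ∈ U
  · rw [extendZero_apply _ ⟨x, hx⟩, extendZero_apply _ ⟨x, hx⟩, extendZero_apply _ ⟨x, hx⟩]
  · simp [extendZero_of_notMem _ hx]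

open Classical in
/-- The partial derivative of a real function. -/
def partialReal (e : E) (f : realFunctions E U) : realFunctions E U :=
  ⟨fun x => fderiv ℝ (extendZero U f.1) x.1 (Pi.single e 1), SmoothReal.of_local fun x =>
    ⟨fun y => fderiv ℝ (extendZero U f.1) y (Pi.single e 1),
      ((f.2 x).fderiv_right (m := ∞) (by simp)).clm_apply contDiffAt_const, ⊤, trivial,
      fun _ _ => rfl⟩⟩

lemma SmoothReal.differentiableAt {f : U → ℝ} (hf : SmoothReal U f) (x : U) :
    DifferentiableAt ℝ (extendZero U f) x.1 := (hf x).differentiableAt (by simp)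

lemma partialReal_add (e : E) (f g : realFunctions E U) :
    partialReal e (f + g) = partialReal e f + partialReal e g := by
  refine Subtype.ext (funext fun x => ?_)
  have h := extendZero_add f.1 g.1
  change fderiv ℝ (extendZero U fun x => f.1 x + g.1 x) x.1 _ = _
  rw [h, fderiv_fun_add (f.2.differentiableAt x) (g.2.differentiableAt x)]
  rfl

lemma partialReal_mul (e : E) (f g : realFunctions E U) :
    partialReal e (f * g) = f * partialReal e g + g * partialReal e f := by
  refine Subtype.ext (funext fun x => ?_)
  have h := extendZero_mul f.1 g.1
  change fderiv ℝ (extendZero U fun x => f.1 x * g.1 x) x.1 _ = _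
  rw [h, fderiv_fun_mul (f.2.differentiableAt x) (g.2.differentiableAt x)]
  simp only [extendZero_apply]
  rfl

lemma partialReal_eq_of_eventuallyEq (e : E) (f : realFunctions E U) (x : U)
    {g : (E → ℝ) → ℝ} (h : extendZero U f.1 =ᶠ[nhds x.1] g) [DecidableEq E] :
    (partialReal e f).1 x = fderiv ℝ g x.1 (Pi.single e 1) := by
  change fderiv ℝ (extendZero U f.1) x.1 _ = _
  rw [h.fderiv_eq]
  congr!

lemma partialReal_algebraMap (e : E) (c : ℝ) :
    partialReal e (algebraMap ℝ (realFunctions E U) c) = 0 := by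
  classical
  refine Subtype.ext (funext fun x => ?_)
  rw [partialReal_eq_of_eventuallyEq e _ x (g := fun _ => c)]
  · simp
  · filter_upwards [U.isOpen.mem_nhds x.2] with y hy
    exact extendZero_apply _ ⟨y, hy⟩

lemma partialReal_smul (e : E) (c : ℝ) (f : realFunctions E U) :
    partialReal e (c • f) = c • partialReal e f := by
  rw [Algebra.smul_def, partialReal_mul, partialReal_algebraMap, mul_zero, add_zero,
    ← Algebra.smul_def]

/-- A basis of the exterior algebra. -/
def extBasis (O : Type) [Fintype O] : Module.Basis (Finset (Fin (Fintype.card O))) ℝ (Ext O) :=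
  ((Pi.basisFun ℝ O).reindex (Fintype.equivFin O)).ExteriorAlgebra

/-- A linear functional applied to the values of a superfunction. -/
def functional (l : Ext O →ₗ[ℝ] ℝ) : superFunctions E O U →ₗ[ℝ] realFunctions E U where
  toFun f := ⟨fun x => l (f.1 x), f.2 l⟩
  map_add' _ _ := Subtype.ext (funext fun _ => map_add _ _ _)
  map_smul' c f := Subtype.ext (funext fun x => l.map_smul c (f.1 x))

lemma superFunctions_ext {f g : superFunctions E O U}
    (h : ∀ l : Ext O →ₗ[ℝ] ℝ, functional l f = functional l g) : f = g := by
  refine Subtype.ext (funext fun x => (extBasis O).ext_elem fun i => ?_)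
  exact congrFun (congrArg Subtype.val (h ((extBasis O).coord i))) x

lemma functional_mul_const (l : Ext O →ₗ[ℝ] ℝ) (c : realFunctions E U) (b : Ext O) :
    functional l (ofReal E O U c * constSection E O U b) = l b • c := by
  refine Subtype.ext (funext fun x => ?_)
  change l (algebraMap ℝ (Ext O) (c.1 x) * b) = l b * c.1 x
  rw [← Algebra.smul_def, map_smul, smul_eq_mul, mul_comm]

lemma eq_sum_basis (f : superFunctions E O U) :
    f = ∑ i, ofReal E O U (functional ((extBasis O).coord i) f) *
      constSection E O U (extBasis O i) := by
  refine Subtype.ext (funext fun x => ?_)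
  rw [← evalAt_apply, ← evalAt_apply, map_sum]
  conv_lhs => rw [← (extBasis O).sum_repr (evalAt x f)]
  refine Finset.sum_congr rfl fun i _ => ?_
  rw [map_mul, Algebra.smul_def]
  rfl

/-- The partial derivative of a superfunction with respect to an even coordinate. -/
def partialEven (e : E) : superFunctions E O U →ₗ[ℝ] superFunctions E O U where
  toFun f := ∑ i, ofReal E O U (partialReal e (functional ((extBasis O).coord i) f)) *
    constSection E O U (extBasis O i)
  map_add' f g := by
    rw [← Finset.sum_add_distrib]
    refine Finset.sum_congr rfl fun i _ => ?_
    rw [map_add, partialReal_add, map_add, add_mul]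
  map_smul' c f := by
    rw [Finset.smul_sum]
    refine Finset.sum_congr rfl fun i _ => ?_
    rw [map_smul, partialReal_smul, map_smul, smul_mul_assoc]
    rfl

lemma partialReal_sum {κ : Type} (s : Finset κ) (e : E) (f : κ → realFunctions E U) :
    partialReal e (∑ i ∈ s, f i) = ∑ i ∈ s, partialReal e (f i) := by
  let φ : realFunctions E U →+ realFunctions E U :=
    AddMonoidHom.mk' (partialReal e) (partialReal_add e)
  exact map_sum φ f s

/-- The derivative is defined with a fixed basis; commuting with every linear functional makes it
independent of that choice and reduces identities to real functions. -/
lemma functional_partialEven (l : Ext O →ₗ[ℝ] ℝ) (e : E) (f : superFunctions E O U) :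
    functional l (partialEven e f) = partialReal e (functional l f) := by
  conv_rhs => rw [eq_sum_basis f]
  change functional l (∑ i, _) = _
  rw [map_sum, map_sum, partialReal_sum]
  refine Finset.sum_congr rfl fun i _ => ?_
  rw [functional_mul_const, functional_mul_const, partialReal_smul]

lemma partialEven_ofReal_mul_const (e : E) (c : realFunctions E U) (b : Ext O) :
    partialEven e (ofReal E O U c * constSection E O U b) =
      ofReal E O U (partialReal e c) * constSection E O U b :=
  superFunctions_ext fun l => by
    rw [functional_partialEven, functional_mul_const, functional_mul_const, partialReal_smul]

lemma partialEven_ofReal (e : E) (c : realFunctions E U) :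
    partialEven e (ofReal E O U c) = ofReal E O U (partialReal e c) := by
  have := partialEven_ofReal_mul_const (O := O) e c 1
  rwa [map_one, mul_one, mul_one] at this

lemma partialEven_const (e : E) (b : Ext O) : partialEven e (constSection E O U b) = 0 := by
  have := partialEven_ofReal_mul_const (O := O) (U := U) e 1 b
  rw [show (1 : realFunctions E U) = algebraMap ℝ _ 1 from (map_one _).symm,
    partialReal_algebraMap, map_zero, zero_mul, map_one, map_one, one_mul] at this
  exact this

lemma superFunctions_induction {p : superFunctions E O U → Prop}
    (h : ∀ c b, p (ofReal E O U c * constSection E O U b))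
    (hadd : ∀ f g, p f → p g → p (f + g)) (h0 : p 0) (f : superFunctions E O U) : p f := by
  rw [eq_sum_basis f]
  exact Finset.sum_induction _ p hadd h0 fun i _ => h _ _

lemma ofReal_comm (c : realFunctions E U) (f : superFunctions E O U) :
    ofReal E O U c * f = f * ofReal E O U c :=
  Subtype.ext (funext fun x => Algebra.commutes (c.1 x) (f.1 x))

/-- Both sides are additive in each argument, so products of a real function with a constant
suffice. Real functions commute with constants, which leaves the ordinary product rule. -/
lemma partialEven_mul (e : E) (f g : superFunctions E O U) :
    partialEven e (f * g) = f * partialEven e g + partialEven e f * g := by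
  induction f using superFunctions_induction with
  | h0 => simp
  | hadd f f' h h' => rw [add_mul, map_add, h, h', map_add]; noncomm_ring
  | h c b =>
    induction g using superFunctions_induction with
    | h0 => simp
    | hadd g g' h h' => rw [mul_add, map_add, h, h', map_add]; noncomm_ring
    | h c' b' =>
      have e1 : ∀ c c' : realFunctions E U, ofReal E O U c * constSection E O U b *
          (ofReal E O U c' * constSection E O U b') =
          ofReal E O U (c * c') * constSection E O U (b * b') := fun c c' => by
        rw [map_mul, map_mul, mul_assoc, ← mul_assoc (constSection E O U b), ← ofReal_comm]
        simp only [mul_assoc]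
      rw [e1, partialEven_ofReal_mul_const, partialEven_ofReal_mul_const,
        partialEven_ofReal_mul_const, e1, e1, partialReal_mul, map_add, add_mul, mul_comm c']

lemma partialEven_const_mul (e : E) (b : Ext O) (f : superFunctions E O U) :
    partialEven e (constSection E O U b * f) = constSection E O U b * partialEven e f := by
  rw [partialEven_mul, partialEven_const, zero_mul, add_zero]

/-- `F` is the common kernel of the functionals that annihilate it, and these commute with the
derivative. This serves both for the filtration and for parity. -/
lemma partialEven_mem (e : E) (F : Submodule ℝ (Ext O)) {f : superFunctions E O U}
    (hf : ∀ x, f.1 x ∈ F) (x : U) : (partialEven e f).1 x ∈ F := by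
  rw [← Subspace.forall_mem_dualAnnihilator_apply_eq_zero_iff]
  intro l hl
  have h0 : functional l f = 0 := Subtype.ext (funext fun y =>
    (Submodule.mem_dualAnnihilator _).1 hl _ (hf y))
  have h := functional_partialEven l e f
  rw [h0, show (0 : realFunctions E U) = algebraMap ℝ _ 0 from (map_zero _).symm,
    partialReal_algebraMap] at h
  exact congrFun (congrArg Subtype.val h) x

/-- Superfunctions with coefficients changed along an algebra morphism. -/
def mapExt {O' : Type} [Fintype O'] (φ : Ext O →ₐ[ℝ] Ext O') :
    superFunctions E O U →ₐ[ℝ] superFunctions E O' U where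
  toFun f := ⟨fun x => φ (f.1 x), fun l => f.2 (l ∘ₗ φ.toLinearMap)⟩
  map_one' := Subtype.ext (funext fun _ => map_one _)
  map_zero' := Subtype.ext (funext fun _ => map_zero _)
  map_mul' _ _ := Subtype.ext (funext fun _ => map_mul _ _ _)
  map_add' _ _ := Subtype.ext (funext fun _ => map_add _ _ _)
  commutes' _ := Subtype.ext (funext fun _ => AlgHom.commutes _ _)

lemma partialEven_mapExt {O' : Type} [Fintype O'] (φ : Ext O →ₐ[ℝ] Ext O') (e : E)
    (f : superFunctions E O U) : partialEven e (mapExt φ f) = mapExt φ (partialEven e f) :=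
  superFunctions_ext fun l => by
    rw [functional_partialEven]
    exact (functional_partialEven (l ∘ₗ φ.toLinearMap) e f).symm

/-- The restriction of superfunctions. -/
def resFun {V : Opens (E → ℝ)} (h : V ≤ U) : superFunctions E O U →ₐ[ℝ] superFunctions E O V :=
  (superdomain E O).res h

lemma partialEven_resFun {V : Opens (E → ℝ)} (h : V ≤ U) (e : E) (f : superFunctions E O U) :
    partialEven e (resFun h f) = resFun h (partialEven e f) := by
  classical
  refine superFunctions_ext fun l => ?_
  rw [functional_partialEven]
  refine Subtype.ext (funext fun x => ?_)
  refine Eq.trans ?_ (congrFun (congrArg Subtype.val (functional_partialEven l e f).symm)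
    ⟨x.1, h x.2⟩)
  rw [partialReal_eq_of_eventuallyEq e _ x (g := extendZero U (functional l f).1)]
  · rw [partialReal_eq_of_eventuallyEq e _ ⟨x.1, h x.2⟩ Filter.EventuallyEq.rfl]
  · filter_upwards [V.isOpen.mem_nhds x.2] with y hy
    rw [extendZero_apply _ ⟨y, hy⟩, extendZero_apply _ ⟨y, h hy⟩]
    rfl

end partials

/-! ### Substitution of sections in superfunctions -/

section taylor

/-- The exponential of a nilpotent derivation is multiplicative; the rational scalars of
`IsNilpotent.exp` act here through `ℝ`. -/
lemma exp_sum_mul {B : Type} [Ring B] [Algebra ℝ B] (D : B →ₗ[ℝ] B)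
    (hD : ∀ x y, D (x * y) = x * D y + D x * y) {N : ℕ} (hN : D ^ N = 0) (x y : B) :
    ∑ i ∈ Finset.range N, ((i.factorial : ℝ)⁻¹) • (D ^ i) (x * y) =
      (∑ i ∈ Finset.range N, ((i.factorial : ℝ)⁻¹) • (D ^ i) x) *
        ∑ i ∈ Finset.range N, ((i.factorial : ℝ)⁻¹) • (D ^ i) y := by
  let _ : Module ℚ B := Module.compHom B (algebraMap ℚ ℝ)
  have hexp : ∀ z, IsNilpotent.exp D z =
      ∑ i ∈ Finset.range N, ((i.factorial : ℝ)⁻¹) • (D ^ i) z := by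
    intro z
    rw [IsNilpotent.exp_eq_sum hN, LinearMap.sum_apply]
    refine Finset.sum_congr rfl fun i _ => ?_
    change algebraMap ℚ ℝ _ • (D ^ i) z = _
    simp
  rw [← hexp, ← hexp, ← hexp]
  exact Module.End.exp_mul_of_derivation ℝ B D hD ⟨N, hN⟩ x y

variable {E O : Type} [Fintype E] [Fintype O] {U : Opens (E → ℝ)}

/-- The derivation `∑ nᵉ ∂ₑ` with constant coefficients. -/
def constDer (U : Opens (E → ℝ)) (n : E → Ext O) :
    superFunctions E O U →ₗ[ℝ] superFunctions E O U :=
  ∑ e, (LinearMap.mulLeft ℝ (constSection E O U (n e))).comp (partialEven e)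

lemma constDer_apply (n : E → Ext O) (f : superFunctions E O U) :
    constDer U n f = ∑ e, constSection E O U (n e) * partialEven e f := by
  simp [constDer]

/-- The coefficients are even, hence central, and can be moved past `f`. -/
lemma constDer_mul {n : E → Ext O} (hn : ∀ e, n e ∈ extParity O 0) (f g : superFunctions E O U) :
    constDer U n (f * g) = f * constDer U n g + constDer U n f * g := by
  simp only [constDer_apply, Finset.mul_sum, Finset.sum_mul, ← Finset.sum_add_distrib]
  refine Finset.sum_congr rfl fun e _ => ?_
  have hc : constSection E O U (n e) * f = f * constSection E O U (n e) :=
    Subtype.ext (funext fun x => even_comm (hn e) (f.1 x))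
  rw [partialEven_mul, mul_add, ← mul_assoc, hc, mul_assoc, mul_assoc]

lemma constDer_mem {n : E → Ext O} {F F' : Submodule ℝ (Ext O)}
    (h : ∀ e, ∀ z ∈ F, n e * z ∈ F') {f : superFunctions E O U}
    (hf : ∀ x, f.1 x ∈ F) (x : U) : (constDer U n f).1 x ∈ F' := by
  rw [← evalAt_apply, constDer_apply, map_sum]
  refine Submodule.sum_mem _ fun e _ => ?_
  rw [map_mul]
  exact h e _ (partialEven_mem e F hf x)

/-- Each application multiplies by elements of zero reduction, so the exponent `Fintype.card O + 1`
already gives zero. The extra one guarantees that the Taylor sum has at least two terms, which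
`taylor_eq` splits off even when `O` is empty. -/
lemma constDer_pow_eq_zero {n : E → Ext O} (hn : ∀ e, aug O (n e) = 0) :
    constDer U n ^ (Fintype.card O + 2) = 0 := by
  have key : ∀ (j : ℕ) (f : superFunctions E O U) (x : U),
      ((constDer U n ^ j) f).1 x ∈ extFilt O j := by
    intro j f
    induction j with
    | zero => exact fun x => mem_extFilt_zero _
    | succ j ih =>
      rw [pow_succ', Module.End.mul_apply]
      exact constDer_mem (fun e z hz => mul_mem_extFilt_succ j (hn e) hz) ih
  have h1 : constDer U n ^ (Fintype.card O + 1) = 0 := by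
    refine LinearMap.ext fun f => Subtype.ext (funext fun x => ?_)
    have := key (Fintype.card O + 1) f x
    rw [extFilt_eq_bot] at this
    exact (Submodule.mem_bot ℝ).1 this
  rw [pow_succ, h1, zero_mul]

/-- The Taylor expansion `exp (∑ nᵉ ∂ₑ)`. -/
def taylor (U : Opens (E → ℝ)) (n : E → Ext O) :
    superFunctions E O U →ₗ[ℝ] superFunctions E O U :=
  ∑ i ∈ Finset.range (Fintype.card O + 2), ((i.factorial : ℝ)⁻¹) • constDer U n ^ i

lemma taylor_apply (n : E → Ext O) (f : superFunctions E O U) :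
    taylor U n f = ∑ i ∈ Finset.range (Fintype.card O + 2),
      ((i.factorial : ℝ)⁻¹) • (constDer U n ^ i) f := by
  simp [taylor]

lemma taylor_mul {n : E → Ext O} (hn : ∀ e, n e ∈ extParity O 0) (hn' : ∀ e, aug O (n e) = 0)
    (f g : superFunctions E O U) : taylor U n (f * g) = taylor U n f * taylor U n g := by
  rw [taylor_apply, taylor_apply, taylor_apply]
  exact exp_sum_mul (constDer U n) (constDer_mul hn) (constDer_pow_eq_zero hn') f g

lemma taylor_eq {n : E → Ext O} {f : superFunctions E O U}
    (h : constDer U n (constDer U n f) = 0) : taylor U n f = f + constDer U n f := by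
  rw [taylor_apply, Finset.sum_range_succ', Finset.sum_range_succ']
  rw [Finset.sum_eq_zero]
  · simp [add_comm]
  · intro i _
    rw [pow_succ, pow_succ, Module.End.mul_apply, Module.End.mul_apply, h, map_zero, smul_zero]

lemma taylor_const (n : E → Ext O) (b : Ext O) :
    taylor U n (constSection E O U b) = constSection E O U b := by
  have h : constDer U n (constSection E O U b) = 0 := by
    rw [constDer_apply]
    simp [partialEven_const]
  rw [taylor_eq (by rw [h, map_zero]), h, add_zero]

lemma partialEven_evenOn [DecidableEq E] (e e' : E) :
    partialEven e (evenOn O U e') = constSection E O U (if e = e' then 1 else 0) := by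
  let c : realFunctions E U := ⟨fun x => x.1 e', SmoothReal.of_contDiff (contDiff_apply ℝ ℝ e')⟩
  change partialEven e (ofReal E O U c) = _
  rw [partialEven_ofReal]
  refine Subtype.ext (funext fun x => ?_)
  change algebraMap ℝ (Ext O) ((partialReal e c).1 x) = _
  rw [partialReal_eq_of_eventuallyEq e c x (g := fun y => y e')]
  · rw [(hasFDerivAt_apply e' x.1).fderiv, ContinuousLinearMap.proj_apply, Pi.single_apply]
    change _ = if e = e' then (1 : Ext O) else 0
    split_ifs with h1 h2 h2
    · exact map_one _
    · exact absurd h1.symm h2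
    · exact absurd h2.symm h1
    · exact map_zero _
  · filter_upwards [U.isOpen.mem_nhds x.2] with y hy
    exact extendZero_apply _ ⟨y, hy⟩

/-- The first derivative of a coordinate is constant, so the expansion stops after the linear term:
it shifts the coordinate by `n e`. -/
lemma taylor_evenOn (n : E → Ext O) (e : E) :
    taylor U n (evenOn O U e) = evenOn O U e + constSection E O U (n e) := by
  classical
  have h : constDer U n (evenOn O U e) = constSection E O U (n e) := by
    rw [constDer_apply, Finset.sum_eq_single e]
    · rw [partialEven_evenOn, if_pos rfl, map_one, mul_one]
    · intro e' _ hne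
      rw [partialEven_evenOn, if_neg hne, map_zero, mul_zero]
    · simp
  rw [taylor_eq, h]
  rw [h, constDer_apply]
  simp [partialEven_const]

lemma constDer_resFun {V : Opens (E → ℝ)} (h : V ≤ U) (n : E → Ext O)
    (f : superFunctions E O U) : constDer V n (resFun h f) = resFun h (constDer U n f) := by
  rw [constDer_apply, constDer_apply, map_sum]
  refine Finset.sum_congr rfl fun e _ => ?_
  rw [map_mul, partialEven_resFun]
  rfl

lemma taylor_resFun {V : Opens (E → ℝ)} (h : V ≤ U) (n : E → Ext O)
    (f : superFunctions E O U) : taylor V n (resFun h f) = resFun h (taylor U n f) := by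
  rw [taylor_apply, taylor_apply, map_sum]
  refine Finset.sum_congr rfl fun i _ => ?_
  rw [map_smul]
  congr 1
  clear * -
  induction i with
  | zero => rfl
  | succ i ih =>
    rw [pow_succ', pow_succ', Module.End.mul_apply, Module.End.mul_apply, ih, constDer_resFun]

lemma taylor_mem {n : E → Ext O} {F : Submodule ℝ (Ext O)} (h : ∀ e, ∀ z ∈ F, n e * z ∈ F)
    {f : superFunctions E O U} (hf : ∀ x, f.1 x ∈ F) (x : U) : (taylor U n f).1 x ∈ F := by
  rw [← evalAt_apply, taylor_apply, map_sum]
  refine Submodule.sum_mem _ fun i _ => ?_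
  rw [map_smul]
  refine Submodule.smul_mem _ _ ?_
  rw [evalAt_apply]
  revert x
  clear * - h hf
  induction i with
  | zero => exact hf
  | succ i ih =>
    rw [pow_succ', Module.End.mul_apply]
    exact fun x => constDer_mem h ih x

end taylor

/-! ### Smooth dependence of the Taylor substitution on the point -/

section subst

variable {E O E' O' : Type} [Fintype E] [Fintype O] [Fintype E'] [Fintype O']
  {U : Opens (E → ℝ)} {W : Opens (E' → ℝ)}

lemma SmoothReal.comp {f : U → ℝ} (hf : SmoothReal U f) {u : W → E → ℝ}
    (hu : ∀ e, SmoothReal W fun x => u x e) (hU : ∀ x, u x ∈ U) :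
    SmoothReal W (fun x => f ⟨u x, hU x⟩) := by
  refine SmoothReal.of_local fun x =>
    ⟨extendZero U f ∘ fun y e => extendZero W (fun x => u x e) y, ?_, ⊤, trivial, fun y _ => ?_⟩
  · have e1 : (fun e => extendZero W (fun x => u x e) x.1) = u x :=
      funext fun e => extendZero_apply _ x
    refine ContDiffAt.comp x.1 ?_ (contDiffAt_pi.2 fun e => hu e x)
    rw [e1]
    exact hf ⟨u x, hU x⟩
  · have e1 : (fun e => extendZero W (fun x => u x e) y.1) = u y :=
      funext fun e => extendZero_apply _ y
    rw [Function.comp_apply, e1]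
    exact (extendZero_apply f ⟨u y, hU y⟩).symm

lemma SmoothExt.sum {O' : Type} {κ : Type} (s : Finset κ) {f : κ → W → Ext O'}
    (h : ∀ i, SmoothExt W (f i)) : SmoothExt W (fun x => ∑ i ∈ s, f i x) := fun l => by
  simp only [map_sum]
  exact SmoothReal.sum s fun i => h i l

lemma SmoothExt.algebraMap {f : W → ℝ} (h : SmoothReal W f) :
    SmoothExt W (fun x => algebraMap ℝ (Ext O') (f x)) :=
  (ofReal E' O' W ⟨f, h⟩).2

variable (ψ : Ext O →ₐ[ℝ] superFunctions E' O' W)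

/-- The values of a family of superfunctions at a point. -/
def specialize (x : W) : Ext O →ₐ[ℝ] Ext O' := (evalAt x).comp ψ

/-- For the derivation the coefficients `n e x` are constants, although they vary with `x`. One
derivative at a time is moved onto `f` and its coefficient is absorbed in `c`, so the induction has
to run over all `f` and `c`. -/
lemma smooth_constDer {u : W → E → ℝ} (hu : ∀ e, SmoothReal W fun x => u x e)
    (hU : ∀ x, u x ∈ U) {n : E → W → Ext O'} (hn : ∀ e, SmoothExt W (n e)) (j : ℕ) :
    ∀ (f : superFunctions E O U) (c : W → Ext O'), SmoothExt W c →
      SmoothExt W fun x => ((constDer U (fun e => n e x) ^ j)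
        (constSection E O' U (c x) * mapExt (specialize ψ x) f)).1 ⟨u x, hU x⟩ := by
  induction j with
  | zero =>
    intro f c hc
    have h : ∀ x, (constSection E O' U (c x) * mapExt (specialize ψ x) f).1 ⟨u x, hU x⟩ =
        c x * ∑ i, algebraMap ℝ (Ext O') ((functional ((extBasis O).coord i) f).1 ⟨u x, hU x⟩) *
          (ψ (extBasis O i)).1 x := by
      intro x
      change c x * specialize ψ x (f.1 ⟨u x, hU x⟩) = _
      congr 1
      conv_lhs => rw [← (extBasis O).sum_repr (f.1 ⟨u x, hU x⟩)]
      rw [map_sum]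
      refine Finset.sum_congr rfl fun i _ => ?_
      rw [map_smul, Algebra.smul_def]
      rfl
    change SmoothExt W fun x => (constSection E O' U (c x) * mapExt (specialize ψ x) f).1 _
    simp only [h]
    exact hc.mul (SmoothExt.sum _ fun i =>
      (SmoothExt.algebraMap (SmoothReal.comp (functional _ f).2 hu hU)).mul (ψ _).2)
  | succ j ih =>
    intro f c hc
    have h : ∀ x, ((constDer U (fun e => n e x) ^ (j + 1))
        (constSection E O' U (c x) * mapExt (specialize ψ x) f)).1 ⟨u x, hU x⟩ =
        ∑ e, ((constDer U (fun e => n e x) ^ j) (constSection E O' U (n e x * c x) *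
          mapExt (specialize ψ x) (partialEven e f))).1 ⟨u x, hU x⟩ := by
      intro x
      rw [pow_succ, Module.End.mul_apply, constDer_apply, map_sum, ← evalAt_apply, map_sum]
      refine Finset.sum_congr rfl fun e _ => ?_
      rw [partialEven_const_mul, partialEven_mapExt, map_mul (constSection E O' U), mul_assoc,
        evalAt_apply]
    simp only [h]
    exact SmoothExt.sum _ fun e => ih _ _ ((hn e).mul hc)

lemma smooth_taylor {u : W → E → ℝ} (hu : ∀ e, SmoothReal W fun x => u x e)
    (hU : ∀ x, u x ∈ U) {n : E → W → Ext O'} (hn : ∀ e, SmoothExt W (n e))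
    (f : superFunctions E O U) :
    SmoothExt W fun x => (taylor U (fun e => n e x) (mapExt (specialize ψ x) f)).1
      ⟨u x, hU x⟩ := by
  have h : ∀ x, (taylor U (fun e => n e x) (mapExt (specialize ψ x) f)).1 ⟨u x, hU x⟩ =
      ∑ i ∈ Finset.range (Fintype.card O' + 2), algebraMap ℝ (Ext O') ((i.factorial : ℝ)⁻¹) *
        ((constDer U (fun e => n e x) ^ i)
          (constSection E O' U 1 * mapExt (specialize ψ x) f)).1 ⟨u x, hU x⟩ := by
    intro x
    rw [taylor_apply, ← evalAt_apply, map_sum]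
    refine Finset.sum_congr rfl fun i _ => ?_
    rw [map_smul, Algebra.smul_def, map_one, one_mul]
    rfl
  simp only [h]
  exact SmoothExt.sum _ fun i => (SmoothExt.const _).mul
    (smooth_constDer ψ hu hU hn i f (fun _ => 1) (SmoothExt.const _))

end subst

/-! ### The existence of morphisms to superdomains -/

section existence

variable {E O E' O' : Type}

lemma mem_extParity_of_involute_even {x : Ext O} (h : CliffordAlgebra.involute x = x) :
    x ∈ extParity O 0 := by
  have hc := CliffordAlgebra.evenOdd_isCompl (Q := (0 : QuadraticForm ℝ (O → ℝ)))
  obtain ⟨a, ha, b, hb, rfl⟩ := Submodule.mem_sup.1 (hc.codisjoint.eq_top ▸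
    (Submodule.mem_top : x ∈ ⊤))
  rw [map_add, CliffordAlgebra.involute_eq_of_mem_even ha,
    CliffordAlgebra.involute_eq_of_mem_odd hb, add_right_inj] at h
  have h2 : (2 : ℝ) • b = 0 := by
    rw [two_smul]
    exact neg_eq_iff_add_eq_zero.1 h
  rw [(smul_eq_zero.1 h2).resolve_left two_ne_zero, add_zero]
  exact ha

lemma mem_extParity_of_involute_odd {x : Ext O} (h : CliffordAlgebra.involute x = -x) :
    x ∈ extParity O 1 := by
  have hc := CliffordAlgebra.evenOdd_isCompl (Q := (0 : QuadraticForm ℝ (O → ℝ)))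
  obtain ⟨a, ha, b, hb, rfl⟩ := Submodule.mem_sup.1 (hc.codisjoint.eq_top ▸
    (Submodule.mem_top : x ∈ ⊤))
  rw [map_add, CliffordAlgebra.involute_eq_of_mem_even ha,
    CliffordAlgebra.involute_eq_of_mem_odd hb, neg_add, add_left_inj] at h
  have h2 : (2 : ℝ) • a = 0 := by
    rw [two_smul]
    exact eq_neg_iff_add_eq_zero.1 h
  rw [(smul_eq_zero.1 h2).resolve_left two_ne_zero, zero_add]
  exact hb

/-- Such a `φ` commutes with the involution, as one checks on generators, and parity is the
eigenvalue of the involution. -/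
lemma parity_of_odd_generators (φ : Ext O →ₐ[ℝ] Ext O')
    (h : ∀ v, φ (ExteriorAlgebra.ι ℝ v) ∈ extParity O' 1) (i : ZMod 2) {x : Ext O}
    (hx : x ∈ extParity O i) : φ x ∈ extParity O' i := by
  have hcomm : (CliffordAlgebra.involute).comp φ = φ.comp CliffordAlgebra.involute := by
    apply ExteriorAlgebra.hom_ext
    ext1 v
    have e : CliffordAlgebra.involute (ExteriorAlgebra.ι ℝ v) = -ExteriorAlgebra.ι ℝ v :=
      CliffordAlgebra.involute_ι _
    change CliffordAlgebra.involute (φ (ExteriorAlgebra.ι ℝ v)) =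
      φ (CliffordAlgebra.involute (ExteriorAlgebra.ι ℝ v))
    rw [e, map_neg, CliffordAlgebra.involute_eq_of_mem_odd (h v)]
  have hx' : CliffordAlgebra.involute (φ x) = φ (CliffordAlgebra.involute x) :=
    DFunLike.congr_fun hcomm x
  have hi : i = 0 ∨ i = 1 := by clear hx; revert i; decide
  rcases hi with rfl | rfl
  · rw [CliffordAlgebra.involute_eq_of_mem_even hx] at hx'
    exact mem_extParity_of_involute_even hx'
  · rw [CliffordAlgebra.involute_eq_of_mem_odd hx, map_neg] at hx'
    exact mem_extParity_of_involute_odd hx'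

variable [Fintype E'] [Fintype O'] {D : Opens (E' → ℝ)} {t : E → superFunctions E' O' D} {τ : O → superFunctions E' O' D}

variable (t) in
/-- The reduced values of even sections. -/
def baseOf (x : D) : E → ℝ := fun e => aug O' ((t e).1 x)

lemma smooth_baseOf (e : E) : SmoothReal D fun x => baseOf t x e := (reduction E' O' D (t e)).2

variable (t) in
/-- The nilpotent part of even sections. -/
def nilOf (e : E) (x : D) : Ext O' := (t e).1 x - algebraMap ℝ _ (baseOf t x e)

lemma smooth_nilOf (e : E) : SmoothExt D (nilOf t e) :=
  (t e - ofReal E' O' D (reduction E' O' D (t e))).2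

lemma nilOf_even (ht : ∀ e x, (t e).1 x ∈ extParity O' 0) (e : E) (x : D) : nilOf t e x ∈ extParity O' 0 :=
  Submodule.sub_mem _ (ht e x) (by
    rw [Algebra.algebraMap_eq_smul_one]
    exact Submodule.smul_mem _ _ (SetLike.GradedOne.one_mem (A := extParity O')))

lemma aug_nilOf (e : E) (x : D) : aug O' (nilOf t e x) = 0 := by
  rw [nilOf, map_sub, AlgHom.commutes]
  exact sub_self _

variable [Fintype E] [Fintype O] (ht : ∀ e x, (t e).1 x ∈ extParity O' 0)
  (hτ : ∀ o x, (τ o).1 x ∈ extParity O' 1)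

/-- The substitution of odd sections for the generators of an exterior algebra. -/
def oddSubst : Ext O →ₐ[ℝ] superFunctions E' O' D :=
  -- The lift exists because each `∑ vₒτₒ` is odd at every point and so has square zero.
  ExteriorAlgebra.lift ℝ ⟨∑ o, (LinearMap.proj o).smulRight (τ o), fun v =>
    Subtype.ext (funext fun x => odd_sq (by
      rw [← evalAt_apply, LinearMap.sum_apply, map_sum]
      refine Submodule.sum_mem _ fun o _ => ?_
      rw [LinearMap.smulRight_apply, map_smul]
      exact Submodule.smul_mem _ _ (hτ o x)))⟩

lemma oddSubst_single [DecidableEq O] (o : O) :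
    oddSubst hτ (ExteriorAlgebra.ι ℝ (Pi.single o 1)) = τ o := by
  rw [oddSubst, ExteriorAlgebra.lift_ι_apply, LinearMap.sum_apply, Finset.sum_eq_single o]
  · simp
  · intro o' _ hne
    simp [Pi.single_eq_of_ne hne]
  · simp

lemma specialize_oddSubst_parity (x : D) (i : ZMod 2) {b : Ext O} (hb : b ∈ extParity O i) :
    specialize (oddSubst hτ) x b ∈ extParity O' i := by
  refine parity_of_odd_generators _ (fun v => ?_) i hb
  change evalAt x (oddSubst hτ _) ∈ _
  rw [oddSubst, ExteriorAlgebra.lift_ι_apply, LinearMap.sum_apply, map_sum]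
  refine Submodule.sum_mem _ fun o _ => ?_
  rw [LinearMap.smulRight_apply, map_smul]
  exact Submodule.smul_mem _ _ (hτ o x)

/-- The value of a superfunction at the point with the given coordinates. -/
def substAt (x : D) {U : Opens (E → ℝ)} (hU : baseOf t x ∈ U) :
    superFunctions E O U →ₐ[ℝ] Ext O' :=
  -- The odd generators are replaced first. Then `f(b + n)` is read as `(exp(∑ nₑ∂ₑ) f)(b)`, with
  -- `b` the reductions and `n` the nilpotent parts of the even sections.
  AlgHom.ofLinearMap
    ((evalAt ⟨baseOf t x, hU⟩ : superFunctions E O' U →ₐ[ℝ] Ext O').toLinearMap ∘ₗ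
      taylor U (fun e => nilOf t e x) ∘ₗ (mapExt (specialize (oddSubst hτ) x)).toLinearMap)
    (by
      change evalAt _ (taylor U _ (mapExt _ 1)) = 1
      rw [map_one, ← map_one (constSection E O' U), taylor_const, map_one, map_one])
    (fun f g => by
      change evalAt _ (taylor U _ (mapExt _ (f * g))) = _
      rw [map_mul, taylor_mul (fun e => nilOf_even ht e x) (fun e => aug_nilOf e x), map_mul]
      rfl)

lemma substAt_apply (x : D) {U : Opens (E → ℝ)} (hU : baseOf t x ∈ U) (f : superFunctions E O U) :
    substAt ht hτ x hU f = (taylor U (fun e => nilOf t e x)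
      (mapExt (specialize (oddSubst hτ) x) f)).1 ⟨baseOf t x, hU⟩ := rfl

lemma substAt_res (x : D) {U V : Opens (E → ℝ)} (h : V ≤ U) (hV : baseOf t x ∈ V)
    (f : superFunctions E O U) :
    substAt ht hτ x hV (resFun h f) = substAt ht hτ x (h hV) f := by
  rw [substAt_apply, substAt_apply]
  have e : mapExt (specialize (oddSubst hτ) x) (resFun h f) =
      resFun h (mapExt (specialize (oddSubst hτ) x) f) := rfl
  rw [e, taylor_resFun]
  rfl

lemma substAt_parity (x : D) {U : Opens (E → ℝ)} (hU : baseOf t x ∈ U) (f : superFunctions E O U)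
    (i : ZMod 2) (hf : ∀ y, f.1 y ∈ extParity O i) : substAt ht hτ x hU f ∈ extParity O' i := by
  refine taylor_mem (fun e z hz => ?_) (fun y => specialize_oddSubst_parity hτ x i (hf y)) _
  have := SetLike.GradedMul.mul_mem (A := extParity O') (nilOf_even ht e x) hz
  rwa [zero_add] at this

lemma substAt_evenOn (x : D) {U : Opens (E → ℝ)} (hU : baseOf t x ∈ U) (e : E) :
    substAt ht hτ x hU (evenOn O U e) = (t e).1 x := by
  have h : mapExt (specialize (oddSubst hτ) x) (evenOn O U e) = evenOn O' U e :=
    Subtype.ext (funext fun y => AlgHom.commutes _ _)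
  rw [substAt_apply, h, taylor_evenOn]
  change algebraMap ℝ _ (baseOf t x e) + nilOf t e x = _
  rw [nilOf, add_sub_cancel]

lemma substAt_oddOn [DecidableEq O] (x : D) {U : Opens (E → ℝ)} (hU : baseOf t x ∈ U) (o : O) :
    substAt ht hτ x hU (oddOn E U o) = (τ o).1 x := by
  have h : mapExt (specialize (oddSubst hτ) x) (oddOn E U o) =
      constSection E O' U ((τ o).1 x) := by
    refine Subtype.ext (funext fun y => ?_)
    exact congrArg (fun z => z.1 x) (oddSubst_single hτ o)
  rw [substAt_apply, h, taylor_const]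
  rfl

/-- The substitution of sections in superfunctions. -/
def subst {U : Opens (E → ℝ)} {W : Opens (E' → ℝ)} (hW : W ≤ D)
    (hU : ∀ x : W, baseOf t ⟨x.1, hW x.2⟩ ∈ U) :
    superFunctions E O U →ₐ[ℝ] superFunctions E' O' W where
  toFun f := ⟨fun x => substAt ht hτ ⟨x.1, hW x.2⟩ (hU x) f,
    smooth_taylor ((resFun hW).comp (oddSubst hτ)) (fun e => (smooth_baseOf e).res hW) hU
      (n := fun e x => nilOf t e ⟨x.1, hW x.2⟩) (fun e l => (smooth_nilOf e l).res hW) f⟩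
  map_one' := Subtype.ext (funext fun _ => map_one _)
  map_zero' := Subtype.ext (funext fun _ => map_zero _)
  map_mul' _ _ := Subtype.ext (funext fun _ => map_mul _ _ _)
  map_add' _ _ := Subtype.ext (funext fun _ => map_add _ _ _)
  commutes' _ := Subtype.ext (funext fun _ => AlgHom.commutes _ _)

/-- The base map consists of the reductions of the even sections; the pullback is the Taylor
substitution at each point, smooth by `smooth_taylor`. -/
theorem exists_hom_superdomain [DecidableEq O] {D : Opens (superdomain E' O').carrier}
    (t : E → ((superdomain E' O').restrict D).sec ⊤) (τ : O → ((superdomain E' O').restrict D).sec ⊤)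
    (ht : ∀ e, t e ∈ ((superdomain E' O').restrict D).parity ⊤ 0)
    (hτ : ∀ o, τ o ∈ ((superdomain E' O').restrict D).parity ⊤ 1) :
    ∃ f : (superdomain E' O').restrict D ⟶ superdomain E O,
      (∀ e, pull f (evenCoord e) = t e) ∧ ∀ o, pull f (oddCoord o) = τ o := by
  let D₀ : Opens (E' → ℝ) := img D ⊤
  let t' : E → superFunctions E' O' D₀ := t
  let τ' : O → superFunctions E' O' D₀ := τ
  have hmem : ∀ x : D, x.1 ∈ D₀ := fun x => ⟨x, trivial, rfl⟩
  let b : D → E → ℝ := fun x => baseOf t' ⟨x.1, hmem x⟩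
  have hb : Continuous b := continuous_pi fun e =>
    (smooth_baseOf (t := t') e).continuous.comp (continuous_subtype_val.subtype_mk _)
  have hW : ∀ U : Opens (E → ℝ), (img D (pre b hb U) : Opens (E' → ℝ)) ≤ D₀ := fun U =>
    img_mono D le_top
  have hU : ∀ (U : Opens (E → ℝ)) (x : (img D (pre b hb U) : Opens (E' → ℝ))),
      baseOf t' ⟨x.1, hW U x.2⟩ ∈ U := by
    rintro U ⟨_, x, hx, rfl⟩
    exact hx
  let f : (superdomain E' O').restrict D ⟶ superdomain E O := Hom.mk b hb
    (fun U => (subst (t := t') (τ := τ') ht hτ (hW U) (hU U) :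
      superFunctions E O U →ₐ[ℝ] superFunctions E' O' (img D (pre b hb U))))
    (fun U i a ha x => substAt_parity (t := t') (τ := τ') ht hτ _ _ _ i ha)
    (fun {U V} h a => Subtype.ext (funext fun x => substAt_res (t := t') (τ := τ') ht hτ _ h _ a))
  refine ⟨f, fun e => Subtype.ext (funext fun x => ?_), fun o => Subtype.ext (funext fun x => ?_)⟩
  · exact substAt_evenOn (t := t') (τ := τ') ht hτ x (U := ⊤) trivial e
  · exact substAt_oddOn (t := t') (τ := τ') ht hτ x (U := ⊤) trivial o

end existence

/-! ### Superspaces that are locally superdomains -/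

namespace SuperSpace

variable {T M N : SuperSpace}

lemma pull_comp (f : T ⟶ M) (g : M ⟶ N) (s : N.sec ⊤) : pull (f ≫ g) s = pull f (pull g s) :=
  pullOn_comp f g (le_pre_top _) (le_pre_top _) s _

/-- The pullback of global sections as a morphism of algebras. -/
def pullHom (f : T ⟶ M) : M.sec ⊤ →ₐ[ℝ] T.sec ⊤ := pullOn f (le_pre_top ⊤)

lemma pullHom_apply (f : T ⟶ M) (s : M.sec ⊤) : pullHom f s = pull f s := rfl

lemma pullHom_comp_apply (f : T ⟶ M) (g : M ⟶ N) (s : N.sec ⊤) :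
    pullHom (f ≫ g) s = pullHom f (pullHom g s) := pull_comp f g s

lemma pull_parity (f : T ⟶ M) (i : ZMod 2) (s : M.sec ⊤) (h : s ∈ M.parity ⊤ i) :
    pull f s ∈ T.parity ⊤ i := pullOn_parity f (le_pre_top _) i s h

lemma eq_of_pull_incl {a b : T.sec ⊤}
    (h : ∀ t, ∃ V : Opens T.carrier, t ∈ V ∧ pull (T.incl V) a = pull (T.incl V) b) : a = b := by
  refine eq_of_locally_eq fun t _ => ?_
  obtain ⟨V, ht, e⟩ := h t
  refine ⟨img V ⊤, le_top, ⟨⟨t, ht⟩, trivial, rfl⟩, ?_⟩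
  exact (pullOn_incl V (le_pre_top ⊤) a).symm.trans (e.trans (pullOn_incl V (le_pre_top ⊤) b))

/-- A superspace that is, near each point, a retract of a superdomain. -/
def LocSuper (T : SuperSpace) : Prop :=
  ∀ t : T.carrier, ∃ (V : Opens T.carrier) (E O : Type) (_ : Fintype E) (_ : Fintype O)
    (D : Opens (superdomain E O).carrier) (φ : T.restrict V ⟶ (superdomain E O).restrict D)
    (ψ : (superdomain E O).restrict D ⟶ T), t ∈ V ∧ φ ≫ ψ = T.incl V

/-- A local isomorphism with an open part of a superdomain gives both maps of the retraction. -/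
lemma _root_.Super.Supermanifold.locSuper (T : Supermanifold) : LocSuper T.space := by
  intro t
  obtain ⟨V, D, ht, ⟨e⟩⟩ := T.isSupermanifold.2.2 t
  exact ⟨V, _, _, inferInstance, inferInstance, D, e.hom, e.inv ≫ T.space.incl V, ht, by
    rw [← Category.assoc, e.hom_inv_id, Category.id_comp]⟩

lemma locSuper_superdomain (E O : Type) [Fintype E] [Fintype O] :
    LocSuper (superdomain E O) := fun _ =>
  ⟨⊤, E, O, inferInstance, inferInstance, ⊤, 𝟙 _, (superdomain E O).incl ⊤, trivial,
    Category.id_comp _⟩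

/-- Replace `D` by the preimage of `W` under `ψ`. Over `W`, `φ` lands in it because `φ ≫ ψ` is the
inclusion. -/
lemma LocSuper.restrict (hT : LocSuper T) (W : Opens T.carrier) : LocSuper (T.restrict W) := by
  rintro ⟨t, htW⟩
  obtain ⟨V, E, O, _, _, D, φ, ψ, htV, e⟩ := hT t
  let D' : Opens (superdomain E O).carrier := img D (pre ψ.base ψ.continuous_base W)
  have hD' : D' ≤ D := by rintro _ ⟨x, -, rfl⟩; exact x.2
  let V' : Opens (T.restrict W).carrier := pre (T.incl W).base (T.incl W).continuous_base V
  let j : (T.restrict W).restrict V' ⟶ T.restrict V :=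
    liftIncl V ((T.restrict W).incl V' ≫ T.incl W) fun x => x.2
  have hj : j ≫ T.incl V = (T.restrict W).incl V' ≫ T.incl W := liftIncl_comp _ _ _
  have hψφ : ∀ x, ψ.base (φ.base x) = x.1 := fun x =>
    congrArg (fun q : T.restrict V ⟶ T => q.base x) e
  have hjx : ∀ x, (j.base x).1 = x.1.1 := fun x =>
    congrArg (fun q : (T.restrict W).restrict V' ⟶ T => q.base x) hj
  let φ' : (T.restrict W).restrict V' ⟶ (superdomain E O).restrict D' :=
    liftIncl D' ((j ≫ φ) ≫ (superdomain E O).incl D) fun x => ⟨φ.base (j.base x), by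
      change ψ.base (φ.base (j.base x)) ∈ W
      rw [hψφ, hjx]
      exact x.1.2, rfl⟩
  let ψ' : (superdomain E O).restrict D' ⟶ T.restrict W :=
    liftIncl W (inclLE hD' ≫ ψ) fun x => by
      have e1 : ψ.base ((inclLE hD').base x) = ψ.base ⟨x.1, hD' x.2⟩ :=
        congrArg ψ.base (inclLE_base hD' x)
      refine (congrArg (fun z => z ∈ W) e1).mpr ?_
      obtain ⟨_, y, hy, rfl⟩ := x
      exact hy
  refine ⟨V', E, O, inferInstance, inferInstance, D', φ', ψ', htV, incl_cancel ?_⟩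
  have h1 : φ' ≫ inclLE hD' = j ≫ φ := incl_cancel (by
    rw [Category.assoc, inclLE_comp]
    exact liftIncl_comp _ _ _)
  rw [Category.assoc, liftIncl_comp, ← Category.assoc, h1, Category.assoc, e, hj]

/-- Locally `f` factors as `φ ≫ (ψ ≫ f)`, and `ψ ≫ f` is determined on a superdomain. -/
theorem LocSuper.hom_ext {E O : Type} [Fintype E] [Fintype O] [DecidableEq O] (hT : LocSuper T)
    {f g : T ⟶ superdomain E O} (he : ∀ e, pull f (evenCoord e) = pull g (evenCoord e))
    (ho : ∀ o, pull f (oddCoord o) = pull g (oddCoord o)) : f = g := by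
  refine hom_ext_local fun t => ?_
  obtain ⟨V, E', O', _, _, D, φ, ψ, ht, e⟩ := hT t
  refine ⟨V, ht, ?_⟩
  have : ψ ≫ f = ψ ≫ g := hom_superdomain_ext
    (fun e => by rw [pull_comp, pull_comp, he]) (fun o => by rw [pull_comp, pull_comp, ho])
  rw [← e, Category.assoc, this, Category.assoc]

/-- Solve the problem on the superdomain for the sections pulled back along `ψ`, and return along
`φ`. Local solutions agree on overlaps by `LocSuper.hom_ext`. -/
theorem LocSuper.exists_hom {E O : Type} [Fintype E] [Fintype O] [DecidableEq O]
    (hT : LocSuper T) (t : E → T.sec ⊤) (τ : O → T.sec ⊤) (ht : ∀ e, t e ∈ T.parity ⊤ 0)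
    (hτ : ∀ o, τ o ∈ T.parity ⊤ 1) :
    ∃ f : T ⟶ superdomain E O,
      (∀ e, pull f (evenCoord e) = t e) ∧ ∀ o, pull f (oddCoord o) = τ o := by
  have loc : ∀ x, ∃ (V : Opens T.carrier) (f : T.restrict V ⟶ superdomain E O), x ∈ V ∧
      (∀ e, pull f (evenCoord e) = pull (T.incl V) (t e)) ∧
      ∀ o, pull f (oddCoord o) = pull (T.incl V) (τ o) := by
    intro x
    obtain ⟨V, E', O', _, _, D, φ, ψ, hx, e⟩ := hT x
    obtain ⟨h, h1, h2⟩ := exists_hom_superdomain (fun e => pull ψ (t e)) (fun o => pull ψ (τ o))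
      (fun e => pull_parity ψ 0 _ (ht e)) (fun o => pull_parity ψ 1 _ (hτ o))
    refine ⟨V, φ ≫ h, hx, fun e' => ?_, fun o => ?_⟩
    · rw [pull_comp, h1, ← pull_comp, e]
    · rw [pull_comp, h2, ← pull_comp, e]
  choose V f hV h1 h2 using loc
  obtain ⟨F, hF⟩ := exists_glueHom V (fun x => ⟨x, hV x⟩) f fun i j =>
    LocSuper.hom_ext (hT.restrict _)
      (fun e => by rw [pull_comp, pull_comp, h1, h1, ← pull_comp, ← pull_comp, inclLE_comp,
        inclLE_comp])
      (fun o => by rw [pull_comp, pull_comp, h2, h2, ← pull_comp, ← pull_comp, inclLE_comp,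
        inclLE_comp])
  refine ⟨F, fun e => eq_of_pull_incl fun x => ⟨V x, hV x, ?_⟩,
    fun o => eq_of_pull_incl fun x => ⟨V x, hV x, ?_⟩⟩
  · rw [← pull_comp, hF, h1]
  · rw [← pull_comp, hF, h2]

/-! #### Characters and units -/

/-- The character is reduction at `φ(t)` after pullback along `ψ`. The same passage to a superdomain
lifts invertibility at a point to a neighbourhood. -/
theorem LocSuper.exists_character (hT : LocSuper T) (t : T.carrier) :
    ∃ γ : ∀ W : Opens T.carrier, t ∈ W → (T.sec W →ₐ[ℝ] ℝ), IsCharacter T t γ ∧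
      ∀ {ν : Type} [Fintype ν] [DecidableEq ν] (W : Opens T.carrier) (ht : t ∈ W)
        (B : Matrix ν ν (T.sec W)), IsUnit (B.map (γ W ht)) →
        ∃ (V : Opens T.carrier) (h : V ≤ W), t ∈ V ∧ IsUnit (B.map (T.res h)) := by
  obtain ⟨V, E, O, _, _, D, φ, ψ, htV, e⟩ := hT t
  let d : ((superdomain E O).restrict D).carrier := φ.base ⟨t, htV⟩
  have hd : ψ.base d = t := congrArg (fun q : T.restrict V ⟶ T => q.base ⟨t, htV⟩) e
  let A : Opens T.carrier → Opens ((superdomain E O).restrict D).carrier := fun W =>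
    pre ψ.base ψ.continuous_base W
  have hdA : ∀ W, t ∈ W → d ∈ A W := fun W ht => by
    change ψ.base d ∈ W
    rwa [hd]
  refine ⟨fun W ht => (bodyAt (U := img D (A W)) d.1 ⟨d, hdA W ht, rfl⟩).comp (ψ.app W),
    fun U W h ht a => ?_, fun {ν} _ _ W ht B hB => ?_⟩
  · exact congrArg (bodyAt (U := img D (A U)) d.1 ⟨d, hdA U ht, rfl⟩) (ψ.app_res h a)
  · let B' : Matrix ν ν (superFunctions E O (img D (A W))) := B.map (ψ.app W)
    -- Where this continuous determinant of the reduction is nonzero, the pulled-back matrix is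
    -- invertible by `isUnit_matrix`.
    let δ : (img D (A W) : Opens (E → ℝ)) → ℝ := fun x => (B'.map fun f => aug O (evalAt x f)).det
    have hδ : Continuous δ := Continuous.matrix_det (continuous_matrix fun r s =>
      continuous_body_section (B' r s))
    let V₁ : Opens (E → ℝ) := img (img D (A W)) ⟨{x | δ x ≠ 0}, isOpen_ne_fun hδ continuous_const⟩
    let V₂ : Opens ((superdomain E O).restrict D).carrier :=
      pre ((superdomain E O).incl D).base ((superdomain E O).incl D).continuous_base V₁
    have hV₂ : V₂ ≤ A W := by
      rintro x ⟨⟨_, y, hy, rfl⟩, -, h⟩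
      have : y = x := Subtype.ext h
      exact this ▸ hy
    have hu : IsUnit (B'.map (resFun (img_mono D hV₂))) := by
      refine isUnit_matrix _ ?_
      rintro ⟨_, x, ⟨y, hy, hyx⟩, rfl⟩
      rw [Matrix.isUnit_iff_isUnit_det]
      have hy' : y = ⟨x.1, x, hV₂ ⟨y, hy, hyx⟩, rfl⟩ := Subtype.ext hyx
      rw [hy'] at hy
      exact IsUnit.mk0 _ hy
    let A₂ : Opens (T.restrict V).carrier := pre φ.base φ.continuous_base V₂
    have hA₂ : A₂ ≤ pre (T.incl V).base (T.incl V).continuous_base W := by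
      rw [← e]
      exact le_pre_comp (f := φ) (g := ψ) (B := V₂) le_rfl hV₂
    have hle : img V A₂ ≤ W := by rintro _ ⟨x, hx, rfl⟩; exact hA₂ hx
    refine ⟨img V A₂, hle, ⟨⟨t, htV⟩, ⟨⟨d.1, d, hdA W ht, rfl⟩, ?_, rfl⟩, rfl⟩, ?_⟩
    · exact ((Matrix.isUnit_iff_isUnit_det _).1 hB).ne_zero
    · let ρ : superFunctions E O (img D V₂) →ₐ[ℝ] (T.restrict V).sec A₂ :=
        pullOn φ (A := A₂) (U := V₂) le_rfl
      have h1 := hu.map ρ.mapMatrix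
      -- Since `φ ≫ ψ` is the inclusion, pulling the matrix back along `ψ` and then `φ` is
      -- restriction.
      have h2 : ρ.mapMatrix (B'.map (resFun (img_mono D hV₂))) = B.map (T.res hle) := by
        ext1 r s
        have e1 : pullOn φ (A := A₂) (U := V₂) le_rfl (pullOn ψ hV₂ (B r s)) =
            T.res hle (B r s) :=
          (pullOn_comp φ ψ le_rfl hV₂ (B r s) (le_pre_comp le_rfl hV₂)).symm.trans
            ((pullOn_congr e _ hA₂ _).trans (pullOn_incl V hA₂ _))
        exact e1
      exact (congrArg IsUnit h2).mp h1

variable {ν : Type} [Fintype ν] [DecidableEq ν]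

/-- Inverses are unique, so the local ones agree on overlaps and glue entry by entry. -/
theorem isUnit_matrix_of_locally {B : Matrix ν ν (T.sec ⊤)}
    (h : ∀ t, ∃ (V : Opens T.carrier), t ∈ V ∧ IsUnit (B.map (T.res (le_top : V ≤ ⊤)))) :
    IsUnit B := by
  choose V hV hu using h
  choose u hu using hu
  have hcov : (⊤ : Opens T.carrier) ≤ ⨆ t, V t := fun t _ => Opens.mem_iSup.2 ⟨t, hV t⟩
  have inv_res : ∀ t (W : Opens T.carrier) (hW : W ≤ V t),
      (T.res hW).mapMatrix (u t).1 = B.map (T.res le_top) := by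
    intro t W hW
    rw [hu]
    ext1 r s
    exact T.res_res _ _ _
  have hl : ∀ t (W : Opens T.carrier) (hW : W ≤ V t),
      (T.res hW).mapMatrix (u t)⁻¹.1 * B.map (T.res le_top) = 1 := fun t W hW => by
    rw [← inv_res t W hW, ← map_mul, Units.inv_mul, map_one]
  have hr : ∀ t (W : Opens T.carrier) (hW : W ≤ V t),
      B.map (T.res le_top) * (T.res hW).mapMatrix (u t)⁻¹.1 = 1 := fun t W hW => by
    rw [← inv_res t W hW, ← map_mul, Units.mul_inv, map_one]
  have ex : ∀ r s, ∃! c : T.sec ⊤, ∀ t, T.res (le_top : V t ≤ ⊤) c = (u t)⁻¹.1 r s := by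
    intro r s
    refine T.existsUnique_glue ⊤ V (fun _ => le_top) hcov (fun t => (u t)⁻¹.1 r s) fun t t' => ?_
    have e := left_inv_eq_right_inv (hl t (V t ⊓ V t') inf_le_left)
      (hr t' (V t ⊓ V t') inf_le_right)
    exact congrFun (congrFun e r) s
  choose c hc _ using ex
  have hC : ∀ t, (T.res (le_top : V t ≤ ⊤)).mapMatrix (Matrix.of c) = (u t)⁻¹.1 := fun t => by
    ext1 r s
    exact hc r s t
  have hB : ∀ t, (T.res (le_top : V t ≤ ⊤)).mapMatrix B = (u t).1 := fun t => (hu t).symm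
  have ext : ∀ {X Y : Matrix ν ν (T.sec ⊤)},
      (∀ t, (T.res (le_top : V t ≤ ⊤)).mapMatrix X = (T.res (le_top : V t ≤ ⊤)).mapMatrix Y) →
      X = Y := fun {X Y} hXY => by
    ext1 r s
    exact T.eq_of_cover (fun _ => le_top) hcov fun t => congrFun (congrFun (hXY t) r) s
  refine isUnit_iff_exists.2 ⟨Matrix.of c, ext fun t => ?_, ext fun t => ?_⟩
  · rw [map_mul, hB, hC, map_one, Units.mul_inv]
  · rw [map_mul, hB, hC, map_one, Units.inv_mul]

/-- The reduction of global sections at a point. -/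
def LocSuper.body (hT : LocSuper T) (t : T.carrier) : T.sec ⊤ →ₐ[ℝ] ℝ :=
  (hT.exists_character t).choose ⊤ trivial

lemma LocSuper.body_pull (hT : LocSuper T) (t : T.carrier) {E O : Type} [Fintype E] [Fintype O]
    (f : T ⟶ superdomain E O) (e : E) : hT.body t (pull f (evenCoord e)) = f.base t e :=
  (hT.exists_character t).choose_spec.1.base_apply f e

lemma LocSuper.exists_isUnit (hT : LocSuper T) (t : T.carrier) (B : Matrix ν ν (T.sec ⊤))
    (h : IsUnit (B.map (hT.body t))) :
    ∃ V : Opens T.carrier, t ∈ V ∧ IsUnit (B.map (T.res (le_top : V ≤ ⊤))) := by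
  obtain ⟨V, _, hV⟩ := (hT.exists_character t).choose_spec.2 ⊤ trivial B h
  exact ⟨V, hV⟩

theorem LocSuper.isUnit_iff (hT : LocSuper T) (B : Matrix ν ν (T.sec ⊤)) :
    IsUnit B ↔ ∀ t, IsUnit (B.map (hT.body t)) :=
  ⟨fun h t => h.map (hT.body t).mapMatrix,
    fun h => isUnit_matrix_of_locally fun t => hT.exists_isUnit t B (h t)⟩

lemma LocSuper.body_odd (hT : LocSuper T) (t : T.carrier) {E O : Type} [Fintype E] [Fintype O]
    [DecidableEq O] (f : T ⟶ superdomain E O) (o : O) : hT.body t (pull f (oddCoord o)) = 0 := by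
  have h : (oddCoord o : (superdomain E O).sec ⊤) * oddCoord o = 0 :=
    Subtype.ext (funext fun _ => ExteriorAlgebra.ι_sq_zero _)
  refine IsCharacter.odd_eq_zero (γ := (hT.exists_character t).choose) ⊤ trivial ?_
  rw [← pullHom_apply, ← map_mul, h, map_zero]

end SuperSpace

/-! ### Morphisms to glued superspaces -/

section gluing

namespace SuperSpace

lemma pullOn_comp_incl {T M : SuperSpace} {D : Opens M.carrier} (f : T ⟶ M.restrict D)
    {B : Opens (M.restrict D).carrier} {A : Opens T.carrier}
    (h' : A ≤ pre f.base f.continuous_base B) (z : (M.restrict D).sec B)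
    (h : A ≤ pre (f ≫ M.incl D).base (f ≫ M.incl D).continuous_base (img D B)) :
    pullOn (f ≫ M.incl D) h (show M.sec (img D B) from z) = pullOn f h' z := by
  have hB : B ≤ pre (M.incl D).base (M.incl D).continuous_base (img D B) :=
    fun x hx => ⟨x, hx, rfl⟩
  have e : pullOn (M.incl D) hB (show M.sec (img D B) from z) = z :=
    (pullOn_incl D hB z).trans (M.res_self _ _)
  exact (pullOn_comp f (M.incl D) h' hB _ h).trans (congrArg _ e)

lemma res_injective_of_le {M : SuperSpace} {A B : Opens M.carrier} (h : A ≤ B) (h' : B ≤ A) :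
    Function.Injective (M.res h) := fun a b e => by
  have := congrArg (M.res h') e
  rwa [M.res_res, M.res_res, M.res_self, M.res_self] at this

end SuperSpace

variable {ι : Type} (U : ι → SuperSpace) (V : ∀ i _ : ι, Opens (U i).carrier)
  (g : ∀ i j, (U i).restrict (V i j) ⟶ U j)

/-- Two points of pieces are linked if the gluing morphism takes the first to the second. -/
def Linked {T : SuperSpace} (i j : ι) (X : T ⟶ U i) (Y : T ⟶ U j) : Prop :=
  ∃ W : T ⟶ (U i).restrict (V i j), W ≫ (U i).incl (V i j) = X ∧ W ≫ g i j = Y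

/-- The cocycle condition for gluing morphisms, in terms of points. -/
structure IsGluing : Prop where
  loc : ∀ i, LocSuper (U i)
  refl : ∀ {T : SuperSpace} (_ : LocSuper T) (i : ι) (X : T ⟶ U i), Linked U V g i i X X
  symm : ∀ {T : SuperSpace} (_ : LocSuper T) {i j : ι} {X : T ⟶ U i} {Y : T ⟶ U j},
    Linked U V g i j X Y → Linked U V g j i Y X
  trans : ∀ {T : SuperSpace} (_ : LocSuper T) {i j k : ι} {X : T ⟶ U i} {Y : T ⟶ U j}
    {Z : T ⟶ U k}, Linked U V g i j X Y → Linked U V g j k Y Z → Linked U V g i k X Z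

variable {U V g}

lemma Linked.mem {T : SuperSpace} {i j : ι} {X : T ⟶ U i} {Y : T ⟶ U j}
    (h : Linked U V g i j X Y) (t : T.carrier) :
    glueRel U V g ⟨i, X.base t⟩ ⟨j, Y.base t⟩ := by
  obtain ⟨W, rfl, rfl⟩ := h
  exact ⟨(W.base t).2, rfl⟩

lemma linked_incl {i j : ι} (A : Opens (U i).carrier) (h : A ≤ V i j) :
    Linked U V g i j ((U i).incl A) (inclLE h ≫ g i j) := ⟨inclLE h, inclLE_comp h, rfl⟩

lemma inclLE_comp_base {i j : ι} (A : Opens (U i).carrier) (h : A ≤ V i j) (x : A) :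
    (inclLE h ≫ g i j).base x = (g i j).base ⟨x.1, h x.2⟩ :=
  congrArg (g i j).base (inclLE_base h x)

lemma linked_of_mem {T : SuperSpace} {i : ι} (j : ι) {X : T ⟶ U i} (h : ∀ t, X.base t ∈ V i j) :
    Linked U V g i j X (liftIncl (V i j) X h ≫ g i j) := ⟨_, liftIncl_comp _ _ _, rfl⟩

namespace IsGluing

variable (hg : IsGluing U V g)
include hg

/-- Inclusions of open parts of the pieces are themselves points, and the conditions of `IsGluing`
for them give the set-theoretic statements. -/
lemma equivalence : Equivalence (glueRel U V g) where
  refl := fun ⟨i, a⟩ => (hg.refl (hg.loc i) i (𝟙 _)).mem a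
  symm := by
    rintro ⟨i, a⟩ ⟨j, b⟩ ⟨h, hb⟩
    change a ∈ V i j at h
    change (g i j).base ⟨a, h⟩ = b at hb
    subst hb
    have := (hg.symm ((hg.loc i).restrict (V i j)) (linked_incl (g := g) (V i j) le_rfl)).mem ⟨a, h⟩
    rwa [inclLE_comp_base] at this
  trans := by
    rintro ⟨i, a⟩ ⟨j, b⟩ ⟨k, c⟩ ⟨h, hb⟩ ⟨h', hc⟩
    change a ∈ V i j at h
    change (g i j).base ⟨a, h⟩ = b at hb
    subst hb
    change (g i j).base ⟨a, h⟩ ∈ V j k at h'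
    change (g j k).base ⟨(g i j).base ⟨a, h⟩, h'⟩ = c at hc
    subst hc
    -- The part of `U i` on which `g i j` followed by `g j k` is defined.
    let A : Opens (U i).carrier := img (V i j) (pre (g i j).base (g i j).continuous_base (V j k))
    have hA : A ≤ V i j := by rintro _ ⟨x, -, rfl⟩; exact x.2
    have hmem : ∀ x : ((U i).restrict A).carrier, (inclLE hA ≫ g i j).base x ∈ V j k := by
      rintro ⟨_, x, hx, rfl⟩
      refine (congrArg (fun z => z ∈ V j k) (inclLE_comp_base (g := g) A hA _)).mpr ?_
      exact hx
    have h1 := hg.trans ((hg.loc i).restrict A) (linked_incl (g := g) A hA)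
      (linked_of_mem k hmem)
    have haA : a ∈ A := ⟨⟨a, h⟩, h', rfl⟩
    have h2 := h1.mem ⟨a, haA⟩
    have h3 : (liftIncl (V j k) (inclLE hA ≫ g i j) hmem).base ⟨a, haA⟩ =
        ⟨(g i j).base ⟨a, h⟩, h'⟩ :=
      Subtype.ext ((congrArg (fun q : (U i).restrict A ⟶ U j => q.base ⟨a, haA⟩)
        (liftIncl_comp (V j k) (inclLE hA ≫ g i j) hmem)).trans
          (inclLE_comp_base (g := g) A hA ⟨a, haA⟩))
    have h4 : (liftIncl (V j k) (inclLE hA ≫ g i j) hmem ≫ g j k).base ⟨a, haA⟩ =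
        (g j k).base ⟨(g i j).base ⟨a, h⟩, h'⟩ := congrArg (g j k).base h3
    rw [h4] at h2
    exact h2

lemma glueMk_eq_iff {i j : ι} {a : (U i).carrier} {b : (U j).carrier} :
    glueMk U V g i a = glueMk U V g j b ↔ glueRel U V g ⟨i, a⟩ ⟨j, b⟩ := by
  refine ⟨fun h => ?_, fun h => Quot.sound h⟩
  exact hg.equivalence.eqvGen_iff.1 (Quot.eqvGen_exact h)

lemma glueMk_injective (i : ι) : Function.Injective (glueMk U V g i) := by
  intro a b h
  obtain ⟨h1, h2⟩ := hg.glueMk_eq_iff.1 h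
  obtain ⟨_, h3⟩ := hg.equivalence.refl ⟨i, a⟩
  exact h3.symm.trans h2

/-- The part of `U j` over the image of `A` is the preimage of `A` under `g j i`, which is open. -/
lemma isOpenMap_glueMk (i : ι) : IsOpenMap (glueMk U V g i) := by
  intro A hA
  refine isOpen_coinduced.2 (isOpen_sigma_iff.2 fun j => ?_)
  have e : (Sigma.mk j ⁻¹' (Quot.mk (glueRel U V g) ⁻¹' (glueMk U V g i '' A))) =
      (img (V j i) (pre (g j i).base (g j i).continuous_base ⟨A, hA⟩) : Set (U j).carrier) := by
    ext x
    constructor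
    · rintro ⟨a, ha, e⟩
      obtain ⟨h1, h2⟩ := (hg.glueMk_eq_iff (i := j) (j := i) (a := x) (b := a)).1 e.symm
      refine ⟨⟨x, h1⟩, ?_, rfl⟩
      change (g j i).base ⟨x, h1⟩ ∈ A
      rw [h2]
      exact ha
    · rintro ⟨y, hy, rfl⟩
      exact ⟨_, hy, (Quot.sound ⟨y.2, rfl⟩ : glueMk U V g j y.1 = glueMk U V g i _).symm⟩
  exact (congrArg IsOpen e).mpr (Opens.isOpen _)

lemma le_img (O : Opens (GlueSpace U V g)) (i : ι)
    (hO : (O : Set (GlueSpace U V g)) ⊆ Set.range (glueMk U V g i)) (j : ι) :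
    gluePre U V g O j ≤
      img (V j i) (pre (g j i).base (g j i).continuous_base (gluePre U V g O i)) := by
  intro x hx
  obtain ⟨a, ha⟩ := hO hx
  obtain ⟨h1, h2⟩ := hg.glueMk_eq_iff.1 ha.symm
  refine ⟨⟨x, h1⟩, ?_, rfl⟩
  change glueMk U V g i ((g j i).base ⟨x, h1⟩) ∈ O
  have h3 : (g j i).base ⟨x, h1⟩ = a := h2
  rw [h3, ha]
  exact hx

/-- A section on the piece `U i` is spread to every piece `U j` by pullback along `g j i`. The
results correspond to each other because going from `U j` to `U i` directly or through `U k` is the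
same morphism. -/
lemma extend_compat (O : Opens (GlueSpace U V g)) (i : ι)
    (hO : (O : Set (GlueSpace U V g)) ⊆ Set.range (glueMk U V g i))
    (s : (U i).sec (gluePre U V g O i)) (j k : ι) :
    (U j).res (glue_le U V g O j k) ((U j).res (hg.le_img O i hO j) ((g j i).app _ s)) =
      (g j k).app _ ((U k).res (hg.le_img O i hO k) ((g k i).app _ s)) := by
  let Q := pre (g j k).base (g j k).continuous_base (gluePre U V g O k)
  let A : Opens (U j).carrier := img (V j k) Q
  have hAk : A ≤ V j k := by rintro _ ⟨x, -, rfl⟩; exact x.2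
  have hAi : A ≤ img (V j i) (pre (g j i).base (g j i).continuous_base (gluePre U V g O i)) :=
    (glue_le U V g O j k).trans (hg.le_img O i hO j)
  have hAi' : A ≤ V j i := fun x hx => by
    obtain ⟨y, -, rfl⟩ := hAi hx
    exact y.2
  -- `W` factors the passage from `A` to `U k` through the domain of `g k i`, and its composite with
  -- `g k i` is the direct passage to `U i`.
  obtain ⟨W, hW1, hW2⟩ := hg.trans ((hg.loc j).restrict A)
    (hg.symm ((hg.loc j).restrict A) (linked_incl (g := g) A hAk)) (linked_incl (g := g) A hAi')
  have htop : img A ⊤ ≤ A := by rintro _ ⟨x, -, rfl⟩; exact x.2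
  have hQ : (⊤ : Opens ((U j).restrict A).carrier) ≤
      pre (inclLE hAk).base (inclLE hAk).continuous_base Q := by
    intro x _
    refine (congrArg (fun z => z ∈ Q) (inclLE_base hAk x)).mpr ?_
    obtain ⟨_, y, hy, rfl⟩ := x
    exact hy
  have hP : (⊤ : Opens ((U j).restrict A).carrier) ≤
      pre (inclLE hAi').base (inclLE hAi').continuous_base
        (pre (g j i).base (g j i).continuous_base (gluePre U V g O i)) := by
    intro x _
    refine (congrArg (fun z => z ∈ pre (g j i).base (g j i).continuous_base (gluePre U V g O i))
      (inclLE_base hAi' x)).mpr ?_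
    obtain ⟨y, hy, hyx⟩ := hAi x.2
    have : y = ⟨x.1, hAi' x.2⟩ := Subtype.ext hyx
    rw [← this]
    exact hy
  refine res_injective_of_le htop (fun x hx => ⟨⟨x, hx⟩, trivial, rfl⟩) ?_
  have hWP : (⊤ : Opens ((U j).restrict A).carrier) ≤ pre W.base W.continuous_base
      (pre (g k i).base (g k i).continuous_base (gluePre U V g O i)) := by
    have : (⊤ : Opens ((U j).restrict A).carrier) ≤ pre (W ≫ g k i).base
        (W ≫ g k i).continuous_base (gluePre U V g O i) := by
      rw [hW2]
      exact le_pre_comp hP le_rfl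
    exact this
  have hYk : (⊤ : Opens ((U j).restrict A).carrier) ≤ pre (inclLE hAk ≫ g j k).base
      (inclLE hAk ≫ g j k).continuous_base (gluePre U V g O k) := le_pre_comp hQ le_rfl
  -- both sides are the pullback of `s` along `T ⟶ U i`
  have left : (U j).res htop ((U j).res (glue_le U V g O j k)
      ((U j).res (hg.le_img O i hO j) ((g j i).app _ s))) =
      pullOn (inclLE hAi' ≫ g j i) (le_pre_comp hP le_rfl) s := by
    rw [pullOn_comp _ _ hP le_rfl s, ← app_eq_pullOn]
    refine Eq.trans ?_ (pullOn_inclLE hAi' hP _ (htop.trans hAi)).symm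
    exact (congrArg ((U j).res htop) ((U j).res_res _ _ _)).trans ((U j).res_res _ _ _)
  have right : (U j).res htop ((g j k).app _ ((U k).res (hg.le_img O i hO k) ((g k i).app _ s))) =
      pullOn (inclLE hAk ≫ g j k) hYk ((U k).res (hg.le_img O i hO k) ((g k i).app _ s)) := by
    rw [pullOn_comp _ _ hQ le_rfl, ← app_eq_pullOn]
    exact (pullOn_inclLE hAk hQ _ htop).symm
  have hYk' := hYk.trans (pre_mono (f := (inclLE hAk ≫ g j k).base)
    (hf := (inclLE hAk ≫ g j k).continuous_base) (hg.le_img O i hO k))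
  have hYk'' : (⊤ : Opens ((U j).restrict A).carrier) ≤ pre (W ≫ (U k).incl (V k i)).base
      (W ≫ (U k).incl (V k i)).continuous_base
      (img (V k i) (pre (g k i).base (g k i).continuous_base (gluePre U V g O i))) := by
    rw [hW1]
    exact hYk'
  have mid : pullOn (inclLE hAk ≫ g j k) hYk
      ((U k).res (hg.le_img O i hO k) ((g k i).app _ s)) =
      pullOn (inclLE hAi' ≫ g j i) (le_pre_comp hP le_rfl) s :=
    (pullOn_res _ hYk (hg.le_img O i hO k) _ hYk').trans
      ((pullOn_congr hW1.symm hYk' hYk'' _).trans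
        ((pullOn_comp_incl W hWP _ hYk'').trans
          (((congrArg _ (app_eq_pullOn (g k i) _ s)).trans
            (pullOn_comp W (g k i) hWP le_rfl s (le_pre_comp hWP le_rfl)).symm).trans
              (pullOn_congr hW2 _ _ _))))
  exact left.trans (mid.symm.trans right.symm)

/-- Over the image of `U i`, a glued section is determined by its `i`-th component, by `le_img`, and
every `i`-th component occurs, by `extend_compat`. -/
theorem isOpenImm_glueIncl (i : ι) : IsOpenImm (glueIncl U V g i) where
  emb := .of_continuous_injective_isOpenMap (continuous_glueMk U V g i) (hg.glueMk_injective i)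
    (hg.isOpenMap_glueMk i)
  bij A O h hO := by
    have e : A = gluePre U V g O i := le_antisymm h fun x hx => by
      obtain ⟨a, ha, e⟩ := hO hx
      rwa [← hg.glueMk_injective i e]
    subst e
    have hO' : ((show Opens (GlueSpace U V g) from O : Opens (GlueSpace U V g)) :
        Set (GlueSpace U V g)) ⊆ Set.range (glueMk U V g i) :=
      hO.trans (Set.image_subset_range _ _)
    have key : ∀ f : (glue U V g).sec O, pullOn (glueIncl U V g i) h f = f.1 i := fun f =>
      (U i).res_self _ _
    constructor
    · intro f f' hff
      rw [key, key] at hff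
      refine Subtype.ext (funext fun j => ?_)
      refine res_injective_of_le (glue_le U V g O j i) (hg.le_img O i hO' j) ?_
      rw [f.2 j i, f'.2 j i, hff]
    · intro s
      refine ⟨⟨fun j => (U j).res (hg.le_img O i hO' j) ((g j i).app _ s),
        hg.extend_compat O i hO' s⟩, ?_⟩
      refine (key _).trans ?_
      change (U i).res _ _ = s
      obtain ⟨W, hW1, hW2⟩ := hg.refl (hg.loc i) i (𝟙 (U i))
      have hWP : gluePre U V g O i ≤ pre W.base W.continuous_base
          (pre (g i i).base (g i i).continuous_base (gluePre U V g O i)) := by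
        have : gluePre U V g O i ≤ pre (W ≫ g i i).base
            (W ≫ g i i).continuous_base (gluePre U V g O i) := by
          rw [hW2]
          exact le_refl _
        exact this
      have h1 : gluePre U V g O i ≤ pre (W ≫ (U i).incl (V i i)).base
          (W ≫ (U i).incl (V i i)).continuous_base
          (img (V i i) (pre (g i i).base (g i i).continuous_base (gluePre U V g O i))) := by
        rw [hW1]
        exact hg.le_img O i hO' i
      have e1 : (U i).res (hg.le_img O i hO' i) ((g i i).app _ s) =
          pullOn (W ≫ (U i).incl (V i i)) h1 ((g i i).app _ s) :=
        (pullOn_id _ _).symm.trans (pullOn_congr hW1.symm (hg.le_img O i hO' i) h1 _)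
      refine e1.trans ((pullOn_comp_incl W hWP _ h1).trans
        (((congrArg _ (app_eq_pullOn (g i i) _ s)).trans
          (pullOn_comp W (g i i) hWP le_rfl s (le_pre_comp hWP le_rfl)).symm).trans
            ((pullOn_congr hW2 _ le_rfl _).trans ((U i).res_self _ _))))

/-- The two maps from `V i j` to the glued space agree by the definition of its sections.
Conversely, equality of base maps puts `X` into `V i j`, and the open immersion of `U j` can be
cancelled. -/
lemma linked_iff {T : SuperSpace} {i j : ι} {X : T ⟶ U i} {Y : T ⟶ U j} :
    Linked U V g i j X Y ↔ X ≫ glueIncl U V g i = Y ≫ glueIncl U V g j := by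
  have hcomp : (U i).incl (V i j) ≫ glueIncl U V g i = g i j ≫ glueIncl U V g j := by
    refine hom_ext (fun x => Quot.sound ⟨x.2, rfl⟩) fun O f A hA hA' => ?_
    have h1 : A ≤ pre (g i j).base (g i j).continuous_base (gluePre U V g O j) := hA'
    have e1 : pullOn ((U i).incl (V i j) ≫ glueIncl U V g i) hA f =
        (U i).res ((img_mono _ h1).trans (glue_le U V g O i j)) (f.1 i) :=
      (U i).res_res _ _ _
    refine e1.trans (((U i).res_res (img_mono (V i j) h1) (glue_le U V g O i j) (f.1 i)).symm.trans ?_)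
    exact (congrArg ((U i).res (img_mono (V i j) h1)) (f.2 i j)).trans rfl
  constructor
  · rintro ⟨W, rfl, rfl⟩
    rw [Category.assoc, Category.assoc, hcomp]
  · intro h
    have hX : ∀ t, X.base t ∈ V i j := fun t => by
      have := congrArg (fun q : T ⟶ glue U V g => q.base t) h
      exact (hg.glueMk_eq_iff.1 this).choose
    refine ⟨liftIncl _ X hX, liftIncl_comp _ _ _, (hg.isOpenImm_glueIncl j).cancel ?_⟩
    rw [Category.assoc, ← hcomp, ← Category.assoc, liftIncl_comp, h]

lemma exists_local_lift {T : SuperSpace} (x : T ⟶ glue U V g) (t : T.carrier) :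
    ∃ (W : Opens T.carrier) (i : ι) (X : T.restrict W ⟶ U i),
      t ∈ W ∧ X ≫ glueIncl U V g i = T.incl W ≫ x := by
  obtain ⟨⟨i, a⟩, ha⟩ := Quot.exists_rep (x.base t)
  let R : Opens (glue U V g).carrier :=
    ⟨Set.range (glueMk U V g i), (hg.isOpenMap_glueMk i).isOpen_range⟩
  let W := pre x.base x.continuous_base R
  obtain ⟨X, hX⟩ := (hg.isOpenImm_glueIncl i).exists_lift (T.incl W ≫ x) fun t => t.2
  exact ⟨W, i, X, ⟨a, ha⟩, hX⟩

end IsGluing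

end gluing

/-! ### Supermatrices of points -/

section supermatrix

variable {T S M : SuperSpace} {a b c d e f : ℕ}

/-- The parity of a position of a supermatrix. -/
def blockParity (r : SIx a b) (s : SIx c d) : ZMod 2 := if SameParity r s then 0 else 1

lemma blockParity_add (r : SIx a b) (s : SIx c d) (t : SIx e f) :
    blockParity r s + blockParity s t = blockParity r t := by
  unfold blockParity SameParity
  generalize r.isLeft = x
  generalize s.isLeft = y
  generalize t.isLeft = z
  revert x y z
  decide

/-- A supermatrix is homogeneous of parity `p` if its entries have that parity in the even blocks
and the other one in the odd blocks. -/
def HasParity (T : SuperSpace) (p : ZMod 2) (B : Matrix (SIx a b) (SIx c d) (T.sec ⊤)) : Prop :=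
  ∀ r s, B r s ∈ T.parity ⊤ (p + blockParity r s)

lemma hasParity_zero_iff {B : Matrix (SIx a b) (SIx c d) (T.sec ⊤)} :
    HasParity T 0 B ↔ IsEvenMatrix T B := by
  simp only [HasParity, zero_add, blockParity, IsEvenMatrix]

lemma HasParity.mul {p q : ZMod 2} {B : Matrix (SIx a b) (SIx c d) (T.sec ⊤)}
    {C : Matrix (SIx c d) (SIx e f) (T.sec ⊤)} (hB : HasParity T p B) (hC : HasParity T q C) :
    HasParity T (p + q) (B * C) := by
  intro r t
  rw [Matrix.mul_apply]
  refine Submodule.sum_mem _ fun s _ => ?_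
  have h := T.mul_mem_parity ⊤ _ _ _ _ (hB r s) (hC s t)
  rwa [add_add_add_comm, blockParity_add] at h

lemma IsEvenMatrix.mul {B : Matrix (SIx a b) (SIx c d) (T.sec ⊤)}
    {C : Matrix (SIx c d) (SIx e f) (T.sec ⊤)} (hB : IsEvenMatrix T B) (hC : IsEvenMatrix T C) :
    IsEvenMatrix T (B * C) :=
  hasParity_zero_iff.1 ((hasParity_zero_iff.2 hB).mul (hasParity_zero_iff.2 hC))

lemma isEvenMatrix_one : IsEvenMatrix T (1 : Matrix (SIx a b) (SIx a b) (T.sec ⊤)) := by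
  intro r s
  by_cases h : r = s
  · subst h
    rw [Matrix.one_apply_eq, if_pos rfl]
    exact T.one_mem_parity ⊤
  · rw [Matrix.one_apply_ne h]
    exact Submodule.zero_mem _

lemma parity_disjoint (p : ZMod 2) {x : T.sec ⊤} (h : x ∈ T.parity ⊤ p)
    (h' : x ∈ T.parity ⊤ (1 + p)) : x = 0 := by
  have hp : p = 0 ∨ p = 1 := by clear h h'; revert p; decide
  rcases hp with rfl | rfl
  · exact Submodule.disjoint_def.1 (T.isCompl_parity ⊤).disjoint _ h h'
  · exact Submodule.disjoint_def.1 (T.isCompl_parity ⊤).disjoint _ h' h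

lemma exists_parity_add (p : ZMod 2) (x : T.sec ⊤) :
    ∃ y ∈ T.parity ⊤ p, ∃ z ∈ T.parity ⊤ (1 + p), y + z = x := by
  obtain ⟨y, hy, z, hz, h⟩ := Submodule.mem_sup.1
    ((T.isCompl_parity ⊤).codisjoint.eq_top ▸ (Submodule.mem_top : x ∈ ⊤))
  have hp : p = 0 ∨ p = 1 := by revert p; decide
  rcases hp with rfl | rfl
  · exact ⟨y, hy, z, hz, h⟩
  · exact ⟨z, hz, y, hy, (add_comm _ _).trans h⟩

/-- The inverse of an even supermatrix is even. -/
lemma IsEvenMatrix.of_mul_eq_one {B C : Matrix (SIx a b) (SIx a b) (T.sec ⊤)}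
    (hB : IsEvenMatrix T B) (h : B * C = 1) (h' : C * B = 1) : IsEvenMatrix T C := by
  have ex := fun r s => exists_parity_add (blockParity r s) (C r s)
  choose y hy z hz hyz using ex
  have hC : C = Matrix.of y + Matrix.of z := by
    ext1 r s
    exact (hyz r s).symm
  have hY : HasParity T 0 (Matrix.of y) := fun r s => by
    rw [zero_add]
    exact hy r s
  have hZ : HasParity T 1 (Matrix.of z) := fun r s => hz r s
  have hB0 := hasParity_zero_iff.2 hB
  have hBY := hB0.mul hY
  have hBZ := hB0.mul hZ
  -- The left side is odd and the right side even, so both vanish; hence the odd part of the inverse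
  -- is zero.
  have hsum : B * Matrix.of z = 1 - B * Matrix.of y := by
    rw [← h, hC, mul_add, add_sub_cancel_left]
  have h0 : B * Matrix.of z = 0 := by
    ext1 r s
    refine parity_disjoint (blockParity r s) ?_ ?_
    · rw [hsum]
      have h1 := hasParity_zero_iff.2 (isEvenMatrix_one (T := T) (a := a) (b := b)) r s
      have h2 := hBY r s
      rw [zero_add] at h1
      rw [zero_add, zero_add] at h2
      exact Submodule.sub_mem _ h1 h2
    · have h2 := hBZ r s
      rwa [zero_add] at h2
  have hz0 : Matrix.of z = 0 := by
    rw [← one_mul (Matrix.of z), ← h', mul_assoc, h0, mul_zero]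
  rw [hC, hz0, add_zero]
  exact hasParity_zero_iff.1 hY

end supermatrix

lemma evenCoord_mem_parity {E O : Type} [Fintype E] [Fintype O] (e : E) :
    (evenCoord e : (superdomain E O).sec ⊤) ∈ (superdomain E O).parity ⊤ 0 := fun _ =>
  SetLike.algebraMap_mem_graded (extParity O) _

lemma oddCoord_mem_parity {E O : Type} [Fintype E] [Fintype O] [DecidableEq O] (o : O) :
    (oddCoord o : (superdomain E O).sec ⊤) ∈ (superdomain E O).parity ⊤ 1 := fun _ =>
  CliffordAlgebra.ι_mem_evenOdd_one _ _

namespace KLIndex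

variable {k l m n : ℕ} (J : KLIndex k l m n)

lemma col_injective : Function.Injective J.col :=
  Sum.map_injective.2 ⟨J.even.injective, J.odd.injective⟩

lemma sameParity_col (r s : SIx k l) : SameParity r (J.col s) ↔ SameParity r s := by
  rcases s with s | s <;> rfl

lemma eq_of_minor_of_rest {R : Type} {A B : Matrix (SIx k l) (SIx m n) R} (h : J.minor A = J.minor B)
    (h' : J.rest A = J.rest B) : A = B := by
  ext1 r c
  by_cases hc : J.Mem c
  · obtain ⟨s, rfl⟩ := hc
    exact congrFun (congrFun h r) s
  · exact congrFun (congrFun h' r) ⟨c, hc⟩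

variable {T S : SuperSpace} {J}

lemma minor_tilde (Y : T ⟶ J.chart) : J.minor (J.tilde Y) = 1 := by
  ext1 r s
  change J.tilde Y r (J.col s) = _
  rw [tilde, dif_pos ⟨s, rfl⟩, Matrix.one_apply]
  simp only [J.col_injective.eq_iff]

lemma minor_body (x : J.EvenPos → ℝ) : J.minor (J.body x) = 1 := by
  ext1 r s
  change J.body x r (J.col s) = _
  rw [body, dif_pos ⟨s, rfl⟩, Matrix.one_apply]
  simp only [J.col_injective.eq_iff]

lemma tilde_comp (φ : S ⟶ T) (Y : T ⟶ J.chart) :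
    J.tilde (φ ≫ Y) = (J.tilde Y).map (pullHom φ) := by
  ext1 r c
  rw [Matrix.map_apply]
  unfold tilde
  split_ifs
  · exact (map_one _).symm
  · exact (map_zero _).symm
  · exact pull_comp _ _ _
  · exact pull_comp _ _ _

/-- As `J.tilde Y` has identity columns at `J`, the factor `u` can only be `J.minor B`. In this
form, "having the coordinates of `B`" is equality up to an invertible left factor. -/
lemma isPoint_iff {Y : T ⟶ J.chart} {B : Matrix (SIx k l) (SIx m n) (T.sec ⊤)} :
    J.IsPoint Y B ↔ ∃ u : (Matrix (SIx k l) (SIx k l) (T.sec ⊤))ˣ, B = u.1 * J.tilde Y := by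
  constructor
  · rintro ⟨⟨u, hu⟩, h⟩
    refine ⟨u, ?_⟩
    have h1 : J.tilde Y = u⁻¹.1 * B := by
      refine J.eq_of_minor_of_rest ?_ ?_
      · rw [minor_tilde]
        change 1 = u⁻¹.1 * J.minor B
        rw [← hu, Units.inv_mul]
      · rw [h, ← hu, Ring.inverse_unit]
    rw [h1, ← Matrix.mul_assoc, Units.mul_inv, Matrix.one_mul]
  · rintro ⟨u, rfl⟩
    have h1 : J.minor (u.1 * J.tilde Y) = u.1 := by
      change u.1 * J.minor (J.tilde Y) = u.1
      rw [minor_tilde, mul_one]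
    refine ⟨h1.symm ▸ u.isUnit, ?_⟩
    rw [h1, Ring.inverse_unit, ← Matrix.mul_assoc, Units.inv_mul, Matrix.one_mul]

lemma IsPoint.comp {Y : T ⟶ J.chart} {B : Matrix (SIx k l) (SIx m n) (T.sec ⊤)}
    (h : J.IsPoint Y B) (φ : S ⟶ T) : J.IsPoint (φ ≫ Y) (B.map (pullHom φ)) := by
  obtain ⟨u, rfl⟩ := isPoint_iff.1 h
  refine isPoint_iff.2 ⟨Units.map (pullHom φ).mapMatrix.toMonoidHom u, ?_⟩
  rw [Matrix.map_mul, tilde_comp]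
  rfl

lemma isEvenMatrix_tilde (Y : T ⟶ J.chart) : IsEvenMatrix T (J.tilde Y) := by
  intro r c
  unfold tilde
  by_cases h1 : J.Mem c
  · rw [dif_pos h1]
    by_cases h2 : J.col r = c
    · subst h2
      rw [if_pos rfl, if_pos ((J.sameParity_col r r).2 rfl)]
      exact T.one_mem_parity ⊤
    · rw [if_neg h2]
      exact Submodule.zero_mem _
  · rw [dif_neg h1]
    by_cases h2 : SameParity r c
    · rw [dif_pos h2, if_pos h2]
      exact pull_parity Y 0 _ (evenCoord_mem_parity (E := J.EvenPos) (O := J.OddPos) _)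
    · rw [dif_neg h2, if_neg h2]
      exact pull_parity Y 1 _ (oddCoord_mem_parity (E := J.EvenPos) (O := J.OddPos) _)

lemma isEvenMatrix_minor {B : Matrix (SIx k l) (SIx m n) (T.sec ⊤)} (h : IsEvenMatrix T B) :
    IsEvenMatrix T (J.minor B) := by
  intro r s
  have := h r (J.col s)
  simp only [J.sameParity_col] at this
  exact this

end KLIndex

open KLIndex

namespace SuperSpace

variable {k l m n : ℕ} {J : KLIndex k l m n} {T : SuperSpace}

namespace LocSuper

variable (hT : LocSuper T)
include hT

lemma tilde_injective {X Y : T ⟶ J.chart} (h : J.tilde X = J.tilde Y) : X = Y := by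
  refine hT.hom_ext (E := J.EvenPos) (O := J.OddPos) ?_ ?_
  · rintro ⟨⟨r, c⟩, hc, hp⟩
    have := congrFun (congrFun h r) c
    simp only [tilde] at this
    rwa [dif_neg hc, dif_pos hp, dif_neg hc, dif_pos hp] at this
  · rintro ⟨⟨r, c⟩, hc, hp⟩
    have := congrFun (congrFun h r) c
    simp only [tilde] at this
    rwa [dif_neg hc, dif_neg hp, dif_neg hc, dif_neg hp] at this

lemma exists_tilde_eq {A : Matrix (SIx k l) (SIx m n) (T.sec ⊤)} (hA : IsEvenMatrix T A)
    (h : J.minor A = 1) : ∃ Y : T ⟶ J.chart, J.tilde Y = A := by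
  obtain ⟨Y, h1, h2⟩ := hT.exists_hom (E := J.EvenPos) (O := J.OddPos)
    (fun p => A p.1.1 p.1.2) (fun p => A p.1.1 p.1.2)
    (fun p => by simpa only [if_pos p.2.2] using hA p.1.1 p.1.2)
    (fun p => by simpa only [if_neg p.2.2] using hA p.1.1 p.1.2)
  change T ⟶ J.chart at Y
  refine ⟨Y, J.eq_of_minor_of_rest ((minor_tilde Y).trans h.symm) ?_⟩
  ext1 r ⟨c, hc⟩
  change J.tilde Y r c = A r c
  rw [tilde, dif_neg hc]
  split_ifs with hp
  · exact h1 ⟨(r, c), hc, hp⟩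
  · exact h2 ⟨(r, c), hc, hp⟩

lemma isPoint_unique {X Y : T ⟶ J.chart} {B : Matrix (SIx k l) (SIx m n) (T.sec ⊤)}
    (hX : J.IsPoint X B) (hY : J.IsPoint Y B) : X = Y :=
  hT.tilde_injective (J.eq_of_minor_of_rest ((minor_tilde X).trans (minor_tilde Y).symm)
    (hX.2.trans hY.2.symm))

/-- The inverse of an even supermatrix is even, so `(M_J B)⁻¹B` is even with identity columns at
`J`; its other entries are admissible coordinates. -/
lemma exists_isPoint {B : Matrix (SIx k l) (SIx m n) (T.sec ⊤)} (hB : IsEvenMatrix T B)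
    (h : IsUnit (J.minor B)) : ∃ Y : T ⟶ J.chart, J.IsPoint Y B := by
  obtain ⟨u, hu⟩ := h
  have h1 : IsEvenMatrix T u⁻¹.1 := IsEvenMatrix.of_mul_eq_one
    (by rw [hu]; exact isEvenMatrix_minor hB) u.mul_inv u.inv_mul
  obtain ⟨Y, hY⟩ := hT.exists_tilde_eq (J := J) (h1.mul hB)
    (by change u⁻¹.1 * J.minor B = 1; rw [← hu, Units.inv_mul])
  refine ⟨Y, isPoint_iff.2 ⟨u, ?_⟩⟩
  rw [hY, ← Matrix.mul_assoc, Units.mul_inv, Matrix.one_mul]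

lemma map_body_tilde (t : T.carrier) (X : T ⟶ J.chart) :
    (J.tilde X).map (hT.body t) = J.body (X.base t) := by
  ext1 r c
  rw [Matrix.map_apply]
  unfold tilde KLIndex.body
  split_ifs with h1 h2 h3
  · exact map_one _
  · exact map_zero _
  · exact hT.body_pull t (E := J.EvenPos) (O := J.OddPos) X _
  · exact hT.body_odd t (E := J.EvenPos) (O := J.OddPos) X _

end LocSuper

end SuperSpace

/-! ### The transition maps -/

section transitions

variable {k l m n : ℕ} {I J K : KLIndex k l m n} {T S : SuperSpace}

lemma locSuper_chart (I : KLIndex k l m n) : LocSuper I.chart :=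
  locSuper_superdomain I.EvenPos I.OddPos

namespace KLIndex

lemma isPoint_tilde_refl (X : T ⟶ I.chart) : I.IsPoint X (I.tilde X) :=
  isPoint_iff.2 ⟨1, (Matrix.one_mul _).symm⟩

lemma IsPoint.symm {X : T ⟶ I.chart} {Y : T ⟶ J.chart} (h : J.IsPoint Y (I.tilde X)) :
    I.IsPoint X (J.tilde Y) := by
  obtain ⟨u, hu⟩ := isPoint_iff.1 h
  refine isPoint_iff.2 ⟨u⁻¹, ?_⟩
  rw [hu, ← Matrix.mul_assoc, Units.inv_mul, Matrix.one_mul]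

lemma IsPoint.trans {B : Matrix (SIx k l) (SIx m n) (T.sec ⊤)} {X : T ⟶ I.chart}
    {Y : T ⟶ J.chart} (h : I.IsPoint X B) (h' : J.IsPoint Y (I.tilde X)) : J.IsPoint Y B := by
  obtain ⟨u, rfl⟩ := isPoint_iff.1 h
  obtain ⟨v, hv⟩ := isPoint_iff.1 h'
  refine isPoint_iff.2 ⟨u * v, ?_⟩
  rw [hv, Units.val_mul, Matrix.mul_assoc]

/-- Left factors commute with right multiplication by `P`. Compatibility of the local maps with
changes of chart and with products rests on this. -/
lemma IsPoint.mul_right {B : Matrix (SIx k l) (SIx m n) (T.sec ⊤)} {X : T ⟶ I.chart}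
    {Y : T ⟶ J.chart} {P : Matrix (SIx m n) (SIx m n) (T.sec ⊤)} (h : I.IsPoint X B)
    (h' : J.IsPoint Y (I.tilde X * P)) : J.IsPoint Y (B * P) := by
  obtain ⟨u, rfl⟩ := isPoint_iff.1 h
  obtain ⟨v, hv⟩ := isPoint_iff.1 h'
  refine isPoint_iff.2 ⟨u * v, ?_⟩
  rw [Matrix.mul_assoc, hv, Units.val_mul, Matrix.mul_assoc]

lemma IsPoint.of_left {B : Matrix (SIx k l) (SIx m n) (T.sec ⊤)} {X : T ⟶ I.chart}
    {Y : T ⟶ J.chart} (h : I.IsPoint X B) (h' : J.IsPoint Y B) : J.IsPoint Y (I.tilde X) := by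
  obtain ⟨u, rfl⟩ := isPoint_iff.1 h
  obtain ⟨v, hv⟩ := isPoint_iff.1 h'
  refine isPoint_iff.2 ⟨u⁻¹ * v, ?_⟩
  rw [Units.val_mul, Matrix.mul_assoc, ← hv, ← Matrix.mul_assoc, Units.inv_mul, Matrix.one_mul]

end KLIndex

lemma base_mem_overlap (hT : LocSuper T) {X : T ⟶ I.chart} (h : IsUnit (J.minor (I.tilde X)))
    (t : T.carrier) : X.base t ∈ overlap I J := by
  have h1 := h.map (hT.body t).mapMatrix
  have h2 : (hT.body t).mapMatrix (J.minor (I.tilde X)) = J.minor (I.body (X.base t)) :=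
    congrArg J.minor (hT.map_body_tilde t X)
  exact (congrArg IsUnit h2).mp h1

/-- The overlap is defined by real matrices; by `LocSuper.isUnit_iff` these decide the invertibility
of the supermatrix as well. -/
lemma isUnit_minor_of_mem_overlap (hT : LocSuper T) {X : T ⟶ I.chart}
    (h : ∀ t, X.base t ∈ overlap I J) : IsUnit (J.minor (I.tilde X)) := by
  refine (hT.isUnit_iff _).2 fun t => ?_
  have h2 : (J.minor (I.tilde X)).map (hT.body t) = J.minor (I.body (X.base t)) :=
    congrArg J.minor (hT.map_body_tilde t X)
  exact (congrArg IsUnit h2).mpr (h t)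

lemma exists_isTransition (I J : KLIndex k l m n) :
    ∃ g : overlapSpace I J ⟶ J.chart, IsTransition I J g :=
  ((locSuper_chart I).restrict _).exists_isPoint (isEvenMatrix_tilde _)
    (isUnit_minor_of_mem_overlap ((locSuper_chart I).restrict _) fun t => t.2)

lemma IsTransition.unique {g g' : overlapSpace I J ⟶ J.chart} (h : IsTransition I J g)
    (h' : IsTransition I J g') : g = g' :=
  ((locSuper_chart I).restrict _).isPoint_unique h h'

variable (g : Transitions k l m n)

/-- The defining equation of the transition map is pulled back along `W`; conversely, coordinates
determine a point. -/
lemma linked_transitions_iff (hT : LocSuper T) {X : T ⟶ I.chart} {Y : T ⟶ J.chart} :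
    Linked KLIndex.chart overlap g.1 I J X Y ↔ J.IsPoint Y (I.tilde X) := by
  have key : ∀ W : T ⟶ overlapSpace I J,
      J.IsPoint (W ≫ g.1 I J) (I.tilde (W ≫ I.chart.incl (overlap I J))) := fun W => by
    rw [tilde_comp]
    exact IsPoint.comp (g.2 I J) W
  constructor
  · rintro ⟨W, rfl, rfl⟩
    exact key W
  · intro h
    have hm := base_mem_overlap hT h.1
    refine ⟨liftIncl _ X hm, liftIncl_comp _ _ _, hT.isPoint_unique ?_ h⟩
    have := key (liftIncl _ X hm)
    rwa [liftIncl_comp] at this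

/-- The cocycle conditions now say that differing by an invertible left factor is an equivalence
relation. -/
lemma isGluing_transitions : IsGluing KLIndex.chart overlap g.1 where
  loc := locSuper_chart
  refl hT _ X := (linked_transitions_iff g hT).2 (isPoint_tilde_refl X)
  symm hT _ _ _ _ h := (linked_transitions_iff g hT).2 ((linked_transitions_iff g hT).1 h).symm
  trans hT _ _ _ _ _ _ h h' := (linked_transitions_iff g hT).2
    (((linked_transitions_iff g hT).1 h).trans ((linked_transitions_iff g hT).1 h'))

/-- Points of charts that are equal in the supergrassmannian. -/
lemma comp_chartIncl_eq_iff (hT : LocSuper T) {X : T ⟶ I.chart} {Y : T ⟶ J.chart} :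
    X ≫ chartIncl g I = Y ≫ chartIncl g J ↔ J.IsPoint Y (I.tilde X) :=
  (isGluing_transitions g).linked_iff.symm.trans (linked_transitions_iff g hT)

end transitions

/-! ### Points of the general linear supergroup -/

section superGL

variable {m n : ℕ} {T S : SuperSpace}

lemma glMatrix_comp (φ : S ⟶ T) (P : T ⟶ superGL m n) :
    glMatrix (φ ≫ P) = (glMatrix P).map (pullHom φ) := by
  ext1 r c
  rw [Matrix.map_apply]
  unfold glMatrix
  dsimp only
  split_ifs
  · exact pull_comp φ (P ≫ _) _
  · exact pull_comp φ (P ≫ _) _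

lemma isEvenMatrix_glMatrix (P : T ⟶ superGL m n) : IsEvenMatrix T (glMatrix P) := by
  intro r c
  unfold glMatrix
  dsimp only
  by_cases h : SameParity r c
  · rw [dif_pos h, if_pos h]
    exact pull_parity _ 0 _ (evenCoord_mem_parity _)
  · rw [dif_neg h, if_neg h]
    exact pull_parity _ 1 _ (oddCoord_mem_parity _)

namespace SuperSpace.LocSuper

variable (hT : LocSuper T)
include hT

lemma map_body_glMatrix (t : T.carrier) (P : T ⟶ superGL m n) :
    (glMatrix P).map (hT.body t) = glBody (P.base t).1 := by
  ext1 r c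
  rw [Matrix.map_apply]
  unfold glMatrix glBody
  dsimp only
  split_ifs with h
  · exact hT.body_pull t (P ≫ (superdomain (GLEvenPos m n) (GLOddPos m n)).incl (glOpens m n)) _
  · exact hT.body_odd t (P ≫ (superdomain (GLEvenPos m n) (GLOddPos m n)).incl (glOpens m n)) _

lemma isUnit_glMatrix (P : T ⟶ superGL m n) : IsUnit (glMatrix P) := by
  refine (hT.isUnit_iff _).2 fun t => ?_
  rw [hT.map_body_glMatrix]
  exact (P.base t).2

lemma glMatrix_injective {P Q : T ⟶ superGL m n} (h : glMatrix P = glMatrix Q) : P = Q := by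
  refine incl_cancel (hT.hom_ext ?_ ?_)
  · rintro ⟨⟨r, c⟩, hp⟩
    have := congrFun (congrFun h r) c
    unfold glMatrix at this
    dsimp only at this
    rwa [dif_pos hp, dif_pos hp] at this
  · rintro ⟨⟨r, c⟩, hp⟩
    have := congrFun (congrFun h r) c
    unfold glMatrix at this
    dsimp only at this
    rwa [dif_neg hp, dif_neg hp] at this

lemma exists_glMatrix_eq {B : Matrix (SIx m n) (SIx m n) (T.sec ⊤)} (hB : IsEvenMatrix T B)
    (h : IsUnit B) : ∃ P : T ⟶ superGL m n, glMatrix P = B := by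
  obtain ⟨f, h1, h2⟩ := hT.exists_hom (E := GLEvenPos m n) (O := GLOddPos m n)
    (fun p => B p.1.1 p.1.2) (fun p => B p.1.1 p.1.2)
    (fun p => by simpa only [if_pos p.2] using hB p.1.1 p.1.2)
    (fun p => by simpa only [if_neg p.2] using hB p.1.1 p.1.2)
  -- The real matrix at `t` is the reduction of the invertible matrix `B`, so `f` lands in the open
  -- part.
  have hf : ∀ t, f.base t ∈ glOpens m n := fun t => by
    have h3 : (hT.body t).mapMatrix B = glBody (f.base t) := by
      ext1 r c
      change hT.body t (B r c) = _
      unfold glBody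
      split_ifs with hp
      · rw [← hT.body_pull t f, h1]
      · rw [← hT.body_odd t f ⟨(r, c), hp⟩, h2]
    change IsUnit (glBody (f.base t))
    rw [← h3]
    exact h.map _
  refine ⟨liftIncl (glOpens m n) f hf, ?_⟩
  ext1 r c
  have e := liftIncl_comp (glOpens m n) f hf
  unfold glMatrix
  dsimp only
  split_ifs with hp
  · exact (congrArg (fun q => pull q _) e).trans (h1 ⟨(r, c), hp⟩)
  · exact (congrArg (fun q => pull q _) e).trans (h2 ⟨(r, c), hp⟩)

theorem bijOn_glMatrix : Set.BijOn (fun P : T ⟶ superGL m n => glMatrix P) Set.univ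
    {B | IsUnit B ∧ IsEvenMatrix T B} :=
  ⟨fun P _ => ⟨hT.isUnit_glMatrix P, isEvenMatrix_glMatrix P⟩,
    fun _ _ _ _ h => hT.glMatrix_injective h, fun _ hB => by
      obtain ⟨P, hP⟩ := hT.exists_glMatrix_eq hB.2 hB.1
      exact ⟨P, trivial, hP⟩⟩

end SuperSpace.LocSuper

end superGL

/-! ### The refined cover -/

section selection

variable {k l m n : ℕ}

/-- A matrix with a right inverse has an invertible maximal square submatrix. -/
lemma exists_isUnit_submatrix (A : Matrix (Fin k) (Fin m) ℝ) (B : Matrix (Fin m) (Fin k) ℝ)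
    (h : A * B = 1) : ∃ e : Fin k ↪o Fin m, IsUnit (A.submatrix id e) := by
  -- The right inverse makes the columns span, so a linearly independent subfamily with the same
  -- span is a basis and has `k` members.
  obtain ⟨κ, a, ha, hspan, hli⟩ := exists_linearIndependent' ℝ A.col
  have htop : Submodule.span ℝ (Set.range A.col) = ⊤ := by
    rw [← Matrix.range_mulVecLin, LinearMap.range_eq_top]
    intro v
    exact ⟨B.mulVec v, by rw [Matrix.mulVecLin_apply, Matrix.mulVec_mulVec, h, Matrix.one_mulVec]⟩
  have : Finite κ := Finite.of_injective a ha
  have : Fintype κ := Fintype.ofFinite κ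
  let b : Module.Basis κ ℝ (Fin k → ℝ) := Module.Basis.mk hli (by rw [hspan, htop])
  have hcard : Fintype.card κ = k := by
    have := Module.finrank_eq_card_basis b
    rw [Module.finrank_fin_fun] at this
    exact this.symm
  let s : Finset (Fin m) := Finset.univ.map ⟨a, ha⟩
  have hs : s.card = k := by rw [Finset.card_map, Finset.card_univ, hcard]
  refine ⟨s.orderEmbOfFin hs, ?_⟩
  rw [← Matrix.linearIndependent_cols_iff_isUnit]
  have hmem : ∀ i, ∃ j : κ, a j = s.orderEmbOfFin hs i := fun i => by
    obtain ⟨j, -, hj⟩ := Finset.mem_map.1 (s.orderEmbOfFin_mem hs i)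
    exact ⟨j, hj⟩
  choose c hc using hmem
  have hcinj : Function.Injective c := fun i j hij =>
    (s.orderEmbOfFin hs).injective (by rw [← hc, ← hc, hij])
  have e : (A.submatrix id (s.orderEmbOfFin hs)).col = (A.col ∘ a) ∘ c := by
    funext i r
    change A r _ = A r _
    rw [hc]
  rw [e]
  exact hli.comp c hcinj

/-- A block diagonal matrix with a right inverse has an invertible submatrix of columns. -/
lemma exists_isUnit_minor (A : Matrix (SIx k l) (SIx m n) ℝ) (B : Matrix (SIx m n) (SIx k l) ℝ)
    (h : A * B = 1) (h0 : ∀ r c, ¬ SameParity r c → A r c = 0) :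
    ∃ J : KLIndex k l m n, IsUnit (J.minor A) := by
  have hA : A = Matrix.fromBlocks A.toBlocks₁₁ 0 0 A.toBlocks₂₂ := by
    ext1 (r | r) (c | c)
    · rfl
    · exact h0 _ _ (by simp)
    · exact h0 _ _ (by simp)
    · rfl
  rw [hA, ← Matrix.fromBlocks_toBlocks B, Matrix.fromBlocks_multiply, ← Matrix.fromBlocks_one,
    Matrix.fromBlocks_inj] at h
  obtain ⟨h1, -, -, h2⟩ := h
  rw [Matrix.zero_mul, add_zero] at h1
  rw [Matrix.zero_mul, zero_add] at h2
  obtain ⟨e, he⟩ := exists_isUnit_submatrix _ _ h1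
  obtain ⟨o, ho⟩ := exists_isUnit_submatrix _ _ h2
  refine ⟨⟨e, o⟩, ?_⟩
  have h3 : KLIndex.minor ⟨e, o⟩ A =
      Matrix.fromBlocks (A.toBlocks₁₁.submatrix id e) 0 0 (A.toBlocks₂₂.submatrix id o) := by
    rw [hA]
    ext1 (r | r) (c | c) <;> rfl
  rw [h3, Matrix.isUnit_iff_isUnit_det, Matrix.det_fromBlocks_zero₂₁]
  exact ((Matrix.isUnit_iff_isUnit_det _).1 he).mul ((Matrix.isUnit_iff_isUnit_det _).1 ho)

lemma exists_isUnit_minor_body (I : KLIndex k l m n) (x : I.EvenPos → ℝ) (p : GLEvenPos m n → ℝ)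
    (hp : IsUnit (glBody p)) : ∃ J : KLIndex k l m n, IsUnit (J.minor (I.body x * glBody p)) := by
  obtain ⟨u, hu⟩ := hp
  -- A right inverse of the product: undo `p`, then select the columns of `I`, where `I.body x` is
  -- the identity.
  refine exists_isUnit_minor _ (u⁻¹.1 * (1 : Matrix (SIx m n) (SIx m n) ℝ).submatrix id I.col) ?_ ?_
  · rw [← hu, ← Matrix.mul_assoc, Matrix.mul_assoc (I.body x), Units.mul_inv, Matrix.mul_one]
    have : I.body x * (1 : Matrix (SIx m n) (SIx m n) ℝ).submatrix id I.col =
        I.minor (I.body x * (1 : Matrix (SIx m n) (SIx m n) ℝ)) := rfl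
    rw [this, Matrix.mul_one, minor_body]
  · intro r c hrc
    rw [Matrix.mul_apply]
    refine Finset.sum_eq_zero fun s _ => ?_
    by_cases hs : SameParity r s
    · have hsc : ¬ SameParity s c := fun h => hrc (hs.trans h)
      rw [glBody, dif_neg hsc, mul_zero]
    · have : I.body x r s = 0 := by
        unfold KLIndex.body
        split_ifs with h1 h2
        · subst h2
          exact absurd ((I.sameParity_col r r).2 rfl) hs
        · rfl
        · rfl
      rw [this, zero_mul]

end selection

/-! ### Local maps on the points of the supergrassmannian -/

section action

variable {k l m n : ℕ} {I J K H : KLIndex k l m n} {T S : SuperSpace}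

lemma SuperSpace.LocSuper.exists_isUnit_pull {ν : Type} [Fintype ν] [DecidableEq ν]
    (hT : LocSuper T) (t : T.carrier) (B : Matrix ν ν (T.sec ⊤))
    (h : IsUnit (B.map (hT.body t))) :
    ∃ V : Opens T.carrier, t ∈ V ∧ IsUnit (B.map (pullHom (T.incl V))) := by
  obtain ⟨V, ht, hV⟩ := hT.exists_isUnit t B h
  refine ⟨V, ht, ?_⟩
  have hle : img V ⊤ ≤ V := by rintro _ ⟨x, -, rfl⟩; exact x.2
  have h1 := hV.map (T.res hle).mapMatrix
  have h2 : (T.res hle).mapMatrix (B.map (T.res (le_top : V ≤ ⊤))) =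
      B.map (pullHom (T.incl V)) := by
    ext1 r s
    exact (T.res_res _ _ _).trans (pullOn_incl V (le_pre_top ⊤) (B r s)).symm
  exact (congrArg IsUnit h2).mp h1

lemma isLocalValue_comp {P : T ⟶ superGL m n} {X : T ⟶ I.chart} {Y : T ⟶ J.chart}
    (h : IsLocalValue P I J X Y) (φ : S ⟶ T) :
    IsLocalValue (φ ≫ P) I J (φ ≫ X) (φ ≫ Y) := by
  have := IsPoint.comp h φ
  rw [Matrix.map_mul, ← tilde_comp, ← glMatrix_comp] at this
  exact this

lemma SuperSpace.LocSuper.exists_isLocalValue (hT : LocSuper T) {P : T ⟶ superGL m n}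
    {X : T ⟶ I.chart} (h : X ∈ refinedCover P I J) : ∃ Y, IsLocalValue P I J X Y :=
  hT.exists_isPoint ((isEvenMatrix_tilde X).mul (isEvenMatrix_glMatrix P)) h

/-- The change from `J` to `K` is included because the second local map may start in a different
chart from the one in which the first ended. -/
lemma isLocalValue_trans {P Q R : T ⟶ superGL m n} (hR : glMatrix R = glMatrix P * glMatrix Q)
    {X : T ⟶ I.chart} {Y : T ⟶ J.chart} {Y' : T ⟶ K.chart} {Z : T ⟶ H.chart}
    (h : IsLocalValue P I J X Y) (h' : K.IsPoint Y' (J.tilde Y)) (h'' : IsLocalValue Q K H Y' Z) :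
    IsLocalValue R I H X Z := by
  unfold IsLocalValue
  rw [hR, ← Matrix.mul_assoc]
  exact (h.trans h').mul_right h''

variable (g : Transitions k l m n)

/-- The values of the local maps at points that are equal in the supergrassmannian are equal. -/
lemma comp_chartIncl_eq_of_isLocalValue (hT : LocSuper T) {P : T ⟶ superGL m n} {X : T ⟶ I.chart}
    {Y : T ⟶ J.chart} {X' : T ⟶ K.chart} {Y' : T ⟶ H.chart}
    (e : X ≫ chartIncl g I = X' ≫ chartIncl g K) (h : IsLocalValue P I J X Y)
    (h' : IsLocalValue P K H X' Y') : Y ≫ chartIncl g J = Y' ≫ chartIncl g H :=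
  (comp_chartIncl_eq_iff g hT).2
    (IsPoint.of_left h (IsPoint.mul_right ((comp_chartIncl_eq_iff g hT).1 e) h'))

/-- After a lift to a chart, some minor of the real matrix at `t` is invertible by
`exists_isUnit_minor_body`, and the minor of the supermatrix is then invertible near `t`. -/
theorem exists_mem_refinedCover (hT : LocSuper T) (x : T ⟶ supergrassmannian g)
    (P : T ⟶ superGL m n) (t : T.carrier) :
    ∃ (V : Opens T.carrier) (I J : KLIndex k l m n) (X : T.restrict V ⟶ I.chart),
      t ∈ V ∧ X ≫ chartIncl g I = T.incl V ≫ x ∧ X ∈ refinedCover (T.incl V ≫ P) I J := by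
  obtain ⟨W, I, X, ht, hX⟩ := (isGluing_transitions g).exists_local_lift x t
  change X ≫ chartIncl g I = T.incl W ≫ x at hX
  have hW := hT.restrict W
  obtain ⟨s, hs⟩ : ∃ s : (T.restrict W).carrier, (T.incl W).base s = t := ⟨⟨t, ht⟩, rfl⟩
  let B := I.tilde X * glMatrix (T.incl W ≫ P)
  obtain ⟨J, hJ⟩ := exists_isUnit_minor_body I (X.base s) ((T.incl W ≫ P).base s).1
    ((T.incl W ≫ P).base s).2
  have hB : (J.minor B).map (hW.body s) =
      J.minor (I.body (X.base s) * glBody ((T.incl W ≫ P).base s).1) := by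
    rw [← hW.map_body_tilde, ← hW.map_body_glMatrix, ← Matrix.map_mul]
    rfl
  obtain ⟨V', ht', hV'⟩ := hW.exists_isUnit_pull s (J.minor B) (hB ▸ hJ)
  have hle : img W V' ≤ W := by rintro _ ⟨x, -, rfl⟩; exact x.2
  -- This identifies an open part of `T` with the corresponding open part of an open part.
  let j : T.restrict (img W V') ⟶ (T.restrict W).restrict V' := liftIncl V' (inclLE hle) fun s => by
    refine (congrArg (fun z => z ∈ V') (inclLE_base hle s)).mpr ?_
    obtain ⟨_, y, hy, rfl⟩ := s
    exact hy
  have hj : j ≫ (T.restrict W).incl V' = inclLE hle := liftIncl_comp _ _ _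
  refine ⟨img W V', I, J, inclLE hle ≫ X, ⟨s, ht', hs⟩, ?_, ?_⟩
  · exact (Category.assoc _ _ _).trans ((congrArg (inclLE hle ≫ ·) hX).trans
      (inclLE_comp_assoc hle x))
  · have h1 := hV'.map (pullHom j).mapMatrix
    have h2 : (pullHom j).mapMatrix ((J.minor B).map (pullHom ((T.restrict W).incl V'))) =
        J.minor (I.tilde (inclLE hle ≫ X) * glMatrix (T.incl (img W V') ≫ P)) := by
      rw [← inclLE_comp_assoc hle P, tilde_comp, glMatrix_comp, ← Matrix.map_mul, ← hj]
      ext1 r s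
      exact (pullHom_comp_apply j _ _).symm
    exact (congrArg IsUnit h2).mp h1

/-! ### The action -/

/-- `y` is the result of acting with `P` on `x`: wherever the local maps are defined, they take
`x` to `y`. -/
def IsActionValue (x : T ⟶ supergrassmannian g) (P : T ⟶ superGL m n)
    (y : T ⟶ supergrassmannian g) : Prop :=
  ∀ (S : SuperSpace) (_ : LocSuper S) (φ : S ⟶ T) (I J : KLIndex k l m n) (X : S ⟶ I.chart)
    (Y : S ⟶ J.chart), X ≫ chartIncl g I = φ ≫ x → IsLocalValue (φ ≫ P) I J X Y →
      φ ≫ y = Y ≫ chartIncl g J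

/-- Local values on a refined cover glue because values at equal points of `G` are equal in `G`. The
same comparison, made locally on `S`, yields the condition for every `φ`. -/
theorem exists_isActionValue (hT : LocSuper T) (x : T ⟶ supergrassmannian g)
    (P : T ⟶ superGL m n) : ∃ y, IsActionValue g x P y := by
  choose V I J X hV hX hXJ using exists_mem_refinedCover g hT x P
  choose Y hY using fun t => (hT.restrict (V t)).exists_isLocalValue (hXJ t)
  have compat : ∀ {S : SuperSpace} (_ : LocSuper S) (φ : S ⟶ T) (t : T.carrier)
      (j : S ⟶ T.restrict (V t)) (K H : KLIndex k l m n) (X' : S ⟶ K.chart) (Y' : S ⟶ H.chart),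
      j ≫ T.incl (V t) = φ → X' ≫ chartIncl g K = φ ≫ x → IsLocalValue (φ ≫ P) K H X' Y' →
      j ≫ Y t ≫ chartIncl g (J t) = Y' ≫ chartIncl g H := by
    rintro S hS _ t j K H X' Y' rfl hX' hY'
    rw [← Category.assoc]
    refine comp_chartIncl_eq_of_isLocalValue g hS (X := j ≫ X t) ?_ ?_ hY'
    · rw [Category.assoc, hX, hX', Category.assoc]
    · rw [Category.assoc]
      exact isLocalValue_comp (hY t) j
  obtain ⟨y, hy⟩ := exists_glueHom V (fun t => ⟨t, hV t⟩) (fun t => Y t ≫ chartIncl g (J t))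
    fun i j => by
      rw [← Category.assoc (inclLE inf_le_right)]
      refine compat (hT.restrict _) (T.incl (V i ⊓ V j)) i _ _ _ (inclLE inf_le_right ≫ X j) _
        (inclLE_comp _) ?_ ?_
      · rw [Category.assoc, hX, inclLE_comp_assoc]
      · rw [← inclLE_comp_assoc inf_le_right P]
        exact isLocalValue_comp (hY j) _
  refine ⟨y, fun S hS φ K H X' Y' hX' hY' => hom_ext_local fun s => ?_⟩
  let W : Opens S.carrier := pre φ.base φ.continuous_base (V (φ.base s))
  let j : S.restrict W ⟶ T.restrict (V (φ.base s)) := liftIncl _ (S.incl W ≫ φ) fun z => z.2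
  have hj : j ≫ T.incl (V (φ.base s)) = S.incl W ≫ φ := liftIncl_comp _ _ _
  refine ⟨W, hV (φ.base s), ?_⟩
  rw [← Category.assoc, ← hj, Category.assoc, hy, ← Category.assoc (S.incl W)]
  refine compat (hS.restrict W) (S.incl W ≫ φ) _ j K H (S.incl W ≫ X') _ hj ?_ ?_
  · rw [Category.assoc, hX', Category.assoc]
  · rw [Category.assoc]
    exact isLocalValue_comp hY' _

/-- The refined pieces cover `T` and carry local values, so equality may be tested on them. -/
lemma eq_of_isLocalValue (hT : LocSuper T) {x : T ⟶ supergrassmannian g} {P : T ⟶ superGL m n}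
    {y y' : T ⟶ supergrassmannian g}
    (h : ∀ (V : Opens T.carrier) (I J : KLIndex k l m n) (X : T.restrict V ⟶ I.chart)
      (Y : T.restrict V ⟶ J.chart), X ≫ chartIncl g I = T.incl V ≫ x →
        IsLocalValue (T.incl V ≫ P) I J X Y → T.incl V ≫ y = T.incl V ≫ y') : y = y' := by
  refine hom_ext_local fun t => ?_
  obtain ⟨V, I, J, X, ht, hX, hXJ⟩ := exists_mem_refinedCover g hT x P t
  obtain ⟨Y, hY⟩ := (hT.restrict V).exists_isLocalValue hXJ
  exact ⟨V, ht, h V I J X Y hX hY⟩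

variable {g}

lemma IsActionValue.unique (hT : LocSuper T) {x : T ⟶ supergrassmannian g} {P : T ⟶ superGL m n}
    {y y' : T ⟶ supergrassmannian g} (h : IsActionValue g x P y) (h' : IsActionValue g x P y') :
    y = y' :=
  eq_of_isLocalValue g hT fun V I J X Y hX hY =>
    (h _ (hT.restrict V) _ I J X Y hX hY).trans (h' _ (hT.restrict V) _ I J X Y hX hY).symm

/-- The condition quantifies over all `S` over `T`, so it is stable under change of base; naturality
of the action comes from here. -/
lemma IsActionValue.comp {x : T ⟶ supergrassmannian g} {P : T ⟶ superGL m n}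
    {y : T ⟶ supergrassmannian g} (h : IsActionValue g x P y) (φ : S ⟶ T) :
    IsActionValue g (φ ≫ x) (φ ≫ P) (φ ≫ y) := fun _ hR ψ I J X Y hX hY => by
  rw [← Category.assoc] at hX hY ⊢
  exact h _ hR (ψ ≫ φ) I J X Y hX hY

/-- Localize twice: to a refined piece for `x` and `P`, then to one for its value and `Q`. There
both sides are the local value computed by `isLocalValue_trans`. -/
lemma IsActionValue.mul (hT : LocSuper T) {P Q R : T ⟶ superGL m n}
    (hR : glMatrix R = glMatrix P * glMatrix Q) {x y z w : T ⟶ supergrassmannian g}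
    (hy : IsActionValue g x P y) (hz : IsActionValue g y Q z) (hw : IsActionValue g x R w) :
    z = w := by
  refine eq_of_isLocalValue g (x := x) (P := P) hT fun V I J X Y hX hY => ?_
  have hYy := hy _ (hT.restrict V) _ I J X Y hX hY
  refine eq_of_isLocalValue g (x := Y ≫ chartIncl g J) (P := T.incl V ≫ Q) (hT.restrict V)
    fun V' K H Y' Z hY' hZ => ?_
  have hV' := (hT.restrict V).restrict V'
  have hY'' : K.IsPoint Y' (J.tilde ((T.restrict V).incl V' ≫ Y)) :=
    (comp_chartIncl_eq_iff g hV').1 (by rw [Category.assoc, hY'])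
  have e1 := hz _ hV' ((T.restrict V).incl V' ≫ T.incl V) K H Y' Z
    (by rw [hY', ← hYy, Category.assoc]) (by rw [Category.assoc]; exact hZ)
  have e2 := hw _ hV' ((T.restrict V).incl V' ≫ T.incl V) I H ((T.restrict V).incl V' ≫ X) Z
    (by rw [Category.assoc, hX, Category.assoc]) (by
      have h1 := isLocalValue_comp hY ((T.restrict V).incl V')
      rw [← Category.assoc] at h1 hZ
      refine isLocalValue_trans ?_ h1 hY'' hZ
      rw [glMatrix_comp, glMatrix_comp, glMatrix_comp, hR, Matrix.map_mul])
  rw [Category.assoc] at e1 e2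
  exact e1.trans e2.symm

/-- In any chart `X̃` is its own normal form, so the local map with `J = I` fixes `X`. -/
lemma IsActionValue.one (hT : LocSuper T) {E : T ⟶ superGL m n} (hE : glMatrix E = 1)
    {x y : T ⟶ supergrassmannian g} (h : IsActionValue g x E y) : y = x := by
  refine hom_ext_local fun t => ?_
  obtain ⟨V, I, X, ht, hX⟩ := (isGluing_transitions g).exists_local_lift x t
  refine ⟨V, ht, (h _ (hT.restrict V) _ I I X X hX ?_).trans hX⟩
  unfold IsLocalValue
  rw [glMatrix_comp, hE, Matrix.map_one _ (map_zero _) (map_one _), Matrix.mul_one]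
  exact isPoint_tilde_refl X

end action

end Super

end

/-! ### The proposition -/

theorem mainTheorem2 (k l m n : ℕ) :
    ∃ g : Transitions k l m n, (∀ g' : Transitions k l m n, g' = g) ∧
      (∀ (T : Supermanifold) (P : T.space ⟶ superGL m n),
        (∀ (I J : KLIndex k l m n), ∀ X ∈ refinedCover P I J,
          ∃! Y : T.space ⟶ J.chart, IsLocalValue P I J X Y) ∧
        (∀ (I J K H : KLIndex k l m n) (X : T.space ⟶ overlapSpace I K)
          (Y : T.space ⟶ J.chart) (Z : T.space ⟶ H.chart),
          IsLocalValue P I J (X ≫ I.chart.incl (overlap I K)) Y →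
          IsLocalValue P K H (X ≫ g.1 I K) Z →
          ∃ W : T.space ⟶ overlapSpace J H,
            W ≫ J.chart.incl (overlap J H) = Y ∧ W ≫ g.1 J H = Z) ∧
        (∀ (x : T.space ⟶ supergrassmannian g) (t : T.space.carrier),
          ∃ (V : TopologicalSpace.Opens T.space.carrier) (I J : KLIndex k l m n)
            (X : T.space.restrict V ⟶ I.chart),
            t ∈ V ∧ X ≫ chartIncl g I = T.space.incl V ≫ x ∧
              X ∈ refinedCover (T.space.incl V ≫ P) I J)) ∧
      (∀ T : Supermanifold, Set.BijOn (fun P : T.space ⟶ superGL m n => glMatrix P) Set.univ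
        {B | IsUnit B ∧ IsEvenMatrix T.space B}) ∧
      ∃ a : PointMaps g,
        IsGluedFromLocal g a ∧ (∀ a' : PointMaps g, IsGluedFromLocal g a' → a' = a) ∧
        IsNatural g a ∧ IsRightAction g a ∧
        ∀ (N : Supermanifold) (p : N.space ⟶ supergrassmannian g) (q : N.space ⟶ superGL m n),
          IsProduct N p q →
          ∃! α : N.space ⟶ supergrassmannian g,
            ∀ (T : Supermanifold) (h : T.space ⟶ N.space), h ≫ α = a T (h ≫ p) (h ≫ q) := by
  choose t ht using exists_isTransition (k := k) (l := l) (m := m) (n := n)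
  let g : Transitions k l m n := ⟨t, ht⟩
  refine ⟨g, fun g' => Subtype.ext (funext fun I => funext fun J =>
    (g'.2 I J).unique (ht I J)), fun T P => ⟨fun I J X hX => ?_, fun I J K H X Y Z hY hZ => ?_,
    fun x s => exists_mem_refinedCover g T.locSuper x P s⟩, fun T => T.locSuper.bijOn_glMatrix, ?_⟩
  · obtain ⟨Y, hY⟩ := T.locSuper.exists_isLocalValue hX
    exact ⟨Y, hY, fun Y' hY' => T.locSuper.isPoint_unique hY' hY⟩
  -- Compatibility with the transition maps is equality of the two values in `G`, which holds since
  -- the two arguments are equal in `G`.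
  · refine (isGluing_transitions g).linked_iff.2
      (comp_chartIncl_eq_of_isLocalValue g T.locSuper ?_ hY hZ)
    exact (isGluing_transitions g).linked_iff.1 ⟨X, rfl, rfl⟩
  · choose a ha using fun T : Supermanifold => exists_isActionValue g T.locSuper
    have hnat : IsNatural g a := fun S T φ x P =>
      (ha S _ _).unique S.locSuper ((ha T x P).comp φ)
    refine ⟨a, fun T x P V I J X Y hX hY => ha T x P _ (T.locSuper.restrict V) _ I J X Y hX hY,
      fun a' ha' => funext fun T => funext fun x => funext fun P =>
        eq_of_isLocalValue g (x := x) (P := P) T.locSuper fun V I J X Y hX hY =>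
          (ha' T x P V I J X Y hX hY).trans
            (ha T x P _ (T.locSuper.restrict V) _ I J X Y hX hY).symm,
      hnat, fun T x => ⟨fun P Q R hR => (ha T x P).mul T.locSuper hR (ha T _ Q) (ha T x R),
        fun E hE => (ha T x E).one T.locSuper hE⟩, fun N p q _ => ?_⟩
    -- The value at the pair of projections induces the family by naturality. Conversely, `h = 𝟙`
    -- forces this value.
    refine ⟨a N p q, fun T h => (hnat T N h p q).symm, fun α hα => ?_⟩
    have := hα N (𝟙 N.space)
    rwa [Category.id_comp, Category.id_comp, Category.id_comp] at this
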